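/- All graphs are finite and simple. A path decomposition of a graph $G$ is a finite collection of subgraphs of $G$, each of which is a path, such that every edge of $G$ belongs to precisely one of them; it is called good if it consists of at most $\lceil |V(G)|/2\rceil$ paths. Let $k\in\mathbb{N}$. Let $G$ be a connected graph with maximum degree $\Delta(G)\le k$ that admits no good path decomposition, and suppose that $G$ is vertex-minimal with these properties, i.e. every connected graph $H$ with $\Delta(H)\le k$ and $|V(H)|<|V(G)|$ admits a good path decomposition. Then $G$ contains none of the following configurations (where $d(x)$ denotes the degree of $x$ in $G$): - $C_1$: a vertex of degree $2$ whose two neighbours are not adjacent; - $C_2$: a cut-edge $uv$ such that $d(u)$ and $d(v)$ are both even; - $C_3$: an edge $uv$ with $d(u)=d(v)=4$ such that $u$ and $v$ have precisely two common neighbours; - $C_4$: an edge $uv$ with $d(u)=d(v)=4$ such that the three neighbours of $u$ other than $v$ can be labelled $t_1,t_2,t_3$ and the three neighbours of $v$ other than $u$ can be labelled $w_1,w_2,w_3$ in such a way that $t_1t_2$ and $w_1w_2$ are not edges of $G$ and $t_3\ne w_3$ (the sets $\{t_1,t_2,t_3\}$ and $\{w_1,w_2,w_3\}$ may intersect); -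 $C_5$: a triangle $uvw$ with $d(u)=4$ and $d(v),d(w)\in\{2,4\}$. -/

import Mathlib

universe u

namespace GallaiPaths

/-- A subgraph of `G` is a path if it consists of the vertices and edges traversed by some walk
without repeated vertices. (A single vertex is a path of length zero.) -/
def IsPathSubgraph {V : Type u} {G : SimpleGraph V} (P : G.Subgraph) : Prop :=
  ∃ (a b : V) (p : G.Walk a b), p.IsPath ∧ P = p.toSubgraph

/-- A path decomposition of `G`: a finite collection of subgraphs of `G`, each of them a path,
such that every edge of `G` belongs to precisely one of them. -/
def IsPathDecomposition {V : Type u} (G : SimpleGraph V) (D : Finset G.Subgraph) : Prop :=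
  (∀ P ∈ D, IsPathSubgraph P) ∧ ∀ e ∈ G.edgeSet, ∃! P : G.Subgraph, P ∈ D ∧ e ∈ P.edgeSet

/-- `G` admits a good path decomposition: one into at most `⌈n / 2⌉` paths, `n = |V(G)|`. -/
def HasGoodPathDecomposition {V : Type u} [Fintype V] (G : SimpleGraph V) : Prop :=
  ∃ D : Finset G.Subgraph, IsPathDecomposition G D ∧ D.card ≤ ⌈(Fintype.card V : ℚ) / 2⌉₊

/-- `G` is connected with maximum degree at most `k` and has no good path decomposition. -/
def IsCounterexample (k : ℕ) {V : Type u} [Fintype V] (G : SimpleGraph V)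
    [DecidableRel G.Adj] : Prop :=
  G.Connected ∧ G.maxDegree ≤ k ∧ ¬ HasGoodPathDecomposition G

/-- `G` is a counterexample for `k`, and no graph with fewer vertices is one. (Every finite graph
has an isomorphic copy in any given universe, so one universe suffices.) -/
def IsMinimalCounterexample (k : ℕ) {V : Type u} [Fintype V] (G : SimpleGraph V)
    [DecidableRel G.Adj] : Prop :=
  IsCounterexample k G ∧
    ∀ (W : Type u) [Fintype W] (H : SimpleGraph W) [DecidableRel H.Adj],
      Fintype.card W < Fintype.card V → ¬ IsCounterexample k H

section Configurations

variable {V : Type u} [Fintype V] (G : SimpleGraph V) [DecidableRel G.Adj]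

/-- A vertex of degree 2 whose neighbours are not adjacent. -/
def ContainsC1 : Prop :=
  ∃ v a b : V, G.degree v = 2 ∧ G.neighborSet v = {a, b} ∧ ¬ G.Adj a b

/-- A cut-edge whose two ends have even degree. -/
def ContainsC2 : Prop :=
  ∃ u v : V, G.Adj u v ∧ G.IsBridge s(u, v) ∧ Even (G.degree u) ∧ Even (G.degree v)

/-- An edge between two vertices of degree 4 with precisely two common neighbours. -/
def ContainsC3 : Prop :=
  ∃ u v : V, G.Adj u v ∧ (G.commonNeighbors u v).ncard = 2 ∧ G.degree u = 4 ∧ G.degree v = 4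

/-- An edge `uv` between two vertices of degree 4, where the three other neighbours of `u` and of
`v` can be labelled `t₁, t₂, t₃` and `w₁, w₂, w₃` such that `t₁t₂` and `w₁w₂` are not edges and
`t₃ ≠ w₃`. The degree condition makes the three labels on each side distinct. -/
def ContainsC4 : Prop :=
  ∃ u v t₁ t₂ t₃ w₁ w₂ w₃ : V, G.Adj u v ∧ G.degree u = 4 ∧ G.degree v = 4 ∧
    G.neighborSet u \ {v} = {t₁, t₂, t₃} ∧ G.neighborSet v \ {u} = {w₁, w₂, w₃} ∧
    ¬ G.Adj t₁ t₂ ∧ ¬ G.Adj w₁ w₂ ∧ t₃ ≠ w₃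

/-- A triangle `uvw` with `d(u) = 4` and `d(v), d(w) ∈ {2, 4}`. -/
def ContainsC5 : Prop :=
  ∃ u v w : V, G.Adj u v ∧ G.Adj v w ∧ G.Adj u w ∧ G.degree u = 4 ∧
    (G.degree v = 2 ∨ G.degree v = 4) ∧ (G.degree w = 2 ∨ G.degree w = 4)

end Configurations

end GallaiPaths

/-! Each configuration is reducible. One or two vertices are deleted, and edges possibly added, so
that a smaller graph of maximum degree at most `k` arises; the decomposition that minimality grants
for it is rerouted through the deleted vertices. Deleting two vertices lowers the bound ⌈n/2⌉ by
exactly one, which leaves room for one new path. An added edge whose ends were joined through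
deleted vertices is subdivided by them (`Dec.subdivide`), which costs nothing.

The difficulty is connectedness. If components are decomposed separately, each odd one costs an
extra half (`dec_closed`), and rounding absorbs a single half. If three vertices meet all components
and at least two components are odd, then an odd component `K` and the rest fit exactly into the
bound for the whole graph (`dec_or_odd_comps`), with no room for the new path. That path has to be
absorbed by `K`: as |K| is odd, `K` can be enlarged by one vertex without raising its bound
(`exists_isDec_end`, `attach`).

C1 is one subdivision. For C2, each end of the cut-edge has odd degree on its own side, hence ends a
path there, and the cut-edge joins the two paths (`IsMin.not_cut_edge`).

For C4 with distinct pairs, `u` and `v` are deleted and `t₁t₂`, `w₁w₂` added; these are subdivided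
by `u` and `v`, and the new path is `t₃ u v w₃`. Should this fail, `t₁` and `w₁` lie in different
odd components (`PairConfig.odd_comps`), and the positions of `t₃` and `w₃` relative to them lead to
a cut-edge, to a reduction at the cut-vertex `v`, to a reduction that keeps `u`, or to a relabelled
configuration excluded by the same lemma (`PairConfig.false`). C3 has its own reroutings, and it
also covers C4 with equal pairs.

For C5 with a vertex of degree two, the two deleted vertices are threaded through a path at `u`. If
all three degrees are four, C3 makes any two triangle vertices share both or none of their outer
neighbours: either all three share both, which is rerouted directly, or some vertex of the triangle
shares none with the other two, which is an instance of C4.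

Paths are duplicate-free vertex lists and edge sets are multisets, so that covering every edge
exactly once is an equation between sums of multisets. -/

namespace GallaiPaths

/-! ### Edges of a path given as a list of vertices -/

section Lists

variable {V : Type u}

/-- The multiset of edges traversed by a list of vertices. -/
def pathEdges : List V → Multiset (Sym2 V)
  | [] => 0
  | [_] => 0
  | a :: b :: l => s(a, b) ::ₘ pathEdges (b :: l)

@[simp] lemma pathEdges_nil : pathEdges ([] : List V) = 0 := rfl

@[simp] lemma pathEdges_singleton (a : V) : pathEdges [a] = 0 := rfl

lemma pathEdges_cons_cons (a b : V) (l : List V) :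
    pathEdges (a :: b :: l) = {s(a, b)} + pathEdges (b :: l) := by
  simp [pathEdges]

/-- The cut vertex is kept in both pieces, so no edge is lost. All reroutings cut paths at named
vertices in this way and reassemble the pieces. -/
lemma pathEdges_append_cons (A : List V) (a : V) (B : List V) :
    pathEdges (A ++ a :: B) = pathEdges (A ++ [a]) + pathEdges (a :: B) := by
  induction A with
  | nil => simp
  | cons c A ih =>
    cases A with
    | nil => simp [pathEdges]
    | cons d A => simpa [pathEdges] using ih

lemma pathEdges_append_cons_cons (A : List V) (a b : V) (B : List V) :
    pathEdges (A ++ a :: b :: B) = pathEdges (A ++ [a]) + ({s(a, b)} + pathEdges (b :: B)) := by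
  rw [pathEdges_append_cons, pathEdges_cons_cons]

lemma pathEdges_concat_concat (A : List V) (a b : V) :
    pathEdges (A ++ [a, b]) = pathEdges (A ++ [a]) + {s(a, b)} := by
  rw [pathEdges_append_cons_cons]; simp

lemma pathEdges_reverse (l : List V) : pathEdges l.reverse = pathEdges l := by
  induction l with
  | nil => simp
  | cons a l ih =>
    cases l with
    | nil => simp
    | cons b l =>
      rw [List.reverse_cons, List.reverse_cons, List.append_assoc, List.singleton_append,
        pathEdges_concat_concat, ← List.reverse_cons, ih, pathEdges_cons_cons, add_comm,
        Sym2.eq_swap]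

lemma pathEdges_reverse_concat (A : List V) (a : V) :
    pathEdges (a :: A.reverse) = pathEdges (A ++ [a]) := by
  rw [← pathEdges_reverse]; simp

lemma mem_of_mem_pathEdges {l : List V} {e : Sym2 V} (he : e ∈ pathEdges l) {x : V}
    (hx : x ∈ e) : x ∈ l := by
  induction l with
  | nil => simp at he
  | cons a l ih =>
    cases l with
    | nil => simp at he
    | cons b l =>
      rw [pathEdges_cons_cons] at he
      rcases Multiset.mem_add.1 he with h | h
      · rw [Multiset.mem_singleton] at h
        subst h
        rcases Sym2.mem_iff.1 hx with rfl | rfl <;> simp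
      · exact List.mem_cons_of_mem _ (ih h)

lemma exists_split_of_mem_pathEdges {l : List V} {a b : V} (h : s(a, b) ∈ pathEdges l) :
    ∃ A B, l = A ++ a :: b :: B ∨ l = A ++ b :: a :: B := by
  induction l with
  | nil => simp at h
  | cons c l ih =>
    cases l with
    | nil => simp at h
    | cons d l =>
      rw [pathEdges_cons_cons] at h
      rcases Multiset.mem_add.1 h with h | h
      · rw [Multiset.mem_singleton, Sym2.eq_iff] at h
        rcases h with ⟨rfl, rfl⟩ | ⟨rfl, rfl⟩
        · exact ⟨[], l, .inl rfl⟩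
        · exact ⟨[], l, .inr rfl⟩
      · obtain ⟨A, B, h | h⟩ := ih h
        · exact ⟨c :: A, B, .inl (by simp [h])⟩
        · exact ⟨c :: A, B, .inr (by simp [h])⟩

end Lists

open scoped Classical

/-! ### Path decompositions and elementary operations on them -/

section Decompositions

variable {V : Type u}

/-- The number of edges of `E` at `x`. -/
noncomputable def deg (E : Multiset (Sym2 V)) (x : V) : ℕ := E.countP (x ∈ ·)

@[simp] lemma deg_zero (x : V) : deg (0 : Multiset (Sym2 V)) x = 0 := rfl

@[simp] lemma deg_add (E F : Multiset (Sym2 V)) (x : V) : deg (E + F) x = deg E x + deg F x :=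
  Multiset.countP_add _ _ _

@[simp] lemma deg_cons (e : Sym2 V) (E : Multiset (Sym2 V)) (x : V) :
    deg (e ::ₘ E) x = deg E x + if x ∈ e then 1 else 0 := by
  simp [deg, Multiset.countP_cons]

@[simp] lemma deg_singleton (e : Sym2 V) (x : V) :
    deg {e} x = if x ∈ e then 1 else 0 := by
  simpa using deg_cons e 0 x

lemma deg_le_of_le {E F : Multiset (Sym2 V)} (h : E ≤ F) (x : V) : deg E x ≤ deg F x :=
  Multiset.countP_le_of_le _ h

lemma deg_eq_zero {E : Multiset (Sym2 V)} {x : V} (h : ∀ e ∈ E, x ∉ e) : deg E x = 0 :=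
  Multiset.countP_eq_zero.2 h

lemma exists_mem_of_deg_ne_zero {E : Multiset (Sym2 V)} {x : V} (h : deg E x ≠ 0) :
    ∃ e ∈ E, x ∈ e := by
  by_contra! hh
  exact h (deg_eq_zero hh)

/-- `L` is a decomposition of the edges `E` into paths with vertices in `S`. -/
def IsDec (S : Set V) (E : Multiset (Sym2 V)) (L : Multiset (List V)) : Prop :=
  (∀ p ∈ L, p.Nodup ∧ ∀ x ∈ p, x ∈ S) ∧ (L.map pathEdges).sum = E

/-- The edges `E` can be decomposed into at most `m` paths with vertices in `S`. -/
def Dec (S : Set V) (E : Multiset (Sym2 V)) (m : ℕ) : Prop :=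
  ∃ L, IsDec S E L ∧ L.card ≤ m

lemma isDec_zero (S : Set V) : IsDec S 0 0 := by simp [IsDec]

lemma IsDec.cons {S : Set V} {E : Multiset (Sym2 V)} {L : Multiset (List V)} (h : IsDec S E L)
    {p : List V} (hp : p.Nodup) (hS : ∀ x ∈ p, x ∈ S) : IsDec S (pathEdges p + E) (p ::ₘ L) := by
  refine ⟨?_, by simp [h.2]⟩
  intro q hq
  rcases Multiset.mem_cons.1 hq with rfl | hq
  · exact ⟨hp, hS⟩
  · exact h.1 q hq

/-- Isolates one path, with the other paths decomposing a remainder `F`; rerouting replaces that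
path and leaves `F` untouched. -/
lemma IsDec.uncons {S : Set V} {E : Multiset (Sym2 V)} {L : Multiset (List V)} {p : List V}
    (h : IsDec S E (p ::ₘ L)) : p.Nodup ∧ (∀ x ∈ p, x ∈ S) ∧
      ∃ F, IsDec S F L ∧ E = pathEdges p + F :=
  ⟨(h.1 p (by simp)).1, (h.1 p (by simp)).2, (L.map pathEdges).sum,
    ⟨fun q hq => h.1 q (by simp [hq]), rfl⟩, by simpa using h.2.symm⟩

lemma IsDec.mono {S T : Set V} {E : Multiset (Sym2 V)} {L : Multiset (List V)} (h : IsDec S E L)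
    (hST : S ⊆ T) : IsDec T E L :=
  ⟨fun p hp => ⟨(h.1 p hp).1, fun x hx => hST ((h.1 p hp).2 x hx)⟩, h.2⟩

lemma IsDec.add {S : Set V} {E F : Multiset (Sym2 V)} {L M : Multiset (List V)}
    (h : IsDec S E L) (h' : IsDec S F M) : IsDec S (E + F) (L + M) := by
  refine ⟨fun p hp => ?_, by simp [h.2, h'.2]⟩
  rcases Multiset.mem_add.1 hp with hp | hp
  · exact h.1 p hp
  · exact h'.1 p hp

lemma IsDec.reverse_head {S : Set V} {E : Multiset (Sym2 V)} {L : Multiset (List V)} {p : List V}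
    (h : IsDec S E (p ::ₘ L)) : IsDec S E (p.reverse ::ₘ L) := by
  obtain ⟨hp, hS, F, hF, rfl⟩ := h.uncons
  rw [← pathEdges_reverse]
  exact hF.cons (by simpa using hp) (by simpa using hS)

/-- Some path of a decomposition traverses a given edge. -/
lemma IsDec.exists_edge {S : Set V} {E : Multiset (Sym2 V)} {L : Multiset (List V)}
    (h : IsDec S E L) {a b : V} (hab : s(a, b) ∈ E) :
    ∃ A B L', IsDec S E ((A ++ a :: b :: B) ::ₘ L') ∧ L'.card + 1 = L.card := by
  rw [← h.2] at hab
  obtain ⟨p, hp, he⟩ := Multiset.mem_bind.1 hab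
  obtain ⟨L', rfl⟩ := Multiset.exists_cons_of_mem hp
  obtain ⟨A, B, rfl | rfl⟩ := exists_split_of_mem_pathEdges he
  · exact ⟨A, B, L', h, by simp⟩
  · exact ⟨B.reverse, A.reverse, L', by simpa using h.reverse_head, by simp⟩

/-- Some path of a decomposition passes through a given vertex of positive degree. -/
lemma IsDec.exists_vertex {S : Set V} {E : Multiset (Sym2 V)} {L : Multiset (List V)}
    (h : IsDec S E L) {a : V} (ha : deg E a ≠ 0) :
    ∃ A B L', IsDec S E ((A ++ a :: B) ::ₘ L') ∧ L'.card + 1 = L.card := by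
  obtain ⟨e, he, hae⟩ := exists_mem_of_deg_ne_zero ha
  obtain ⟨b, rfl⟩ := Sym2.mem_iff_exists.1 hae
  obtain ⟨A, B, L', hL, hc⟩ := h.exists_edge he
  exact ⟨A, b :: B, L', hL, hc⟩

lemma deg_pathEdges_cons_of_notMem {l : List V} {x : V} (h : x ∉ l) : deg (pathEdges l) x = 0 :=
  deg_eq_zero fun _ he hx => h (mem_of_mem_pathEdges he hx)

/-- A vertex at which a path has odd degree is an end of the path. -/
lemma exists_cons_of_odd_deg {l : List V} (hl : l.Nodup) {x : V}
    (h : Odd (deg (pathEdges l) x)) : ∃ B, l = x :: B ∨ l.reverse = x :: B := by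
  have hx : x ∈ l := by
    by_contra hx
    rw [deg_pathEdges_cons_of_notMem hx] at h
    simp at h
  obtain ⟨A, B, rfl⟩ := List.append_of_mem hx
  -- An interior vertex has exactly two path edges, which is even; so one side of `x` is empty.
  rcases List.eq_nil_or_concat A with rfl | ⟨A, a, rfl⟩
  · exact ⟨B, .inl rfl⟩
  rcases B with _ | ⟨b, B⟩
  · exact ⟨a :: A.reverse, .inr (by simp)⟩
  exfalso
  have e : pathEdges (A.concat a ++ x :: b :: B) =
      pathEdges (A ++ [a]) + ({s(a, x)} + ({s(x, b)} + pathEdges (b :: B))) := by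
    rw [List.concat_eq_append, List.append_assoc, List.singleton_append,
      pathEdges_append_cons_cons, pathEdges_cons_cons]
  rw [e] at h
  simp only [deg_add] at h
  rw [deg_pathEdges_cons_of_notMem (l := A ++ [a]), deg_pathEdges_cons_of_notMem (l := b :: B)] at h
  · simp at h
    exact absurd h (by decide)
  · rw [List.nodup_append] at hl
    exact (List.nodup_cons.1 hl.2.1).1
  · intro hx
    rw [List.nodup_append] at hl
    exact hl.2.2 x (by simpa using hx) x (by simp) rfl

/-- A vertex of odd degree is an end of some path of a decomposition. -/
lemma IsDec.exists_end {S : Set V} {E : Multiset (Sym2 V)} {L : Multiset (List V)}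
    (h : IsDec S E L) {a : V} (ha : Odd (deg E a)) :
    ∃ B L', IsDec S E ((a :: B) ::ₘ L') ∧ L'.card + 1 = L.card := by
  have key : ∃ p ∈ L, Odd (deg (pathEdges p) a) := by
    by_contra! hh
    simp only [Nat.not_odd_iff_even] at hh
    rw [← Nat.not_even_iff_odd, ← h.2] at ha
    apply ha
    clear ha h
    induction L using Multiset.induction with
    | empty => simp
    | cons p L ih =>
      simp only [Multiset.map_cons, Multiset.sum_cons, deg_add]
      exact (hh p (by simp)).add (ih fun q hq => hh q (by simp [hq]))
  obtain ⟨p, hp, hodd⟩ := key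
  obtain ⟨L', rfl⟩ := Multiset.exists_cons_of_mem hp
  obtain ⟨B, hB | hB⟩ := exists_cons_of_odd_deg (h.1 p hp).1 hodd
  · exact ⟨B, L', hB ▸ h, by simp⟩
  · exact ⟨B, L', hB ▸ h.reverse_head, by simp⟩

/-- Trivial paths are not needed. -/
lemma IsDec.exists_support {S : Set V} {F : Multiset (Sym2 V)} {L : Multiset (List V)}
    (h : IsDec S F L) {T : Set V} (hT : ∀ e ∈ F, ∀ x ∈ e, x ∈ T) :
    ∃ L', IsDec T F L' ∧ L'.card ≤ L.card := by
  -- Only a one-vertex path can leave `T`: on a longer path every vertex lies on an edge of `F`.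
  refine ⟨L.filter (fun p => 2 ≤ p.length), ⟨?_, ?_⟩, Multiset.card_le_card (Multiset.filter_le _ _)⟩
  · intro p hp
    rw [Multiset.mem_filter] at hp
    refine ⟨(h.1 p hp.1).1, fun x hx => ?_⟩
    have hmem : ∀ e ∈ pathEdges p, e ∈ F := by
      intro e he
      rw [← h.2]
      exact Multiset.mem_bind.2 ⟨p, hp.1, he⟩
    obtain ⟨A, B, rfl⟩ := List.append_of_mem hx
    rcases B with _ | ⟨b, B⟩
    · rcases List.eq_nil_or_concat A with rfl | ⟨A, a, rfl⟩
      · simp at hp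
      · refine hT s(a, x) (hmem _ ?_) x (by simp)
        rw [List.concat_eq_append, List.append_assoc, List.singleton_append,
          pathEdges_concat_concat]
        simp
    · refine hT s(x, b) (hmem _ ?_) x (by simp)
      rw [pathEdges_append_cons_cons]
      simp
  · rw [← h.2]
    clear h
    induction L using Multiset.induction with
    | empty => simp
    | cons p L ih =>
      rw [Multiset.filter_cons]
      split_ifs with hp
      · simp [ih]
      · have : pathEdges p = 0 := by
          rcases p with _ | ⟨a, _ | ⟨b, p⟩⟩ <;> simp_all
        simp [ih, this]

lemma Dec.mono {S T : Set V} {E : Multiset (Sym2 V)} {m m' : ℕ} (h : Dec S E m) (hST : S ⊆ T)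
    (hm : m ≤ m') : Dec T E m' := by
  obtain ⟨L, hL, hc⟩ := h
  exact ⟨L, hL.mono hST, hc.trans hm⟩

lemma Dec.add {S T : Set V} {E F : Multiset (Sym2 V)} {m m' : ℕ} (h : Dec S E m)
    (h' : Dec T F m') : Dec (S ∪ T) (E + F) (m + m') := by
  obtain ⟨L, hL, hc⟩ := h
  obtain ⟨M, hM, hc'⟩ := h'
  exact ⟨L + M, (hL.mono Set.subset_union_left).add (hM.mono Set.subset_union_right), by
    simpa using Nat.add_le_add hc hc'⟩

lemma dec_zero (S : Set V) : Dec S 0 0 := ⟨0, isDec_zero S, by simp⟩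

lemma dec_path {p : List V} (hp : p.Nodup) : Dec Set.univ (pathEdges p) 1 :=
  ⟨{p}, by simpa using (isDec_zero Set.univ).cons hp (by simp), by simp⟩

/-- An edge `ab` of a decomposed graph may be subdivided by new vertices. -/
lemma Dec.subdivide {S : Set V} {E : Multiset (Sym2 V)} {m : ℕ} {a b : V}
    (h : Dec S ({s(a, b)} + E) m) {M : List V} (hM : M.Nodup) (hS : ∀ x ∈ M, x ∉ S) :
    Dec (S ∪ {x | x ∈ M}) (pathEdges (a :: (M ++ [b])) + E) m := by
  obtain ⟨L, hL, hc⟩ := h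
  obtain ⟨A, B, L', hL, hc'⟩ := hL.exists_edge (a := a) (b := b) (by simp)
  obtain ⟨hp, hpS, F, hF, hE⟩ := hL.uncons
  have h1 : E = pathEdges (A ++ [a]) + pathEdges (b :: B) + F := by
    rw [pathEdges_append_cons_cons] at hE
    apply add_left_cancel (a := {s(a, b)})
    rw [hE]
    abel
  refine ⟨(A ++ a :: (M ++ b :: B)) ::ₘ L', ?_, by simpa [hc'] using hc⟩
  have h2 : pathEdges (a :: (M ++ [b])) + E = pathEdges (A ++ a :: (M ++ b :: B)) + F := by
    have e := pathEdges_append_cons (a :: M) b B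
    simp only [List.cons_append] at e
    rw [h1, pathEdges_append_cons A a (M ++ b :: B), e]
    abel
  rw [h2]
  refine (hF.mono Set.subset_union_left).cons ?_ ?_
  -- The subdividing vertices lie outside `S`, which contains the path, so no vertex is repeated.
  -- This is why decompositions record a vertex set.
  · have : ∀ x ∈ M, x ∉ A ++ a :: b :: B := fun x hx hx' => hS x hx (hpS x hx')
    grind [List.nodup_append]
  · intro x hx
    simp only [List.mem_append, List.mem_cons] at hx
    have := hpS x
    simp only [List.mem_append, List.mem_cons] at this
    simp only [Set.mem_union, Set.mem_ofPred_eq]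
    tauto

/-- A path ending at a vertex of odd degree may be prolonged to a new vertex. -/
lemma Dec.prolong {S : Set V} {E : Multiset (Sym2 V)} {m : ℕ} {a c : V} (h : Dec S E m)
    (ha : Odd (deg E a)) (hc : c ∉ S) : Dec (insert c S) ({s(c, a)} + E) m := by
  obtain ⟨L, hL, hm⟩ := h
  obtain ⟨B, L', hL, hc'⟩ := hL.exists_end ha
  obtain ⟨hp, hpS, F, hF, hE⟩ := hL.uncons
  refine ⟨(c :: a :: B) ::ₘ L', ?_, by simpa [hc'] using hm⟩
  rw [hE, ← add_assoc, ← pathEdges_cons_cons]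
  refine (hF.mono (Set.subset_insert _ _)).cons (List.nodup_cons.2 ⟨fun h => hc (hpS c h), hp⟩) ?_
  intro x hx
  rcases List.mem_cons.1 hx with rfl | hx
  · simp
  · exact Set.mem_insert_of_mem _ (hpS x hx)

end Decompositions

/-! ### Connectivity of edge multisets, and components -/

section Reachability

variable {V : Type u}

/-- Reachability along the edges of `E`. -/
def Reach (E : Multiset (Sym2 V)) : V → V → Prop :=
  Relation.ReflTransGen fun a b => s(a, b) ∈ E

lemma Reach.refl (E : Multiset (Sym2 V)) (x : V) : Reach E x x := Relation.ReflTransGen.refl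

lemma Reach.of_mem {E : Multiset (Sym2 V)} {x y : V} (h : s(x, y) ∈ E) : Reach E x y :=
  Relation.ReflTransGen.single h

lemma Reach.trans {E : Multiset (Sym2 V)} {x y z : V} (h : Reach E x y) (h' : Reach E y z) :
    Reach E x z :=
  Relation.ReflTransGen.trans h h'

lemma Reach.symm {E : Multiset (Sym2 V)} {x y : V} (h : Reach E x y) : Reach E y x := by
  induction h with
  | refl => exact Reach.refl _ _
  | tail _ h ih => exact (Reach.of_mem (by rwa [Sym2.eq_swap])).trans ih

/-- Every edge of `E` may be replaced by a connection in `F`. -/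
lemma Reach.lift {E F : Multiset (Sym2 V)} (hEF : ∀ a b, s(a, b) ∈ E → Reach F a b) {x y : V}
    (h : Reach E x y) : Reach F x y := by
  induction h with
  | refl => exact Reach.refl _ _
  | tail _ h ih => exact ih.trans (hEF _ _ h)

lemma Reach.mono {E F : Multiset (Sym2 V)} (hEF : ∀ e ∈ E, e ∈ F) {x y : V} (h : Reach E x y) :
    Reach F x y :=
  h.lift fun _ _ hab => Reach.of_mem (hEF _ hab)

/-- A set that no edge leaves contains everything reachable from it. -/
lemma Reach.mem_of_closed {E : Multiset (Sym2 V)} {S : Set V}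
    (hS : ∀ a b, s(a, b) ∈ E → a ∈ S → b ∈ S) {x y : V} (h : Reach E x y) (hx : x ∈ S) :
    y ∈ S := by
  induction h with
  | refl => exact hx
  | tail _ h ih => exact hS _ _ h ih

/-- A walk of `E` leaving `S` uses an edge outside `F`, if `F` lives on `S`. -/
lemma Reach.exists_root {E F : Multiset (Sym2 V)} {S : Set V} (hF : ∀ e ∈ F, ∀ x ∈ e, x ∈ S)
    {x o : V} (h : Reach E x o) (hx : x ∈ S) (ho : o ∉ S) :
    ∃ r ∈ S, Reach F x r ∧ ∃ q, s(r, q) ∈ E ∧ s(r, q) ∉ F := by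
  revert hx
  refine Relation.ReflTransGen.head_induction_on h (fun hx => absurd hx ho) ?_
  intro a b hab _ ih ha
  by_cases hF' : s(a, b) ∈ F
  · obtain ⟨r, hr, hbr, hq⟩ := ih (hF _ hF' b (by simp))
    exact ⟨r, hr, (Reach.of_mem hF').trans hbr, hq⟩
  · exact ⟨a, ha, Reach.refl _ _, b, hab, hF'⟩

/-- `E` is the edge set of a simple graph on the vertex set `S`. -/
structure GraphOn (S : Finset V) (E : Multiset (Sym2 V)) : Prop where
  nodup : E.Nodup
  loopless : ∀ e ∈ E, ¬ e.IsDiag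
  mem : ∀ e ∈ E, ∀ x ∈ e, x ∈ S

lemma GraphOn.of_le {S T : Finset V} {E F : Multiset (Sym2 V)} (h : GraphOn S E) (hF : F ≤ E)
    (hT : ∀ e ∈ F, ∀ x ∈ e, x ∈ T) : GraphOn T F :=
  ⟨Multiset.nodup_of_le hF h.nodup, fun e he => h.loopless e (Multiset.mem_of_le hF he), hT⟩

lemma GraphOn.cons {S T : Finset V} {E : Multiset (Sym2 V)} (h : GraphOn S E) {a b : V}
    (hab : a ≠ b) (hn : s(a, b) ∉ E) (hST : S ⊆ T) (ha : a ∈ T) (hb : b ∈ T) :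
    GraphOn T ({s(a, b)} + E) := by
  refine ⟨?_, ?_, ?_⟩
  · rw [Multiset.singleton_add]
    exact Multiset.nodup_cons.2 ⟨hn, h.nodup⟩
  · intro e he
    rcases Multiset.mem_add.1 he with he | he
    · rw [Multiset.mem_singleton] at he
      subst he
      simpa using hab
    · exact h.loopless e he
  · intro e he x hx
    rcases Multiset.mem_add.1 he with he | he
    · rw [Multiset.mem_singleton] at he
      subst he
      rcases Sym2.mem_iff.1 hx with rfl | rfl <;> assumption
    · exact hST (h.mem e he x hx)

lemma GraphOn.ne {S : Finset V} {E : Multiset (Sym2 V)} (h : GraphOn S E) {a b : V}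
    (hab : s(a, b) ∈ E) : a ≠ b := by
  simpa using h.loopless _ hab

lemma GraphOn.reach_mem {S : Finset V} {E : Multiset (Sym2 V)} (h : GraphOn S E) {x y : V}
    (hxy : Reach E x y) (hx : x ∈ S) : y ∈ S :=
  Reach.mem_of_closed (S := (S : Set V)) (fun a b hab _ => h.mem _ hab b (by simp)) hxy hx

/-- The edges of `E` inside `S`. -/
noncomputable def restr (E : Multiset (Sym2 V)) (S : Finset V) : Multiset (Sym2 V) :=
  E.filter fun e => ∀ x ∈ e, x ∈ S

lemma mem_restr {E : Multiset (Sym2 V)} {S : Finset V} {e : Sym2 V} :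
    e ∈ restr E S ↔ e ∈ E ∧ ∀ x ∈ e, x ∈ S := by
  simp [restr]

lemma mk_mem_restr {E : Multiset (Sym2 V)} {S : Finset V} {a b : V} :
    s(a, b) ∈ restr E S ↔ s(a, b) ∈ E ∧ a ∈ S ∧ b ∈ S := by
  simp [mem_restr]

lemma restr_le (E : Multiset (Sym2 V)) (S : Finset V) : restr E S ≤ E := Multiset.filter_le _ _

lemma GraphOn.restr {S T : Finset V} {E : Multiset (Sym2 V)} (h : GraphOn S E) :
    GraphOn T (restr E T) :=
  h.of_le (restr_le _ _) fun _ he => (mem_restr.1 he).2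

lemma GraphOn.restr_self {S : Finset V} {E : Multiset (Sym2 V)} (h : GraphOn S E) :
    GallaiPaths.restr E S = E :=
  Multiset.filter_eq_self.2 h.mem

/-- No edge of `E` leaves `C`. -/
def Closed (E : Multiset (Sym2 V)) (C : Finset V) : Prop :=
  ∀ a b, s(a, b) ∈ E → a ∈ C → b ∈ C

/-- Closedness excludes edges between `C` and `D`, the only ones the right-hand side would miss;
disjointness prevents double counting. -/
lemma restr_union {E : Multiset (Sym2 V)} {C D : Finset V} (hC : Closed E C) (hD : Closed E D)
    (hCD : Disjoint C D) : restr E (C ∪ D) = restr E C + restr E D := by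
  unfold restr
  rw [Multiset.filter_add_filter]
  have h2 : E.filter (fun e => (∀ x ∈ e, x ∈ C) ∧ ∀ x ∈ e, x ∈ D) = 0 := by
    rw [Multiset.filter_eq_nil]
    intro e _
    induction e with
    | _ a b =>
      rintro ⟨h1, h2⟩
      exact Finset.disjoint_left.1 hCD (h1 a (by simp)) (h2 a (by simp))
  rw [h2, add_zero]
  refine Multiset.filter_congr fun e he => ?_
  induction e with
  | _ a b =>
    have h1 := hC a b he
    have h2 := hC b a (by rwa [Sym2.eq_swap])
    have h3 := hD a b he
    have h4 := hD b a (by rwa [Sym2.eq_swap])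
    simp only [Sym2.mem_iff, forall_eq_or_imp, forall_eq, Finset.mem_union]
    tauto

variable [Fintype V]

/-- The vertices reachable from `x`. -/
noncomputable def comp (E : Multiset (Sym2 V)) (x : V) : Finset V := Finset.univ.filter (Reach E x)

@[simp] lemma mem_comp {E : Multiset (Sym2 V)} {x y : V} : y ∈ comp E x ↔ Reach E x y := by
  simp [comp]

lemma closed_comp (E : Multiset (Sym2 V)) (x : V) : Closed E (comp E x) := by
  intro a b hab ha
  rw [mem_comp] at *
  exact ha.trans (Reach.of_mem hab)

lemma comp_eq_of_reach {E : Multiset (Sym2 V)} {x y : V} (h : Reach E x y) :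
    comp E x = comp E y := by
  ext z
  rw [mem_comp, mem_comp]
  exact ⟨h.symm.trans, h.trans⟩

lemma comp_subset {S : Finset V} {E : Multiset (Sym2 V)} (h : GraphOn S E) {x : V} (hx : x ∈ S) :
    comp E x ⊆ S := by
  intro y hy
  exact h.reach_mem (mem_comp.1 hy) hx

lemma reach_restr_comp {E : Multiset (Sym2 V)} {x y z : V} (hy : Reach E x y)
    (hz : Reach E y z) : Reach (restr E (comp E x)) y z := by
  induction hz with
  | refl => exact Reach.refl _ _
  | @tail b c hb h ih =>
    refine ih.trans (Reach.of_mem (mk_mem_restr.2 ⟨h, ?_, ?_⟩))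
    · exact mem_comp.2 (hy.trans hb)
    · exact mem_comp.2 ((hy.trans hb).trans (Reach.of_mem h))

end Reachability

/-! ### Minimality, odd components and the parity budget -/

section Minimal

variable {V : Type u} [Fintype V]

/-- Edge sets of graphs that are connected on all of `V`, of maximum degree at most `k`, without
a decomposition into `⌈|V| / 2⌉` paths, such that all connected graphs of maximum degree at most
`k` on proper subsets of `V` have one. -/
structure IsMin (k : ℕ) (E : Multiset (Sym2 V)) : Prop where
  graph : GraphOn Finset.univ E
  conn : ∀ x y, Reach E x y
  deg_le : ∀ x, deg E x ≤ k
  not_dec : ¬ Dec Set.univ E ((Fintype.card V + 1) / 2)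
  dec : ∀ (S : Finset V) (F : Multiset (Sym2 V)), GraphOn S F →
    (∃ r ∈ S, ∀ x ∈ S, Reach F x r) → (∀ x, deg F x ≤ k) → S.card < Fintype.card V →
      Dec (S : Set V) F ((S.card + 1) / 2)

variable {k : ℕ} {E : Multiset (Sym2 V)}

/-- The number of odd components that meet `C`. -/
noncomputable def oddComps (F : Multiset (Sym2 V)) (C : Finset V) : ℕ :=
  ((C.image (comp F)).filter fun K => Odd K.card).card

lemma dec_comp (hE : IsMin k E) {S : Finset V} {F : Multiset (Sym2 V)} (hF : GraphOn S F)
    (hd : ∀ x, deg F x ≤ k) (hS : S.card < Fintype.card V) {x : V} (hx : x ∈ S) :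
    Dec (comp F x : Set V) (restr F (comp F x)) (((comp F x).card + 1) / 2) := by
  refine hE.dec _ _ hF.restr ⟨x, mem_comp.2 (Reach.refl _ _), fun y hy => ?_⟩
    (fun y => (deg_le_of_le (restr_le _ _) y).trans (hd y))
    ((Finset.card_le_card (comp_subset hF hx)).trans_lt hS)
  exact reach_restr_comp (mem_comp.1 hy) (mem_comp.1 hy).symm

/-- Induction over a set of components. Doubling the number of paths makes the count exact: an even
component `K` contributes |K|, an odd one |K| + 1. -/
lemma dec_biUnion_comp (hE : IsMin k E) {S : Finset V} {F : Multiset (Sym2 V)} (hF : GraphOn S F)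
    (hd : ∀ x, deg F x ≤ k) (hS : S.card < Fintype.card V) (𝒦 : Finset (Finset V))
    (h𝒦 : 𝒦 ⊆ S.image (comp F)) : Closed F (𝒦.biUnion id) ∧ ∃ m,
      Dec (𝒦.biUnion id : Finset V) (restr F (𝒦.biUnion id)) m ∧
      2 * m = (𝒦.biUnion id).card + (𝒦.filter fun K => Odd K.card).card := by
  induction 𝒦 using Finset.induction with
  | empty =>
    refine ⟨fun a b _ h => by simp at h, 0, ?_, by simp⟩
    have : restr F (Finset.biUnion ∅ id) = 0 := by
      refine Multiset.eq_zero_of_forall_notMem fun e he => ?_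
      induction e with
      | _ a b => simp [mk_mem_restr] at he
    rw [this]
    exact dec_zero _
  | insert K 𝒦 hK ih =>
    obtain ⟨hcl, m, hm, hm2⟩ := ih fun L hL => h𝒦 (Finset.mem_insert_of_mem hL)
    obtain ⟨x, hx, rfl⟩ := Finset.mem_image.1 (h𝒦 (Finset.mem_insert_self _ _))
    have hdis : Disjoint (comp F x) (𝒦.biUnion id) := by
      rw [Finset.disjoint_left]
      intro y hy hy'
      obtain ⟨L, hL, hyL⟩ := Finset.mem_biUnion.1 hy'
      obtain ⟨z, _, rfl⟩ := Finset.mem_image.1 (h𝒦 (Finset.mem_insert_of_mem hL))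
      rw [mem_comp] at hy
      rw [id, mem_comp] at hyL
      exact hK (by rwa [comp_eq_of_reach (hy.trans hyL.symm)])
    rw [Finset.biUnion_insert, id]
    refine ⟨?_, ((comp F x).card + 1) / 2 + m, ?_, ?_⟩
    · intro a b hab ha
      rcases Finset.mem_union.1 ha with ha | ha
      · exact Finset.mem_union_left _ (closed_comp F x a b hab ha)
      · exact Finset.mem_union_right _ (hcl a b hab ha)
    · rw [restr_union (closed_comp F x) hcl hdis, Finset.coe_union]
      exact (dec_comp hE hF hd hS hx).add hm
    · rw [Finset.card_union_of_disjoint hdis, Finset.filter_insert]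
      split_ifs with h
      · rw [Finset.card_insert_of_notMem (by simp [hK])]
        obtain ⟨j, hj⟩ := h
        omega
      · rw [Nat.not_odd_iff_even] at h
        obtain ⟨j, hj⟩ := h
        omega

/-- Decomposing each component separately costs one half more per odd component. -/
lemma dec_closed (hE : IsMin k E) {S : Finset V} {F : Multiset (Sym2 V)} (hF : GraphOn S F)
    (hd : ∀ x, deg F x ≤ k) (hS : S.card < Fintype.card V) {C : Finset V} (hC : Closed F C)
    (hCS : C ⊆ S) : Dec (C : Set V) (restr F C) ((C.card + oddComps F C) / 2) := by
  obtain ⟨-, m, hm, hm2⟩ := dec_biUnion_comp hE hF hd hS (C.image (comp F))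
    (Finset.image_subset_image hCS)
  have : (C.image (comp F)).biUnion id = C := by
    ext y
    simp only [Finset.mem_biUnion, Finset.mem_image, id, exists_exists_and_eq_and, mem_comp]
    constructor
    · rintro ⟨x, hx, hxy⟩
      exact Reach.mem_of_closed (S := (C : Set V)) hC hxy hx
    · exact fun hy => ⟨y, hy, Reach.refl _ _⟩
  rw [this] at hm hm2
  refine hm.mono le_rfl ?_
  rw [oddComps]
  omega

/-- If three vertices meet all components, then either there is at most one odd component, or
there are at least two and each can be split off without exceeding the bound. -/
lemma dec_or_odd_comps (hE : IsMin k E) {S : Finset V} {F : Multiset (Sym2 V)} (hF : GraphOn S F)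
    (hd : ∀ x, deg F x ≤ k) (hS : S.card < Fintype.card V) {r₁ r₂ r₃ : V}
    (hr : ∀ x ∈ S, Reach F x r₁ ∨ Reach F x r₂ ∨ Reach F x r₃) :
    Dec (S : Set V) F ((S.card + 1) / 2) ∨
      ((∀ x ∈ S, Odd (comp F x).card → Dec (S \ comp F x : Finset V) (restr F (S \ comp F x))
        ((S.card + 3) / 2 - ((comp F x).card + 1) / 2)) ∧
      ∃ x ∈ S, ∃ y ∈ S, Odd (comp F x).card ∧ Odd (comp F y).card ∧ ¬ Reach F x y) := by
  have hScl : Closed F S := fun a b hab _ => hF.mem _ hab b (by simp)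
  have ho : oddComps F S ≤ 3 := by
    refine (Finset.card_le_card (t := {comp F r₁, comp F r₂, comp F r₃}) ?_).trans
      Finset.card_le_three
    intro K hK
    obtain ⟨x, hx, rfl⟩ := Finset.mem_image.1 (Finset.mem_filter.1 hK).1
    rcases hr x hx with h | h | h <;> simp [comp_eq_of_reach h]
  -- A single odd component is already paid for by the rounding in (|S| + 1) / 2.
  by_cases h1 : oddComps F S ≤ 1
  · left
    have := dec_closed hE hF hd hS hScl subset_rfl
    rw [hF.restr_self] at this
    exact this.mono le_rfl (by omega)
  right
  constructor
  · intro x hx hodd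
    have hcl : Closed F (S \ comp F x) := by
      intro a b hab ha
      rw [Finset.mem_sdiff] at *
      exact ⟨hScl a b hab ha.1, fun hb => ha.2 (closed_comp F x b a (by rwa [Sym2.eq_swap]) hb)⟩
    -- At most two odd components remain, so the rest costs at most (|S| - |K| + 2) / 2, where `K`
    -- is the component of `x`. As |K| is odd this is the stated bound.
    refine (dec_closed hE hF hd hS hcl Finset.sdiff_subset).mono le_rfl ?_
    have hlt : oddComps F (S \ comp F x) < oddComps F S := by
      refine Finset.card_lt_card ?_
      rw [Finset.ssubset_iff_of_subset]
      · refine ⟨comp F x, Finset.mem_filter.2 ⟨Finset.mem_image_of_mem _ hx, hodd⟩, ?_⟩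
        intro h
        obtain ⟨y, hy, hxy⟩ := Finset.mem_image.1 (Finset.mem_filter.1 h).1
        have : y ∈ comp F x := by
          rw [← hxy]
          exact mem_comp.2 (Reach.refl _ _)
        exact (Finset.mem_sdiff.1 hy).2 this
      · exact Finset.filter_subset_filter _ (Finset.image_subset_image Finset.sdiff_subset)
    have h2 := comp_subset hF hx
    have h3 := Finset.card_le_card h2
    rw [Finset.card_sdiff_of_subset h2]
    obtain ⟨j, hj⟩ := hodd
    omega
  · obtain ⟨K, hK, L, hL, hKL⟩ := Finset.one_lt_card.1 (not_le.1 h1)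
    obtain ⟨hK, hKo⟩ := Finset.mem_filter.1 hK
    obtain ⟨hL, hLo⟩ := Finset.mem_filter.1 hL
    obtain ⟨x, hx, rfl⟩ := Finset.mem_image.1 hK
    obtain ⟨y, hy, rfl⟩ := Finset.mem_image.1 hL
    exact ⟨x, hx, y, hy, hKo, hLo, fun h => hKL (comp_eq_of_reach h)⟩

/-- A connected graph with an odd number of vertices has a decomposition in which some path ends
at a prescribed vertex. -/
lemma exists_isDec_end (hE : IsMin k E) {K : Finset V} {F : Multiset (Sym2 V)} (hF : GraphOn K F)
    {r : V} (hr : r ∈ K) (hconn : ∀ x ∈ K, Reach F x r) (hd : ∀ x, deg F x ≤ k)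
    (hdr : deg F r + 1 ≤ k) (hodd : Odd K.card) (hK : K.card + 1 < Fintype.card V) {c : V}
    (hc : c ∉ K) : ∃ Q L, IsDec (K : Set V) F ((Q ++ [r]) ::ₘ L) ∧
      L.card + 1 ≤ (K.card + 1) / 2 := by
  have hcF : ∀ e ∈ F, c ∉ e := fun e he hce => hc (hF.mem e he c hce)
  have hcr : c ≠ r := fun h => hc (h ▸ hr)
  -- A pendant vertex `c` at `r` makes the number of vertices even without raising the bound; the
  -- path through `cr`, stripped of `c`, ends at `r`.
  have hF' : GraphOn (insert c K) ({s(c, r)} + F) :=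
    hF.cons hcr (fun h => hcF _ h (by simp)) (Finset.subset_insert _ _) (by simp) (by simp [hr])
  have hdec := hE.dec _ _ hF' ⟨r, by simp [hr], ?_⟩ ?_
    (by rwa [Finset.card_insert_of_notMem hc])
  rotate_left
  · intro x hx
    rcases Finset.mem_insert.1 hx with rfl | hx
    · exact Reach.of_mem (by simp)
    · exact (hconn x hx).mono fun e he => Multiset.mem_add.2 (.inr he)
  · intro x
    simp only [deg_add, deg_singleton, Sym2.mem_iff]
    split_ifs with h
    · rcases h with rfl | rfl
      · rw [deg_eq_zero hcF]
        omega
      · omega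
    · simpa using hd x
  obtain ⟨L, hL, hLc⟩ := hdec
  obtain ⟨A, B, L', hL, hc'⟩ := hL.exists_edge (a := c) (b := r) (by simp)
  obtain ⟨hp, hpS, F', hF'', hEq⟩ := hL.uncons
  -- `c` has degree one, so a path through `cr` must begin at `c`.
  have hA : A = [] := by
    rcases List.eq_nil_or_concat A with rfl | ⟨A, a, rfl⟩
    · rfl
    exfalso
    have h1 : s(a, c) ∈ {s(c, r)} + F := by
      rw [hEq, List.concat_eq_append, List.append_assoc, List.singleton_append,
        pathEdges_append_cons_cons]
      simp
    rcases Multiset.mem_add.1 h1 with h1 | h1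
    · rw [Multiset.mem_singleton, Sym2.eq_iff] at h1
      rcases h1 with ⟨rfl, h1⟩ | ⟨rfl, -⟩
      · exact hcr h1
      · simp [List.nodup_append] at hp
    · exact hcF _ h1 (by simp)
  subst hA
  rw [List.nil_append, pathEdges_cons_cons, add_assoc] at hEq
  have hEq := add_left_cancel hEq
  have hsub : ∀ e ∈ F', ∀ x ∈ e, x ∈ (K : Set V) := fun e he x hx =>
    hF.mem e (by rw [hEq]; exact Multiset.mem_add.2 (.inr he)) x hx
  -- The other paths contain no edge at `c`, but one could be the trivial path at `c`; such paths
  -- are dropped.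
  obtain ⟨L'', hL'', hcard⟩ := hF''.exists_support hsub
  refine ⟨B.reverse, L'', ?_, ?_⟩
  · have := hL''.cons (p := r :: B) (by simp_all) ?_
    · rw [← hEq] at this
      simpa using this.reverse_head
    · intro x hx
      have h1 := hpS x (by simp only [List.nil_append]; exact List.mem_cons_of_mem _ hx)
      simp only [Finset.coe_insert, Set.mem_insert_iff] at h1
      rcases h1 with rfl | h1
      · simp only [List.nil_append, List.nodup_cons] at hp
        exact absurd hx hp.1
      · exact h1
  · rw [Finset.card_insert_of_notMem hc] at hLc
    obtain ⟨j, hj⟩ := hodd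
    omega

/-- If `b` is in `K`, joining one new vertex `c` to `a` and `b` makes the order even at no cost, and
`cb` is then subdivided by `M`. If not, a path of `K` ending at `a` is prolonged through `c`, `M` to
`b`, which it cannot have met before. -/
lemma attach_of_mem_left (hE : IsMin k E) {K : Finset V} {F : Multiset (Sym2 V)}
    (hF : GraphOn K F) {r : V} (hr : r ∈ K) (hconn : ∀ x ∈ K, Reach F x r)
    (hd : ∀ x, deg F x ≤ k) (hodd : Odd K.card) (hK : K.card + 1 < Fintype.card V) {a b c : V}
    {M : List V} (ha : a ∈ K) (hab : a ≠ b) (hda : deg F a + 1 ≤ k) (hdb : deg F b + 1 ≤ k)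
    (hk : 2 ≤ k) (hM : (c :: M).Nodup) (hMK : ∀ x ∈ c :: M, x ∉ K) (hMb : b ∉ c :: M) :
    Dec Set.univ (pathEdges (a :: (c :: M ++ [b])) + F) ((K.card + 1) / 2) := by
  have hcK : c ∉ K := hMK c (by simp)
  by_cases hb : b ∈ K
  · have hcF : ∀ e ∈ F, c ∉ e := fun e he hce => hcK (hF.mem e he c hce)
    have hca : c ≠ a := fun h => hcK (h ▸ ha)
    have hcb : c ≠ b := fun h => hcK (h ▸ hb)
    have hF1 : GraphOn (insert c K) ({s(a, c)} + F) :=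
      hF.cons hca.symm (fun h => hcF _ h (by simp)) (Finset.subset_insert _ _) (by simp [ha])
        (by simp)
    have hF2 : GraphOn (insert c K) ({s(c, b)} + ({s(a, c)} + F)) := by
      refine hF1.cons hcb ?_ subset_rfl (by simp) (by simp [hb])
      intro h
      rcases Multiset.mem_add.1 h with h | h
      · rw [Multiset.mem_singleton, Sym2.eq_iff] at h
        rcases h with ⟨h, -⟩ | ⟨-, h⟩
        · exact hca h
        · exact hab h.symm
      · exact hcF _ h (by simp)
    have hdec := hE.dec _ _ hF2 ⟨r, by simp [hr], ?_⟩ ?_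
      (by rwa [Finset.card_insert_of_notMem hcK])
    rotate_left
    · have hmono : ∀ x ∈ K, Reach ({s(c, b)} + ({s(a, c)} + F)) x r := fun x hx =>
        (hconn x hx).mono fun e he => by simp [he]
      intro x hx
      rcases Finset.mem_insert.1 hx with rfl | hx
      · exact (Reach.of_mem (by simp)).trans (hmono b hb)
      · exact hmono x hx
    · intro x
      simp only [deg_add, deg_singleton, Sym2.mem_iff]
      by_cases hxc : x = c
      · subst hxc
        simp [deg_eq_zero hcF]
        omega
      · by_cases hxa : x = a
        · subst hxa
          simp [hab, hxc]
          omega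
        · by_cases hxb : x = b
          · subst hxb
            simp [hxa, hxc]
            omega
          · simp [hxa, hxb, hxc, hd x]
    have := hdec.subdivide (M := M) (List.nodup_cons.1 hM).2 ?_
    · have h : pathEdges (a :: (c :: M ++ [b])) + F =
          pathEdges (c :: (M ++ [b])) + ({s(a, c)} + F) := by
        rw [List.cons_append, pathEdges_cons_cons]
        abel
      rw [h]
      refine this.mono (Set.subset_univ _) ?_
      rw [Finset.card_insert_of_notMem hcK]
      obtain ⟨j, hj⟩ := hodd
      omega
    · intro x hx
      simp only [Finset.coe_insert, Set.mem_insert_iff, not_or]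
      refine ⟨?_, hMK x (List.mem_cons_of_mem _ hx)⟩
      rintro rfl
      exact (List.nodup_cons.1 hM).1 hx
  · obtain ⟨Q, L, hL, hc⟩ := exists_isDec_end hE hF ha
      (fun x hx => (hconn x hx).trans (hconn a ha).symm) hd hda hodd hK hcK
    obtain ⟨hp, hpS, F', hF', rfl⟩ := hL.uncons
    refine ⟨(Q ++ a :: (c :: M ++ [b])) ::ₘ L, ?_, by simpa using hc⟩
    have : pathEdges (a :: (c :: M ++ [b])) + (pathEdges (Q ++ [a]) + F') =
        pathEdges (Q ++ a :: (c :: M ++ [b])) + F' := by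
      rw [pathEdges_append_cons Q a (c :: M ++ [b])]
      abel
    rw [this]
    refine (hF'.mono (Set.subset_univ _)).cons ?_ (by simp)
    have h1 : ∀ x ∈ c :: M, x ∉ Q ++ [a] := fun x hx hx' => hMK x hx (hpS x hx')
    have h2 : b ∉ Q ++ [a] := fun hx' => hb (hpS b hx')
    grind [List.nodup_append]

/-- An odd component absorbs a path of otherwise new vertices between two vertices, at least one
of which it contains. -/
lemma attach (hE : IsMin k E) {K : Finset V} {F : Multiset (Sym2 V)}
    (hF : GraphOn K F) {r : V} (hr : r ∈ K) (hconn : ∀ x ∈ K, Reach F x r)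
    (hd : ∀ x, deg F x ≤ k) (hodd : Odd K.card) (hK : K.card + 1 < Fintype.card V) {a b : V}
    {M : List V} (hab : a ≠ b) (haK : a ∈ K ∨ b ∈ K) (hda : deg F a + 1 ≤ k)
    (hdb : deg F b + 1 ≤ k) (hk : 2 ≤ k) (hMn : M ≠ []) (hM : (a :: (M ++ [b])).Nodup)
    (hMK : ∀ x ∈ M, x ∉ K) :
    Dec Set.univ (pathEdges (a :: (M ++ [b])) + F) ((K.card + 1) / 2) := by
  rcases haK with ha | hb
  · obtain ⟨c, M, rfl⟩ := List.exists_cons_of_ne_nil hMn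
    exact attach_of_mem_left hE hF hr hconn hd hodd hK ha hab hda hdb hk
      (by grind [List.nodup_append]) hMK (by grind [List.nodup_append])
  · have h1 : pathEdges (a :: (M ++ [b])) = pathEdges (b :: (M.reverse ++ [a])) := by
      rw [← pathEdges_reverse]; simp
    have h2 : M.reverse ≠ [] := by simpa using hMn
    have h3 : ∀ x ∈ M.reverse, x ∉ K := by simpa using hMK
    have h4 : (b :: (M.reverse ++ [a])).Nodup := by
      rw [← List.nodup_reverse]; simpa using hM
    rw [h1]
    obtain ⟨c, M', hM'⟩ := List.exists_cons_of_ne_nil h2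
    rw [hM'] at h3 h4 ⊢
    exact attach_of_mem_left hE hF hr hconn hd hodd hK hb hab.symm hdb hda hk
      (by grind [List.nodup_append]) h3 (by grind [List.nodup_append])

end Minimal

/-! ### Translation between simple graphs and edge multisets -/

section Translation

variable {V : Type u}

/-- Turns the bound into natural number division, in which all later counting is done. -/
lemma ceil_half (n : ℕ) : ⌈(n : ℚ) / 2⌉₊ = (n + 1) / 2 := by
  apply le_antisymm
  · rw [Nat.ceil_le, div_le_iff₀ (by norm_num)]
    have : n ≤ (n + 1) / 2 * 2 := by omega
    exact_mod_cast this
  · by_contra! h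
    have h1 : (n : ℚ) / 2 ≤ (((n + 1) / 2 - 1 : ℕ) : ℚ) := by
      rw [← Nat.ceil_le]
      omega
    rw [div_le_iff₀ (by norm_num)] at h1
    have h2 : n ≤ ((n + 1) / 2 - 1) * 2 := by exact_mod_cast h1
    omega

lemma pathEdges_map {W : Type u} (f : V → W) (l : List V) :
    pathEdges (l.map f) = (pathEdges l).map (Sym2.map f) := by
  induction l with
  | nil => simp
  | cons a l ih =>
    cases l with
    | nil => simp
    | cons b l => simpa [pathEdges] using ih

lemma nodup_pathEdges {l : List V} (hl : l.Nodup) : (pathEdges l).Nodup := by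
  induction l with
  | nil => simp
  | cons a l ih =>
    cases l with
    | nil => simp
    | cons b l =>
      rw [pathEdges_cons_cons, Multiset.singleton_add, Multiset.nodup_cons]
      refine ⟨fun h => ?_, ih (List.nodup_cons.1 hl).2⟩
      exact (List.nodup_cons.1 hl).1 (mem_of_mem_pathEdges h (by simp))

lemma pathEdges_support {G : SimpleGraph V} {a b : V} (p : G.Walk a b) :
    pathEdges p.support = (p.edges : Multiset (Sym2 V)) := by
  induction p with
  | nil => simp
  | cons h p ih =>
    rw [SimpleGraph.Walk.support_cons, SimpleGraph.Walk.edges_cons, ← p.cons_tail_support,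
      pathEdges_cons_cons, p.cons_tail_support, ih]
    simp

lemma isChain_of_pathEdges {G : SimpleGraph V} {l : List V}
    (h : ∀ e ∈ pathEdges l, e ∈ G.edgeSet) : l.IsChain G.Adj := by
  induction l with
  | nil => simp
  | cons a l ih =>
    cases l with
    | nil => simp
    | cons b l =>
      rw [pathEdges_cons_cons] at h
      rw [List.isChain_cons_cons]
      exact ⟨h s(a, b) (by simp), ih fun e he => h e (Multiset.mem_add.2 (.inr he))⟩

/-- A path of `G` given as a list of vertices, as a subgraph. -/
lemma exists_isPathSubgraph {G : SimpleGraph V} {l : List V} (hl : l.Nodup) (hne : l ≠ [])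
    (h : ∀ e ∈ pathEdges l, e ∈ G.edgeSet) :
    ∃ P : G.Subgraph, IsPathSubgraph P ∧ ∀ e, e ∈ P.edgeSet ↔ e ∈ pathEdges l := by
  let p := SimpleGraph.Walk.ofSupport l hne (isChain_of_pathEdges h)
  have hp : p.support = l := SimpleGraph.Walk.support_ofSupport hne _
  refine ⟨p.toSubgraph, ⟨_, _, p, ?_, rfl⟩, fun e => ?_⟩
  · rw [SimpleGraph.Walk.isPath_def, hp]
    exact hl
  · rw [SimpleGraph.Walk.mem_edges_toSubgraph, ← Multiset.mem_coe, ← pathEdges_support, hp]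

lemma hasGoodPathDecomposition_of_dec [Fintype V] {G : SimpleGraph V}
    (h : Dec Set.univ G.edgeFinset.val ((Fintype.card V + 1) / 2)) :
    HasGoodPathDecomposition G := by
  obtain ⟨L, hL, hc⟩ := h
  have hmem : ∀ p ∈ L, ∀ e ∈ pathEdges p, e ∈ G.edgeSet := by
    intro p hp e he
    rw [← SimpleGraph.mem_edgeFinset, ← Finset.mem_val, ← hL.2]
    exact Multiset.mem_bind.2 ⟨p, hp, he⟩
  have key : ∀ p : List V, ∃ P : G.Subgraph, p ∈ L → p ≠ [] →
      IsPathSubgraph P ∧ ∀ e, e ∈ P.edgeSet ↔ e ∈ pathEdges p := by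
    intro p
    by_cases hp : p ∈ L ∧ p ≠ []
    · obtain ⟨P, hP⟩ := exists_isPathSubgraph (hL.1 p hp.1).1 hp.2 (hmem p hp.1)
      exact ⟨P, fun _ _ => hP⟩
    · exact ⟨⊥, fun h1 h2 => absurd ⟨h1, h2⟩ hp⟩
  choose f hf using key
  -- The empty list is no path of a graph. Coinciding trivial paths may merge in the image, which
  -- only lowers the count.
  refine ⟨(L.filter (· ≠ [])).toFinset.image f, ⟨?_, ?_⟩, ?_⟩
  · intro P hP
    simp only [Finset.mem_image, Multiset.mem_toFinset, Multiset.mem_filter] at hP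
    obtain ⟨p, ⟨hp, hne⟩, rfl⟩ := hP
    exact (hf p hp hne).1
  · intro e he
    have he' : e ∈ (L.map pathEdges).sum := by
      rw [hL.2]
      exact SimpleGraph.mem_edgeFinset.2 he
    obtain ⟨p, hp, hep⟩ := Multiset.mem_bind.1 he'
    have hne : ∀ q, e ∈ pathEdges q → q ≠ [] := by
      rintro q hq rfl
      simp at hq
    refine ⟨f p, ⟨?_, ((hf p hp (hne p hep)).2 e).2 hep⟩, ?_⟩
    · exact Finset.mem_image_of_mem _ (by simp [hp, hne p hep])
    · rintro Q ⟨hQ, heQ⟩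
      simp only [Finset.mem_image, Multiset.mem_toFinset, Multiset.mem_filter] at hQ
      obtain ⟨q, ⟨hq, hqne⟩, rfl⟩ := hQ
      have heq := ((hf q hq hqne).2 e).1 heQ
      congr 1
      -- Two different lists through `e` would give `e` multiplicity two in the sum, which is the
      -- duplicate-free edge set.
      by_contra hqp
      obtain ⟨L', rfl⟩ := Multiset.exists_cons_of_mem hp
      have hq' : q ∈ L' := (Multiset.mem_cons.1 hq).resolve_left hqp
      have hnd : (((p ::ₘ L').map pathEdges).sum).Nodup := by
        rw [hL.2]
        exact G.edgeFinset.nodup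
      rw [Multiset.map_cons, Multiset.sum_cons, Multiset.nodup_add] at hnd
      exact Multiset.disjoint_left.1 hnd.2.2 hep (Multiset.mem_bind.2 ⟨q, hq', heq⟩)
  · rw [ceil_half]
    refine Finset.card_image_le.trans ((Multiset.toFinset_card_le _).trans ?_)
    exact (Multiset.card_le_card (Multiset.filter_le _ _)).trans hc

/-- Equality of the multisets is checked by multiplicities: each path has an edge at most once, and
exactly one path of `D` has a given edge of `F`. -/
lemma dec_of_hasGoodPathDecomposition {S : Finset V} {F : Multiset (Sym2 V)} (hF : GraphOn S F)
    {H : SimpleGraph S} (hH : ∀ a b : S, H.Adj a b ↔ s(a.1, b.1) ∈ F)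
    (h : HasGoodPathDecomposition H) : Dec (S : Set V) F ((S.card + 1) / 2) := by
  obtain ⟨D, ⟨hD1, hD2⟩, hc⟩ := h
  have key : ∀ P : H.Subgraph, ∃ l : List S, P ∈ D →
      l.Nodup ∧ ∀ e, e ∈ pathEdges l ↔ e ∈ P.edgeSet := by
    intro P
    by_cases hP : P ∈ D
    · obtain ⟨a, b, p, hp, rfl⟩ := hD1 P hP
      refine ⟨p.support, fun _ => ⟨hp.support_nodup, fun e => ?_⟩⟩
      rw [pathEdges_support, SimpleGraph.Walk.mem_edges_toSubgraph, Multiset.mem_coe]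
    · exact ⟨[], fun h => absurd h hP⟩
  choose f hf using key
  refine ⟨D.val.map fun P => (f P).map Subtype.val, ⟨?_, ?_⟩, ?_⟩
  · intro p hp
    obtain ⟨P, hP, rfl⟩ := Multiset.mem_map.1 hp
    refine ⟨(hf P hP).1.map Subtype.val_injective, fun x hx => ?_⟩
    obtain ⟨y, -, rfl⟩ := List.mem_map.1 hx
    exact y.2
  · rw [Multiset.map_map]
    have hmem : ∀ P ∈ D, ∀ e, e ∈ pathEdges ((f P).map Subtype.val) ↔
        ∃ e' ∈ P.edgeSet, Sym2.map Subtype.val e' = e := by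
      intro P hP e
      rw [pathEdges_map, Multiset.mem_map]
      exact exists_congr fun e' => and_congr_left fun _ => (hf P hP).2 e'
    ext e
    change Multiset.count e (D.val.bind fun P => pathEdges ((f P).map Subtype.val)) = _
    rw [Multiset.count_bind]
    change ∑ P ∈ D, Multiset.count e (pathEdges ((f P).map Subtype.val)) = _
    have hle : ∀ P ∈ D, (pathEdges ((f P).map Subtype.val)).Nodup := fun P hP =>
      nodup_pathEdges ((hf P hP).1.map Subtype.val_injective)
    by_cases he : e ∈ F
    · rw [Multiset.count_eq_one_of_mem hF.nodup he]
      induction e with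
      | _ a b =>
        have ha := hF.mem _ he a (by simp)
        have hb := hF.mem _ he b (by simp)
        obtain ⟨P, ⟨hP, heP⟩, huniq⟩ := hD2 s(⟨a, ha⟩, ⟨b, hb⟩) ((hH ⟨a, ha⟩ ⟨b, hb⟩).2 he)
        rw [Finset.sum_eq_single P]
        · exact Multiset.count_eq_one_of_mem (hle P hP) ((hmem P hP _).2 ⟨_, heP, rfl⟩)
        · intro Q hQ hQP
          refine Multiset.count_eq_zero_of_notMem fun h => hQP (huniq Q ⟨hQ, ?_⟩)
          obtain ⟨e', he', h2⟩ := (hmem Q hQ _).1 h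
          have : e' = s(⟨a, ha⟩, ⟨b, hb⟩) :=
            Sym2.map.injective Subtype.val_injective (h2.trans rfl)
          rwa [← this]
        · exact fun h => absurd hP h
    · rw [Multiset.count_eq_zero_of_notMem he]
      refine Finset.sum_eq_zero fun P hP => Multiset.count_eq_zero_of_notMem fun h => he ?_
      obtain ⟨e', he', rfl⟩ := (hmem P hP _).1 h
      induction e' with
      | _ a b => exact (hH a b).1 (P.edgeSet_subset he')
  · rw [Multiset.card_map]
    rw [ceil_half, Fintype.card_coe] at hc
    exact hc

lemma deg_edgeFinset [Fintype V] (G : SimpleGraph V) (x : V) :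
    deg G.edgeFinset.val x = G.degree x := by
  rw [← SimpleGraph.card_incidenceFinset_eq_degree, SimpleGraph.incidenceFinset_eq_filter, deg,
    Multiset.countP_eq_card_filter]
  rfl

lemma reach_of_reachable {G : SimpleGraph V} {F : Multiset (Sym2 V)}
    (hF : ∀ a b, G.Adj a b → s(a, b) ∈ F) {x y : V} (h : G.Reachable x y) : Reach F x y := by
  obtain ⟨p⟩ := h
  induction p with
  | nil => exact Reach.refl _ _
  | cons h p ih => exact (Reach.of_mem (hF _ _ h)).trans ih

/-- Minimality is needed only for graphs on subsets of `V`, so all reductions can stay inside one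
vertex type; `G` minimal is applied to the graph induced by `F` on the subtype of `S`. -/
lemma isMin_edgeFinset {k : ℕ} [Fintype V] {G : SimpleGraph V} [DecidableRel G.Adj]
    (hG : IsMinimalCounterexample k G) : IsMin k G.edgeFinset.val := by
  obtain ⟨⟨hconn, hdeg, hno⟩, hmin⟩ := hG
  refine ⟨⟨G.edgeFinset.nodup, ?_, by simp⟩, ?_, ?_, ?_, ?_⟩
  · intro e he
    exact G.not_isDiag_of_mem_edgeFinset he
  · intro x y
    exact reach_of_reachable (fun a b hab => by simpa using hab) (hconn x y)
  · intro x
    refine le_of_eq_of_le ?_ ((G.degree_le_maxDegree x).trans hdeg)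
    convert deg_edgeFinset G x
  · intro h
    refine hno (hasGoodPathDecomposition_of_dec ?_)
    convert h
  · rintro S F hF ⟨r, hr, hreach⟩ hd hS
    let H : SimpleGraph S :=
      { Adj := fun a b => s(a.1, b.1) ∈ F
        symm := ⟨fun a b h => by rwa [Sym2.eq_swap]⟩
        loopless := ⟨fun a h => hF.ne h rfl⟩ }
    have hH : ∀ a b : S, H.Adj a b ↔ s(a.1, b.1) ∈ F := fun a b => Iff.rfl
    have h1 := hmin S H (by simpa using hS)
    have hHconn : H.Connected := by
      have hS' : ∀ x y, Reach F x y → ∀ hx : x ∈ S, ∃ hy : y ∈ S,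
          H.Reachable ⟨x, hx⟩ ⟨y, hy⟩ := by
        intro x y h hx
        induction h with
        | refl => exact ⟨hx, SimpleGraph.Reachable.refl _⟩
        | @tail b c _ h ih =>
          obtain ⟨hb, hreach⟩ := ih
          have hc := hF.mem _ h c (by simp)
          have hadj : H.Adj ⟨b, hb⟩ ⟨c, hc⟩ := h
          exact ⟨hc, hreach.trans hadj.reachable⟩
      have : Nonempty S := ⟨⟨r, hr⟩⟩
      refine ⟨fun x y => ?_⟩
      obtain ⟨_, h1⟩ := hS' x.1 r (hreach x x.2) x.2
      obtain ⟨_, h2⟩ := hS' y.1 r (hreach y y.2) y.2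
      exact h1.trans h2.symm
    have hHdeg : H.maxDegree ≤ k := by
      refine SimpleGraph.maxDegree_le_of_forall_degree_le _ _ fun x => le_trans ?_ (hd x.1)
      rw [← SimpleGraph.card_neighborFinset_eq_degree, deg, Multiset.countP_eq_card_filter]
      have hinj : Function.Injective fun y : S => s(x.1, y.1) := by
        intro y z h
        have h : s(x.1, y.1) = s(x.1, z.1) := h
        rw [Sym2.congr_right] at h
        exact Subtype.ext h
      rw [← Finset.card_image_of_injective _ hinj]
      refine Multiset.card_le_card ((Multiset.le_iff_subset (Finset.nodup _)).2 ?_)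
      intro e he
      obtain ⟨y, hy, rfl⟩ := Finset.mem_image.1 he
      rw [SimpleGraph.mem_neighborFinset] at hy
      simpa using hy
    refine dec_of_hasGoodPathDecomposition hF hH ?_
    by_contra hbad
    exact h1 ⟨hHconn, hHdeg, hbad⟩

end Translation

/-! ### Neighbour lists and deletion of vertices -/

section Neighbours

variable {V : Type u}

/-- `l` lists the neighbours of `x`. -/
def Nb (E : Multiset (Sym2 V)) (x : V) (l : List V) : Prop :=
  l.Nodup ∧ ∀ y, s(x, y) ∈ E ↔ y ∈ l

/-- The edges from `x` to the members of a list. -/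
def star (x : V) : List V → Multiset (Sym2 V)
  | [] => 0
  | y :: l => {s(x, y)} + star x l

@[simp] lemma star_nil (x : V) : star x [] = 0 := rfl

@[simp] lemma star_cons (x y : V) (l : List V) : star x (y :: l) = {s(x, y)} + star x l := rfl

lemma mem_star {x : V} {l : List V} {e : Sym2 V} : e ∈ star x l ↔ ∃ y ∈ l, e = s(x, y) := by
  induction l with
  | nil => simp
  | cons z l ih => simp [ih]

lemma nodup_star {x : V} {l : List V} (hl : l.Nodup) : (star x l).Nodup := by
  induction l with
  | nil => simp
  | cons z l ih =>
    rw [List.nodup_cons] at hl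
    rw [star_cons, Multiset.singleton_add, Multiset.nodup_cons]
    refine ⟨fun h => ?_, ih hl.2⟩
    obtain ⟨y, hy, h⟩ := mem_star.1 h
    rw [Sym2.congr_right] at h
    exact hl.1 (h ▸ hy)

lemma deg_star_self (x : V) (l : List V) : deg (star x l) x = l.length := by
  induction l with
  | nil => simp
  | cons z l ih => simp [ih, add_comm]

/-- The edges not at `x`. -/
noncomputable def del (E : Multiset (Sym2 V)) (x : V) : Multiset (Sym2 V) := E.filter (x ∉ ·)

lemma mem_del {E : Multiset (Sym2 V)} {x : V} {e : Sym2 V} : e ∈ del E x ↔ e ∈ E ∧ x ∉ e := by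
  simp [del]

lemma mk_mem_del {E : Multiset (Sym2 V)} {x a b : V} :
    s(a, b) ∈ del E x ↔ s(a, b) ∈ E ∧ a ≠ x ∧ b ≠ x := by
  simp [mem_del, eq_comm]

lemma del_le (E : Multiset (Sym2 V)) (x : V) : del E x ≤ E := Multiset.filter_le _ _

lemma deg_del_self (E : Multiset (Sym2 V)) (x : V) : deg (del E x) x = 0 :=
  deg_eq_zero fun _ he => (mem_del.1 he).2

lemma eq_star_add_del {S : Finset V} {E : Multiset (Sym2 V)} (hE : GraphOn S E) {x : V}
    {l : List V} (hx : Nb E x l) : E = star x l + del E x := by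
  have h := Multiset.filter_add_not (fun e => x ∈ e) E
  rw [del]
  conv_lhs => rw [← h]
  congr 1
  refine (Multiset.Nodup.ext (hE.nodup.filter _) (nodup_star hx.1)).2 fun e => ?_
  rw [Multiset.mem_filter, mem_star]
  constructor
  · rintro ⟨he, hxe⟩
    obtain ⟨y, rfl⟩ := Sym2.mem_iff_exists.1 hxe
    exact ⟨y, (hx.2 y).1 he, rfl⟩
  · rintro ⟨y, hy, rfl⟩
    exact ⟨(hx.2 y).2 hy, by simp⟩

lemma Nb.deg_eq {S : Finset V} {E : Multiset (Sym2 V)} (hE : GraphOn S E) {x : V}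
    {l : List V} (hx : Nb E x l) : deg E x = l.length := by
  rw [eq_star_add_del hE hx, deg_add, deg_star_self, deg_del_self, add_zero]

lemma Nb.notMem {S : Finset V} {E : Multiset (Sym2 V)} (hE : GraphOn S E) {x : V}
    {l : List V} (hx : Nb E x l) : x ∉ l := fun h => hE.ne ((hx.2 x).2 h) rfl

lemma Nb.perm {E : Multiset (Sym2 V)} {x : V} {l l' : List V} (hx : Nb E x l) (h : l.Perm l') :
    Nb E x l' :=
  ⟨h.nodup_iff.1 hx.1, fun y => (hx.2 y).trans h.mem_iff⟩

lemma Nb.del {E : Multiset (Sym2 V)} {u v : V} {l : List V} (hu : Nb E u (v :: l)) (huv : u ≠ v) :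
    Nb (del E v) u l := by
  refine ⟨(List.nodup_cons.1 hu.1).2, fun y => ?_⟩
  rw [mk_mem_del, hu.2, List.mem_cons]
  have := (List.nodup_cons.1 hu.1).1
  constructor
  · rintro ⟨rfl | h, -, h2⟩
    · exact absurd rfl h2
    · exact h
  · rintro h
    exact ⟨.inr h, huv, fun h' => this (h' ▸ h)⟩

lemma GraphOn.del [Fintype V] {S : Finset V} {E : Multiset (Sym2 V)} (hE : GraphOn S E) (x : V) :
    GraphOn (S.erase x) (del E x) :=
  hE.of_le (del_le _ _) fun e he y hy =>
    Finset.mem_erase.2 ⟨fun h => (mem_del.1 he).2 (h ▸ hy), hE.mem e (mem_del.1 he).1 y hy⟩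

/-- The graph left after deleting two adjacent vertices. -/
lemma eq_stars_add_del {S : Finset V} {E : Multiset (Sym2 V)} (hE : GraphOn S E) {u v : V}
    {T W : List V} (hu : Nb E u (v :: T)) (hv : Nb E v (u :: W)) :
    E = {s(u, v)} + star u T + star v W + GallaiPaths.del (GallaiPaths.del E u) v := by
  have huv : u ≠ v := hE.ne ((hu.2 v).2 (by simp))
  conv_lhs => rw [eq_star_add_del hE hu, eq_star_add_del (hE.of_le (del_le E u)
    (fun e he => hE.mem e (mem_del.1 he).1)) (hv.del huv.symm), star_cons, ← add_assoc]

/-- A vertex all but one of whose edges stay inside `M`. -/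
lemma deg_eq_deg_restr_add_one {S : Finset V} {E : Multiset (Sym2 V)} (hg : GraphOn S E)
    {u v : V} {M : Finset V} (huv : s(u, v) ∈ E) (huM : u ∈ M) (hvM : v ∉ M)
    (hM : ∀ y, s(u, y) ∈ E → y ∉ M → y = v) : deg E u = deg (restr E M) u + 1 := by
  have h := Multiset.filter_add_not (fun e => ∀ x ∈ e, x ∈ M) E
  have h1 : (E.filter fun e => ¬ ∀ x ∈ e, x ∈ M).filter (u ∈ ·) = {s(u, v)} := by
    refine (Multiset.Nodup.ext ((hg.nodup.filter _).filter _) (by simp)).2 fun e => ?_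
    rw [Multiset.mem_filter, Multiset.mem_filter, Multiset.mem_singleton]
    constructor
    · rintro ⟨⟨he, h1⟩, hue⟩
      obtain ⟨y, rfl⟩ := Sym2.mem_iff_exists.1 hue
      have hy : y ∉ M := by
        intro hy
        apply h1
        simp [huM, hy]
      rw [hM y he hy]
    · rintro rfl
      refine ⟨⟨huv, fun h => hvM (h v (by simp))⟩, by simp⟩
  conv_lhs => rw [← h]
  rw [deg_add]
  refine congrArg₂ (· + ·) rfl ?_
  rw [deg, Multiset.countP_eq_card_filter, h1]
  simp

end Neighbours

/-! ### Configurations C1 and C2 -/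

section Configurations

variable {V : Type u} [Fintype V] {k : ℕ} {E : Multiset (Sym2 V)}

/-- Connectedness of a graph obtained from a connected one: it is enough to connect the vertices
that have lost an edge. -/
lemma IsMin.reach_of_roots (hE : IsMin k E) {S : Finset V} {F : Multiset (Sym2 V)}
    (hF : GraphOn S F) {o : V} (ho : o ∉ S) {P : V → Prop}
    (hP : ∀ r ∈ S, ∀ q, s(r, q) ∈ E → s(r, q) ∉ F → P r) {x : V} (hx : x ∈ S) :
    ∃ r, P r ∧ Reach F x r := by
  obtain ⟨r, hr, hxr, q, hq, hq'⟩ :=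
    (hE.conn x o).exists_root (S := (S : Set V)) hF.mem hx ho
  exact ⟨r, hP r hr q hq hq', hxr⟩

lemma IsMin.false_of_dec (hE : IsMin k E) {S : Set V} {F : Multiset (Sym2 V)} {m : ℕ}
    (h : Dec S F m) (hEF : E = F) (hm : m ≤ (Fintype.card V + 1) / 2) : False :=
  hE.not_dec (hEF ▸ h.mono (Set.subset_univ _) hm)

/-- A vertex of degree two has adjacent neighbours. -/
lemma IsMin.adj_of_degree_two (hE : IsMin k E) {v a b : V} (hv : Nb E v [a, b]) :
    s(a, b) ∈ E := by
  by_contra hab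
  have hg := hE.graph
  have hne : a ≠ b := by simpa using hv.1
  have hvn := hv.notMem hg
  simp only [List.mem_cons, List.not_mem_nil, or_false, not_or] at hvn
  have hF : GraphOn (Finset.univ.erase v) ({s(a, b)} + del E v) :=
    (hg.del v).cons hne (fun h => hab (mem_del.1 h).1) subset_rfl
      (by simp [Ne.symm hvn.1]) (by simp [Ne.symm hvn.2])
  have hEeq := eq_star_add_del hg hv
  have hcard : (Finset.univ.erase v).card + 1 = Fintype.card V := by
    rw [Finset.card_erase_of_mem (Finset.mem_univ _), Finset.card_univ]
    have : 0 < Fintype.card V := Fintype.card_pos_iff.2 ⟨v⟩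
    omega
  have hdec := hE.dec _ _ hF ⟨a, by simp [Ne.symm hvn.1], fun x hx => ?_⟩ (fun x => ?_)
    (by omega)
  -- The added edge `ab` becomes the path `a v b`.
  · have := hdec.subdivide (M := [v]) (by simp) (by simp)
    refine hE.false_of_dec this ?_ (by omega)
    refine hEeq.trans ?_
    simp only [List.cons_append, List.nil_append, pathEdges_cons_cons, pathEdges_singleton,
      star_cons, star_nil, Sym2.eq_swap (a := a) (b := v)]
  · have hroot : ∀ r ∈ Finset.univ.erase v, ∀ q, s(r, q) ∈ E → s(r, q) ∉ {s(a, b)} + del E v →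
        r = a ∨ r = b := by
      intro r hr q hq hq'
      have hrv : r ≠ v := by simpa using hr
      by_cases hqv : q = v
      · subst hqv
        have := (hv.2 r).1 (by rwa [Sym2.eq_swap])
        simpa using this
      · exact absurd (Multiset.mem_add.2 (.inr (mk_mem_del.2 ⟨hq, hrv, hqv⟩))) hq'
    obtain ⟨r, rfl | rfl, hxr⟩ := hE.reach_of_roots hF (o := v) (by simp) hroot hx
    · exact hxr
    · exact hxr.trans (Reach.of_mem (by simp [Sym2.eq_swap]))
  · have := hE.deg_le x
    rw [hEeq] at this
    simp only [deg_add, star_cons, star_nil, deg_singleton, Sym2.mem_iff, deg_zero] at this ⊢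
    split_ifs at this ⊢ <;> first | omega | tauto

/-- There is no cut-edge between vertices of even degree. -/
lemma IsMin.not_cut_edge (hE : IsMin k E) {u v : V} (huv : s(u, v) ∈ E) (hu : Even (deg E u))
    (hv : Even (deg E v)) {M : Finset V} (huM : u ∈ M) (hvM : v ∉ M)
    (hM : ∀ a b, s(a, b) ∈ E → a ∈ M → b ∉ M → a = u ∧ b = v) : False := by
  have hg := hE.graph
  have hside : ∀ (u v : V) (M : Finset V), s(u, v) ∈ E → Even (deg E u) → u ∈ M → v ∉ M →
      (∀ a b, s(a, b) ∈ E → a ∈ M → b ∉ M → a = u ∧ b = v) →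
      ∃ B L, IsDec (M : Set V) (restr E M) ((u :: B) ::ₘ L) ∧ L.card + 1 ≤ (M.card + 1) / 2 := by
    intro u v M huv hu huM hvM hM
    -- On its own side `u` loses only the cut-edge, so its degree there is odd and some path ends at
    -- `u`.
    have hd := deg_eq_deg_restr_add_one hg huv huM hvM fun y hy hyM => (hM u y hy huM hyM).2
    have hdec := hE.dec M (restr E M) hg.restr ⟨u, huM, fun x hx => ?_⟩
      (fun x => (deg_le_of_le (restr_le _ _) x).trans (hE.deg_le x)) ?_
    · obtain ⟨L, hL, hc⟩ := hdec
      obtain ⟨B, L', hL', hc'⟩ := hL.exists_end (a := u) (by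
        rw [hd, Nat.even_add_one, Nat.not_even_iff_odd] at hu
        exact hu)
      exact ⟨B, L', hL', by omega⟩
    · obtain ⟨r, hr, hxr⟩ := hE.reach_of_roots (hg.restr (T := M)) hvM (P := fun r => r = u)
        (fun r hr q hq hq' => (hM r q hq hr fun hqM => hq' (mk_mem_restr.2 ⟨hq, hr, hqM⟩)).1) hx
      exact hr ▸ hxr
    · rw [← Finset.card_univ]
      exact Finset.card_lt_card (Finset.ssubset_univ_iff.2 fun h => hvM (h ▸ Finset.mem_univ v))
  obtain ⟨B, L, hL, hc⟩ := hside u v M huv hu huM hvM hM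
  obtain ⟨B', L', hL', hc'⟩ := hside v u Mᶜ (by rwa [Sym2.eq_swap]) hv (by simpa using hvM)
    (by simpa using huM) (fun a b hab ha hb => by
      rw [Finset.mem_compl] at ha hb
      rw [not_not] at hb
      exact (hM b a (by rwa [Sym2.eq_swap]) hb ha).symm)
  obtain ⟨hp, hpM, F, hF, hEq⟩ := hL.uncons
  obtain ⟨hp', hpM', F', hF', hEq'⟩ := hL'.uncons
  apply hE.not_dec
  -- Joining the two paths through `uv` saves one path, which makes up for the rounding on the two
  -- sides.
  refine ⟨(B.reverse ++ u :: v :: B') ::ₘ (L + L'), ?_, ?_⟩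
  · have hsum : E = pathEdges (B.reverse ++ u :: v :: B') + (F + F') := by
      have h1 : E = {s(u, v)} + restr E M + restr E Mᶜ := by
        refine (Multiset.Nodup.ext hg.nodup ?_).2 fun e => ?_
        · rw [add_assoc, Multiset.singleton_add, Multiset.nodup_cons, Multiset.nodup_add]
          refine ⟨?_, hg.restr.nodup, hg.restr.nodup, ?_⟩
          · rw [Multiset.mem_add, mk_mem_restr, mk_mem_restr]
            simp [huM, hvM]
          · rw [Multiset.disjoint_left]
            intro e he he'
            induction e with
            | _ a b =>
              rw [mk_mem_restr] at he he'
              exact Finset.mem_compl.1 he'.2.1 he.2.1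
        · induction e with
          | _ a b =>
            rw [Multiset.mem_add, Multiset.mem_add, mk_mem_restr, mk_mem_restr,
              Multiset.mem_singleton, Finset.mem_compl, Finset.mem_compl]
            have h1 := hM a b
            have h2 := hM b a
            rw [Sym2.eq_swap (a := b)] at h2
            constructor
            · intro h
              by_cases ha : a ∈ M <;> by_cases hb : b ∈ M
              · simp [h, ha, hb]
              · obtain ⟨rfl, rfl⟩ := h1 h ha hb
                simp
              · obtain ⟨rfl, rfl⟩ := h2 h hb ha
                simp [Sym2.eq_swap]
              · simp [h, ha, hb]
            · rintro ((h | h) | h)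
              · rwa [h]
              · exact h.1
              · exact h.1
      rw [h1, hEq, hEq', pathEdges_append_cons_cons, ← pathEdges_reverse (u :: B),
        List.reverse_cons]
      abel
    rw [hsum]
    refine ((hF.mono (Set.subset_univ _)).add (hF'.mono (Set.subset_univ _))).cons ?_ (by simp)
    have hdis : ∀ x ∈ u :: B, x ∉ v :: B' := fun x hx hx' =>
      (Finset.mem_compl.1 (hpM' x hx')) (hpM x hx)
    grind [List.nodup_append, List.nodup_reverse]
  · have := Finset.card_add_card_compl M
    simp only [Multiset.card_cons, Multiset.card_add]
    omega

end Configurations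

/-! ### Configuration C4 with distinct pairs: reduction and parity obstruction -/

section Pairs

variable {V : Type u}

lemma del_comm (E : Multiset (Sym2 V)) (u v : V) : del (del E u) v = del (del E v) u :=
  Multiset.filter_comm _ _ _

lemma restr_add (E F : Multiset (Sym2 V)) (S : Finset V) :
    restr (E + F) S = restr E S + restr F S :=
  Multiset.filter_add _ _ _

lemma restr_singleton_of_mem {a b : V} {S : Finset V} (ha : a ∈ S) (hb : b ∈ S) :
    restr {s(a, b)} S = {s(a, b)} :=
  Multiset.filter_eq_self.2 (by simp [ha, hb])

lemma restr_singleton_of_notMem {a b : V} {S : Finset V} (ha : a ∉ S) :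
    restr {s(a, b)} S = 0 :=
  Multiset.eq_zero_of_forall_notMem fun e he => by
    rw [mem_restr, Multiset.mem_singleton] at he
    obtain ⟨rfl, he⟩ := he
    exact ha (he a (by simp))

/-- Used to treat one odd component separately from everything else. -/
lemma restr_sdiff_add_restr {S C : Finset V} {F : Multiset (Sym2 V)} (hF : GraphOn S F)
    (hC : Closed F C) (hCS : C ⊆ S) : restr F (S \ C) + restr F C = F := by
  rw [← restr_union _ hC Finset.sdiff_disjoint, Finset.sdiff_union_of_subset hCS, hF.restr_self]
  intro a b hab ha
  rw [Finset.mem_sdiff] at *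
  exact ⟨hF.mem _ hab b (by simp), fun hb => ha.2 (hC b a (by rwa [Sym2.eq_swap]) hb)⟩

/-- Two adjacent vertices `u`, `v` of degree four and a non-adjacent pair of neighbours for each,
such that the pairs and the remaining neighbours differ. -/
structure PairConfig (E : Multiset (Sym2 V)) (u v t₁ t₂ t₃ w₁ w₂ w₃ : V) : Prop where
  nb_left : Nb E u [v, t₁, t₂, t₃]
  nb_right : Nb E v [u, w₁, w₂, w₃]
  left : s(t₁, t₂) ∉ E
  right : s(w₁, w₂) ∉ E
  ne : t₃ ≠ w₃
  pair_ne : s(t₁, t₂) ≠ s(w₁, w₂)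

/-- The graph obtained by deleting `u` and `v` and joining the two non-adjacent pairs. -/
noncomputable def pairGraph (E : Multiset (Sym2 V)) (u v t₁ t₂ w₁ w₂ : V) : Multiset (Sym2 V) :=
  {s(t₁, t₂)} + ({s(w₁, w₂)} + del (del E u) v)

lemma PairConfig.symm {E : Multiset (Sym2 V)} {u v t₁ t₂ t₃ w₁ w₂ w₃ : V}
    (h : PairConfig E u v t₁ t₂ t₃ w₁ w₂ w₃) : PairConfig E v u w₁ w₂ w₃ t₁ t₂ t₃ :=
  ⟨h.nb_right, h.nb_left, h.right, h.left, h.ne.symm, h.pair_ne.symm⟩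

lemma pairGraph_symm (E : Multiset (Sym2 V)) (u v t₁ t₂ w₁ w₂ : V) :
    pairGraph E v u w₁ w₂ t₁ t₂ = pairGraph E u v t₁ t₂ w₁ w₂ := by
  rw [pairGraph, pairGraph, del_comm, add_left_comm]

variable [Fintype V] {k : ℕ} {E : Multiset (Sym2 V)} {u v t₁ t₂ t₃ w₁ w₂ w₃ : V}

/-- All vertices but `u` and `v`. -/
noncomputable def others (u v : V) : Finset V := (Finset.univ.erase u).erase v

@[simp] lemma mem_others {u v x : V} : x ∈ others u v ↔ x ≠ v ∧ x ≠ u := by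
  simp [others]

lemma others_comm (u v : V) : others u v = others v u := by
  ext x
  simp [and_comm]

lemma card_others {u v : V} (h : u ≠ v) : (others u v).card + 2 = Fintype.card V := by
  rw [others, Finset.card_erase_of_mem (by simpa using h.symm),
    Finset.card_erase_of_mem (Finset.mem_univ _), Finset.card_univ]
  have : 1 < Fintype.card V := Fintype.one_lt_card_iff.2 ⟨u, v, h⟩
  omega

lemma graphOn_others (hE : IsMin k E) (u v : V) : GraphOn (others u v) (del (del E u) v) :=
  (hE.graph.del u).del v

lemma mk_mem_del_del {u v a b : V} : s(a, b) ∈ del (del E u) v ↔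
    s(a, b) ∈ E ∧ a ∈ others u v ∧ b ∈ others u v := by
  simp only [mk_mem_del, mem_others]
  tauto

/-- After deleting `u` and `v`, every component contains a neighbour of `u` or `v`. -/
lemma exists_reach_neighbour (hE : IsMin k E) {u v : V} {T W : List V} (hu : Nb E u (v :: T))
    (hv : Nb E v (u :: W)) {F : Multiset (Sym2 V)} (hF : GraphOn (others u v) F)
    (hHF : ∀ e ∈ del (del E u) v, e ∈ F) {x : V} (hx : x ∈ others u v) :
    ∃ r, (r ∈ T ∨ r ∈ W) ∧ Reach F x r := by
  refine hE.reach_of_roots hF (o := u) (by simp) ?_ hx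
  intro r hr q hq hq'
  rw [mem_others] at hr
  by_cases hqu : q = u
  · subst hqu
    have := (hu.2 r).1 (by rwa [Sym2.eq_swap])
    rw [List.mem_cons] at this
    tauto
  by_cases hqv : q = v
  · subst hqv
    have := (hv.2 r).1 (by rwa [Sym2.eq_swap])
    rw [List.mem_cons] at this
    tauto
  exact absurd (hHF _ (mk_mem_del_del.2 ⟨hq, by simpa using hr, by simp [hqu, hqv]⟩)) hq'

lemma PairConfig.distinct (hE : IsMin k E) (h : PairConfig E u v t₁ t₂ t₃ w₁ w₂ w₃) :
    u ≠ v ∧ (t₁ ≠ t₂ ∧ t₁ ≠ t₃ ∧ t₂ ≠ t₃) ∧ (w₁ ≠ w₂ ∧ w₁ ≠ w₃ ∧ w₂ ≠ w₃) ∧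
      (t₁ ∈ others u v ∧ t₂ ∈ others u v ∧ t₃ ∈ others u v) ∧
      (w₁ ∈ others u v ∧ w₂ ∈ others u v ∧ w₃ ∈ others u v) := by
  have h1 := h.nb_left.1
  have h2 := h.nb_right.1
  have h3 := h.nb_left.notMem hE.graph
  have h4 := h.nb_right.notMem hE.graph
  simp only [List.nodup_cons, List.mem_cons, List.not_mem_nil, or_false, not_or, mem_others] at *
  grind

lemma PairConfig.nodup_path (hE : IsMin k E) (h : PairConfig E u v t₁ t₂ t₃ w₁ w₂ w₃) :
    [t₃, u, v, w₃].Nodup := by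
  obtain ⟨huv, -, -, ⟨-, -, ht⟩, -, -, hw⟩ := h.distinct hE
  rw [mem_others] at ht hw
  simp [huv, ht, hw.1.symm, hw.2.symm, h.ne]

lemma PairConfig.eq (hE : IsMin k E) (h : PairConfig E u v t₁ t₂ t₃ w₁ w₂ w₃) :
    E = {s(u, v)} + ({s(u, t₁)} + ({s(u, t₂)} + {s(u, t₃)})) +
      ({s(v, w₁)} + ({s(v, w₂)} + {s(v, w₃)})) + del (del E u) v := by
  simpa using eq_stars_add_del hE.graph h.nb_left h.nb_right

lemma PairConfig.graphOn (hE : IsMin k E) (h : PairConfig E u v t₁ t₂ t₃ w₁ w₂ w₃) :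
    GraphOn (others u v) (pairGraph E u v t₁ t₂ w₁ w₂) := by
  obtain ⟨-, ⟨ht, -⟩, ⟨hw, -⟩, ⟨ht1, ht2, -⟩, hw1, hw2, -⟩ := h.distinct hE
  refine ((graphOn_others hE u v).cons hw (fun hh => h.right (mk_mem_del_del.1 hh).1) subset_rfl
    hw1 hw2).cons ht ?_ subset_rfl ht1 ht2
  rw [Multiset.mem_add, Multiset.mem_singleton, mk_mem_del_del]
  rintro (hh | hh)
  · exact h.pair_ne hh
  · exact h.left hh.1

/-- The edges `ut₃` and `vw₃` are deleted without replacement. The slack this leaves at `t₃` and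
`w₃` is what `attach` needs at the ends of the new path. -/
lemma PairConfig.deg_le (hE : IsMin k E) (h : PairConfig E u v t₁ t₂ t₃ w₁ w₂ w₃) (x : V) :
    deg (pairGraph E u v t₁ t₂ w₁ w₂) x +
      ((if x = t₃ then 1 else 0) + if x = w₃ then 1 else 0) ≤ k := by
  have h1 := hE.deg_le x
  obtain ⟨-, ⟨ht, -⟩, ⟨hw, -⟩, -⟩ := h.distinct hE
  rw [h.eq hE] at h1
  simp only [pairGraph, deg_add, deg_singleton, Sym2.mem_iff] at h1 ⊢
  have e1 : (if x = t₁ ∨ x = t₂ then 1 else 0) ≤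
      (if x = u ∨ x = t₁ then 1 else 0) + if x = u ∨ x = t₂ then 1 else 0 := by grind
  have e2 : (if x = w₁ ∨ x = w₂ then 1 else 0) ≤
      (if x = v ∨ x = w₁ then 1 else 0) + if x = v ∨ x = w₂ then 1 else 0 := by grind
  have e3 : (if x = t₃ then 1 else 0) ≤ if x = u ∨ x = t₃ then 1 else 0 := by grind
  have e4 : (if x = w₃ then 1 else 0) ≤ if x = v ∨ x = w₃ then 1 else 0 := by grind
  omega

lemma PairConfig.four_le (hE : IsMin k E) (h : PairConfig E u v t₁ t₂ t₃ w₁ w₂ w₃) : 4 ≤ k := by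
  have := hE.deg_le u
  rwa [h.nb_left.deg_eq hE.graph] at this

/-- The reduction, given a decomposition of the reduced graph with the path through `t₃`, `u`,
`v`, `w₃` added. -/
lemma PairConfig.false_of_dec (hE : IsMin k E) (h : PairConfig E u v t₁ t₂ t₃ w₁ w₂ w₃)
    {E₁ E₂ : Multiset (Sym2 V)} (hsum : E₁ + E₂ = pairGraph E u v t₁ t₂ w₁ w₂)
    (ht : s(t₁, t₂) ∈ E₁) (hw : s(w₁, w₂) ∈ E₁) {S : Set V} {m₁ m₂ : ℕ} (huS : u ∉ S)
    (hvS : v ∉ S) (h₁ : Dec S E₁ m₁) (h₂ : Dec Set.univ (pathEdges [t₃, u, v, w₃] + E₂) m₂)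
    (hm : m₁ + m₂ ≤ (Fintype.card V + 1) / 2) : False := by
  have huv := (h.distinct hE).1
  obtain ⟨G₁, rfl⟩ := Multiset.exists_cons_of_mem ht
  have hw' : s(w₁, w₂) ∈ G₁ := (Multiset.mem_cons.1 hw).resolve_left h.pair_ne.symm
  obtain ⟨G, rfl⟩ := Multiset.exists_cons_of_mem hw'
  rw [← Multiset.singleton_add, ← Multiset.singleton_add] at hsum h₁
  have hG : G + E₂ = del (del E u) v := by
    apply add_left_cancel (a := {s(t₁, t₂)} + {s(w₁, w₂)})
    rw [pairGraph] at hsum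
    simpa [add_assoc] using hsum
  -- `t₁t₂` becomes `t₁ u t₂`, and then `w₁w₂` becomes `w₁ v w₂`; the path `t₃ u v w₃` covers the
  -- three remaining edges at `u` and `v`.
  have h₃ := h₁.subdivide (M := [u]) (by simp) (by simpa using huS)
  rw [add_left_comm] at h₃
  have h₄ := h₃.subdivide (M := [v]) (by simp) (by
    simp only [List.mem_singleton, forall_eq, Set.mem_union, Set.mem_ofPred_eq, not_or]
    exact ⟨hvS, huv.symm⟩)
  refine hE.false_of_dec (h₄.add h₂) ?_ hm
  refine (h.eq hE).trans ?_
  rw [← hG]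
  simp only [List.cons_append, List.nil_append, pathEdges_cons_cons, pathEdges_singleton,
    Sym2.eq_swap (a := t₁) (b := u), Sym2.eq_swap (a := w₁) (b := v),
    Sym2.eq_swap (a := t₃) (b := u)]
  abel

lemma PairConfig.reach (hE : IsMin k E) (h : PairConfig E u v t₁ t₂ t₃ w₁ w₂ w₃) {x : V}
    (hx : x ∈ others u v) : let F := pairGraph E u v t₁ t₂ w₁ w₂
    Reach F x t₁ ∨ Reach F x t₃ ∨ Reach F x w₁ ∨ Reach F x w₃ := by
  intro F
  obtain ⟨r, hr, hxr⟩ := exists_reach_neighbour hE h.nb_left h.nb_right (h.graphOn hE)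
    (fun e he => by simp [pairGraph, he]) hx
  have e1 : Reach F t₂ t₁ := Reach.symm (Reach.of_mem (by simp [F, pairGraph]))
  have e2 : Reach F w₂ w₁ := Reach.symm (Reach.of_mem (by simp [F, pairGraph]))
  simp only [List.mem_cons, List.not_mem_nil, or_false] at hr
  rcases hr with (rfl | rfl | rfl) | (rfl | rfl | rfl)
  · exact .inl hxr
  · exact .inl (hxr.trans e1)
  · exact .inr (.inl hxr)
  · exact .inr (.inr (.inl hxr))
  · exact .inr (.inr (.inl (hxr.trans e2)))
  · exact .inr (.inr (.inr hxr))

/-- An odd component avoiding both pairs absorbs the new path. -/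
lemma PairConfig.false_of_odd_comp (hE : IsMin k E) (h : PairConfig E u v t₁ t₂ t₃ w₁ w₂ w₃)
    {z : V} (hz : z ∈ others u v) (hodd : Odd (comp (pairGraph E u v t₁ t₂ w₁ w₂) z).card)
    (hdec : Dec (others u v \ comp (pairGraph E u v t₁ t₂ w₁ w₂) z : Finset V)
      (restr (pairGraph E u v t₁ t₂ w₁ w₂) (others u v \ comp (pairGraph E u v t₁ t₂ w₁ w₂) z))
      (((others u v).card + 3) / 2 - ((comp (pairGraph E u v t₁ t₂ w₁ w₂) z).card + 1) / 2))
    (hzt : ¬ Reach (pairGraph E u v t₁ t₂ w₁ w₂) z t₁)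
    (hzw : ¬ Reach (pairGraph E u v t₁ t₂ w₁ w₂) z w₁) : False := by
  have hg := h.graphOn hE
  have hreach := h.reach hE hz
  have hdeg := h.deg_le hE
  set F := pairGraph E u v t₁ t₂ w₁ w₂ with hFdef
  obtain ⟨huv, ⟨ht, -⟩, ⟨hw, -⟩, ⟨ht1, ht2, ht3⟩, hw1, hw2, hw3⟩ := h.distinct hE
  have hsub := comp_subset hg hz
  have hcard := card_others huv
  have hcard2 := Finset.card_le_card hsub
  have htF : s(t₁, t₂) ∈ F := by simp [F, pairGraph]
  have hwF : s(w₁, w₂) ∈ F := by simp [F, pairGraph]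
  have hle := fun x => deg_le_of_le (restr_le F (comp F z)) x
  -- Every component meets `t₁`, `t₃`, `w₁` or `w₃`, so this one contains an end of the new path and
  -- can absorb it.
  have h3 : t₃ ∈ comp F z ∨ w₃ ∈ comp F z := by
    simpa only [mem_comp, hzt, hzw, false_or] using hreach
  have hatt : Dec Set.univ (pathEdges [t₃, u, v, w₃] + restr F (comp F z))
      (((comp F z).card + 1) / 2) := by
    refine attach hE (M := [u, v]) (r := z) (hg.restr (T := comp F z)) (by simp [Reach.refl])
      (fun x hx => reach_restr_comp (mem_comp.1 hx) (mem_comp.1 hx).symm)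
      (fun x => (hle x).trans ((Nat.le_add_right _ _).trans (hdeg x))) hodd (by omega) h.ne h3 ?_ ?_ ?_
      (by simp) ?_ ?_
    · have h1 := hdeg t₃
      have h2 := hle t₃
      simp only [if_true] at h1
      omega
    · have h1 := hdeg w₃
      have h2 := hle w₃
      simp only [if_true] at h1
      omega
    · have := h.four_le hE
      omega
    · exact h.nodup_path hE
    · simp only [List.mem_cons, List.not_mem_nil, or_false, forall_eq_or_imp, forall_eq]
      exact ⟨fun h => by simpa using hsub h, fun h => by simpa using hsub h⟩
  have hmem : ∀ a b, a ∈ others u v → b ∈ others u v → s(a, b) ∈ F → ¬ Reach F z a →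
      s(a, b) ∈ restr F (others u v \ comp F z) := by
    intro a b ha hb hab hza
    rw [mk_mem_restr, Finset.mem_sdiff, Finset.mem_sdiff, mem_comp, mem_comp]
    exact ⟨hab, ⟨ha, hza⟩, hb, fun hzb => hza (hzb.trans (Reach.of_mem hab).symm)⟩
  refine h.false_of_dec hE (restr_sdiff_add_restr hg (closed_comp F z) hsub)
    (hmem t₁ t₂ ht1 ht2 htF hzt) (hmem w₁ w₂ hw1 hw2 hwF hzw) (by simp) (by simp) hdec hatt ?_
  omega

/-- If the reduction fails, then `t₁` and `w₁` lie in different odd components. -/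
lemma PairConfig.odd_comps (hE : IsMin k E) (h : PairConfig E u v t₁ t₂ t₃ w₁ w₂ w₃) :
    let F := pairGraph E u v t₁ t₂ w₁ w₂
    ¬ Reach F t₁ w₁ ∧ Odd (comp F t₁).card ∧ Odd (comp F w₁).card ∧
      ∀ x ∈ others u v, Odd (comp F x).card →
        Dec (others u v \ comp F x : Finset V) (restr F (others u v \ comp F x))
          (((others u v).card + 3) / 2 - ((comp F x).card + 1) / 2) := by
  intro F
  have hg : GraphOn (others u v) F := h.graphOn hE
  have hdeg := h.deg_le hE
  have hreach : ∀ x ∈ others u v, Reach F x t₁ ∨ Reach F x t₃ ∨ Reach F x w₁ ∨ Reach F x w₃ :=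
    fun x hx => h.reach hE hx
  obtain ⟨huv, ⟨ht, -⟩, ⟨hw, -⟩, ⟨ht1, ht2, ht3⟩, hw1, hw2, hw3⟩ := h.distinct hE
  have hcard := card_others huv
  have htF : s(t₁, t₂) ∈ F := by simp [F, pairGraph]
  have hwF : s(w₁, w₂) ∈ F := by simp [F, pairGraph]
  -- If no `t` is connected to a `w`, then `uv` is a cut-edge between vertices of degree four.
  -- Otherwise one of the four roots is superfluous.
  have hroots : ∃ r₁ r₂ r₃, ∀ x ∈ others u v, Reach F x r₁ ∨ Reach F x r₂ ∨ Reach F x r₃ := by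
    by_cases h1 : Reach F t₁ w₁
    · refine ⟨w₁, t₃, w₃, fun x hx => ?_⟩
      rcases hreach x hx with hh | hh | hh | hh
      · exact .inl (hh.trans h1)
      · exact .inr (.inl hh)
      · exact .inl hh
      · exact .inr (.inr hh)
    by_cases h2 : Reach F t₁ w₃
    · refine ⟨w₁, t₃, w₃, fun x hx => ?_⟩
      rcases hreach x hx with hh | hh | hh | hh
      · exact .inr (.inr (hh.trans h2))
      · exact .inr (.inl hh)
      · exact .inl hh
      · exact .inr (.inr hh)
    by_cases h3 : Reach F t₃ w₁
    · refine ⟨w₁, t₁, w₃, fun x hx => ?_⟩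
      rcases hreach x hx with hh | hh | hh | hh
      · exact .inr (.inl hh)
      · exact .inl (hh.trans h3)
      · exact .inl hh
      · exact .inr (.inr hh)
    by_cases h4 : Reach F t₃ w₃
    · refine ⟨w₁, t₁, w₃, fun x hx => ?_⟩
      rcases hreach x hx with hh | hh | hh | hh
      · exact .inr (.inl hh)
      · exact .inr (.inr (hh.trans h4))
      · exact .inl hh
      · exact .inr (.inr hh)
    exfalso
    have hw2' : ∀ {a}, Reach F a w₂ → Reach F a w₁ := fun h => h.trans (Reach.of_mem hwF).symm
    refine hE.not_cut_edge (u := u) (v := v) (M := insert u (comp F t₁ ∪ comp F t₃))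
      ((h.nb_left.2 v).2 (by simp)) (by rw [h.nb_left.deg_eq hE.graph]; exact ⟨2, rfl⟩)
      (by rw [h.nb_right.deg_eq hE.graph]; exact ⟨2, rfl⟩) (by simp) ?_ ?_
    · simp only [Finset.mem_insert, Finset.mem_union, not_or]
      exact ⟨huv.symm, fun hh => by simpa using comp_subset hg ht1 hh,
        fun hh => by simpa using comp_subset hg ht3 hh⟩
    · intro a b hab ha hb
      simp only [Finset.mem_insert, Finset.mem_union, not_or, mem_comp] at ha hb
      rcases ha with rfl | ha
      · refine ⟨rfl, ?_⟩
        have := (h.nb_left.2 b).1 hab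
        simp only [List.mem_cons, List.not_mem_nil, or_false] at this
        rcases this with rfl | rfl | rfl | rfl
        · rfl
        · exact absurd (Reach.refl _ _) hb.2.1
        · exact absurd (Reach.of_mem htF) hb.2.1
        · exact absurd (Reach.refl _ _) hb.2.2
      · exfalso
        have haS : a ∈ others u v := by
          rcases ha with ha | ha
          · exact hg.reach_mem ha ht1
          · exact hg.reach_mem ha ht3
        by_cases hbv : b = v
        · subst hbv
          have := (h.nb_right.2 a).1 (by rwa [Sym2.eq_swap])
          simp only [List.mem_cons, List.not_mem_nil, or_false] at this
          have hau := (mem_others.1 haS).2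
          rcases this with rfl | rfl | rfl | rfl
          · exact hau rfl
          · exact ha.elim h1 h3
          · exact ha.elim (fun hh => h1 (hw2' hh)) fun hh => h3 (hw2' hh)
          · exact ha.elim h2 h4
        · have : s(a, b) ∈ F := by
            simp only [F, pairGraph, Multiset.mem_add]
            exact .inr (.inr (mk_mem_del_del.2 ⟨hab, haS, by simp [hb.1, hbv]⟩))
          rcases ha with ha | ha
          · exact hb.2.1 (ha.trans (Reach.of_mem this))
          · exact hb.2.2 (ha.trans (Reach.of_mem this))
  obtain ⟨r₁, r₂, r₃, hr⟩ := hroots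
  rcases dec_or_odd_comps hE hg (fun x => (Nat.le_add_right _ _).trans (hdeg x)) (by omega) hr with
    hdec | ⟨hsplit, x, hx, y, hy, hxo, hyo, hxy⟩
  · exfalso
    refine h.false_of_dec hE (add_zero _) htF hwF (by simp) (by simp) hdec
      (m₂ := 1) ?_ (by omega)
    rw [add_zero]
    exact dec_path (h.nodup_path hE)
  -- Any other odd component would absorb the new path; so two different odd components are exactly
  -- those of `t₁` and `w₁`.
  have key : ∀ z ∈ others u v, Odd (comp F z).card → Reach F z t₁ ∨ Reach F z w₁ := by
    intro z hz hodd
    by_contra! hh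
    exact h.false_of_odd_comp hE hz hodd (hsplit z hz hodd) hh.1 hh.2
  rcases key x hx hxo with hx1 | hx1 <;> rcases key y hy hyo with hy1 | hy1
  · exact absurd (hx1.trans hy1.symm) hxy
  · rw [comp_eq_of_reach hx1] at hxo
    rw [comp_eq_of_reach hy1] at hyo
    exact ⟨fun hh => hxy ((hx1.trans hh).trans hy1.symm), hxo, hyo, hsplit⟩
  · rw [comp_eq_of_reach hx1] at hxo
    rw [comp_eq_of_reach hy1] at hyo
    exact ⟨fun hh => hxy ((hx1.trans hh.symm).trans hy1.symm), hyo, hxo, hsplit⟩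
  · exact absurd (hx1.trans hy1.symm) hxy

end Pairs

/-! ### Configuration C4 with distinct pairs: where `t₃` and `w₃` lie -/

section Pairs

variable {V : Type u} [Fintype V] {k : ℕ} {E : Multiset (Sym2 V)} {u v t₁ t₂ t₃ w₁ w₂ w₃ : V}

/-- If `t₃` and `w₃` lie outside the odd component of `w₁`, then `v` is a cut-vertex and the graph
is reduced by splitting there. -/
lemma PairConfig.false_of_separated (hE : IsMin k E) (h : PairConfig E u v t₁ t₂ t₃ w₁ w₂ w₃)
    (hodd : Odd (comp (pairGraph E u v t₁ t₂ w₁ w₂) w₁).card)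
    (ht₁ : ¬ Reach (pairGraph E u v t₁ t₂ w₁ w₂) w₁ t₁)
    (ht₃ : ¬ Reach (pairGraph E u v t₁ t₂ w₁ w₂) w₁ t₃)
    (hw₃ : ¬ Reach (pairGraph E u v t₁ t₂ w₁ w₂) w₁ w₃) : False := by
  have hg := h.graphOn hE
  have hEeq := h.eq hE
  have hdegF : ∀ x, deg (pairGraph E u v t₁ t₂ w₁ w₂) x ≤ k :=
    fun x => (Nat.le_add_right _ _).trans (h.deg_le hE x)
  obtain ⟨huv, ⟨ht12, ht13, ht23⟩, -, ⟨ht1, ht2, ht3⟩, hw1, hw2, hw3⟩ := h.distinct hE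
  have hcard := card_others huv
  have hF0 : pairGraph E u v t₁ t₂ w₁ w₂ =
    {s(t₁, t₂)} + ({s(w₁, w₂)} + del (del E u) v) := rfl
  have hH := graphOn_others hE u v
  have hHmem : ∀ a b, s(a, b) ∈ E → a ∈ others u v → b ∈ others u v →
    s(a, b) ∈ del (del E u) v := fun a b h1 h2 h3 => mk_mem_del_del.2 ⟨h1, h2, h3⟩
  set F := pairGraph E u v t₁ t₂ w₁ w₂ with hFdef
  set H := del (del E u) v with hHdef
  have hHF : ∀ e ∈ H, e ∈ F := fun e he => by rw [hF0]; simp [he]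
  set K := comp F w₁ with hK
  have hKS : K ⊆ others u v := comp_subset hg hw1
  have hKcl : Closed H K := fun a b hab => closed_comp F w₁ a b (hHF _ hab)
  have ht₂ : ¬ Reach F w₁ t₂ := fun hh =>
    ht₁ (hh.trans (Reach.of_mem (by rw [hF0]; simp [Sym2.eq_swap])))
  have hw₂ : Reach F w₁ w₂ := Reach.of_mem (by rw [hF0]; simp)
  -- `K` is attached to the rest of the graph only by `vw₁` and `vw₂`. `R` is the other side of `v`,
  -- with `u` kept, and `E₁` is its edge set.
  set R := insert u (others u v \ K) with hR
  set E₁ := restr H (others u v \ K) + star u [t₁, t₂, t₃] with hE₁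
  have huK : u ∉ K := fun hh => by simpa using hKS hh
  have hvK : v ∉ K := fun hh => by simpa using hKS hh
  have hvR : v ∉ R := by simp [hR, huv.symm]
  have hsplit := restr_sdiff_add_restr hH hKcl hKS
  have hEsplit : E = E₁ + ({s(u, v)} + star v [w₁, w₂, w₃] + restr H K) := by
    refine hEeq.trans ?_
    conv_lhs => rw [← hsplit]
    rw [hE₁]
    simp only [star_cons, star_nil]
    abel
  have hE₁le : E₁ ≤ E := by
    conv_rhs => rw [hEsplit]
    exact Multiset.le_add_right _ _
  have hmemR : ∀ x, x ∈ others u v → ¬ Reach F w₁ x → x ∈ others u v \ K := by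
    intro x hx hx'
    rw [Finset.mem_sdiff, hK, mem_comp]
    exact ⟨hx, hx'⟩
  have hgR : GraphOn R E₁ := by
    refine hE.graph.of_le hE₁le ?_
    intro e he x hx
    rw [hE₁, Multiset.mem_add, mem_star] at he
    rcases he with he | ⟨y, hy, rfl⟩
    · exact Finset.mem_insert_of_mem ((mem_restr.1 he).2 x hx)
    · rcases Sym2.mem_iff.1 hx with rfl | rfl
      · exact Finset.mem_insert_self _ _
      · simp only [List.mem_cons, List.not_mem_nil, or_false] at hy
        refine Finset.mem_insert_of_mem ?_
        rcases hy with rfl | rfl | rfl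
        · exact hmemR _ ht1 ht₁
        · exact hmemR _ ht2 ht₂
        · exact hmemR _ ht3 ht₃
  have huE₁ : ∀ b, s(u, b) ∈ E → b ≠ v → s(u, b) ∈ E₁ := by
    intro b hb hbv
    rw [hE₁, Multiset.mem_add, mem_star]
    refine .inr ⟨b, ?_, rfl⟩
    have := (h.nb_left.2 b).1 hb
    rw [List.mem_cons] at this
    exact this.resolve_left hbv
  have hroot : ∀ r ∈ R, ∀ q, s(r, q) ∈ E → s(r, q) ∉ E₁ → r = u ∨ r = w₃ := by
    intro r hr q hq hq'
    rcases Finset.mem_insert.1 hr with rfl | hr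
    · exact .inl rfl
    right
    rw [Finset.mem_sdiff] at hr
    have hrS := mem_others.1 hr.1
    by_cases hqu : q = u
    · subst hqu
      rw [Sym2.eq_swap] at hq hq'
      exact absurd (huE₁ r hq hrS.1) hq'
    by_cases hqv : q = v
    · subst hqv
      have := (h.nb_right.2 r).1 (by rwa [Sym2.eq_swap])
      simp only [List.mem_cons, List.not_mem_nil, or_false] at this
      rcases this with h1 | rfl | rfl | h1
      · exact absurd h1 hrS.2
      · exact absurd (mem_comp.2 (Reach.refl _ _)) hr.2
      · exact absurd (mem_comp.2 hw₂) hr.2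
      · exact h1
    · have hqS : q ∈ others u v := by simp [hqu, hqv]
      have hqH := hHmem r q hq hr.1 hqS
      refine absurd ?_ hq'
      rw [hE₁, Multiset.mem_add, mk_mem_restr]
      refine .inl ⟨hqH, Finset.mem_sdiff.2 hr, Finset.mem_sdiff.2 ⟨hqS, fun hqK => ?_⟩⟩
      exact hr.2 (hKcl q r (by rwa [Sym2.eq_swap]) hqK)
  -- `u` and `w₃` are the only neighbours of `v` in `R`. If they were not connected there, `uv`
  -- would be a cut-edge between vertices of even degree.
  have hw₃u : Reach E₁ u w₃ := by
    by_contra hcon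
    refine hE.not_cut_edge (u := u) (v := v) (M := comp E₁ u)
      ((h.nb_left.2 v).2 (by simp)) (by rw [h.nb_left.deg_eq hE.graph]; exact ⟨2, rfl⟩)
      (by rw [h.nb_right.deg_eq hE.graph]; exact ⟨2, rfl⟩) (by simp [Reach.refl]) ?_ ?_
    · exact fun hh => hvR (comp_subset hgR (Finset.mem_insert_self _ _) hh)
    · intro a b hab ha hb
      have hab' : s(a, b) ∉ E₁ := fun hh => hb (closed_comp E₁ u a b hh ha)
      rcases hroot a (comp_subset hgR (Finset.mem_insert_self _ _) ha) b hab hab' with rfl | rfl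
      · refine ⟨rfl, ?_⟩
        by_contra hbv
        exact hab' (huE₁ b hab hbv)
      · exact absurd (mem_comp.1 ha) hcon
  have hRcard : R.card + K.card + 1 = Fintype.card V := by
    have h1 := Finset.card_le_card hKS
    rw [hR, Finset.card_insert_of_notMem (by simp), Finset.card_sdiff_of_subset hKS]
    omega
  have hKpos : 0 < K.card := Finset.card_pos.2 ⟨w₁, mem_comp.2 (Reach.refl _ _)⟩
  obtain ⟨L₁, hL₁, hc₁⟩ := hE.dec R E₁ hgR ⟨u, Finset.mem_insert_self _ _, fun x hx => by
    obtain ⟨r, rfl | rfl, hxr⟩ := hE.reach_of_roots hgR hvR hroot hx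
    · exact hxr
    · exact hxr.trans hw₃u.symm⟩ (fun x => (deg_le_of_le hE₁le x).trans (hE.deg_le x)) (by omega)
  -- Without `uv` the degree of `u` is odd, so a path on the side of `R` ends at `u`.
  have hdu : deg E₁ u = 3 := by
    rw [hE₁, deg_add, deg_star_self, deg_eq_zero]
    · rfl
    · intro e he hue
      have := (mem_restr.1 he).2 u hue
      simp at this
  obtain ⟨B₁, L₁', hL₁', hc₁'⟩ := hL₁.exists_end (a := u) (by rw [hdu]; decide)
  obtain ⟨hp₁, hpS₁, F₁, hF₁, hEq₁⟩ := hL₁'.uncons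
  obtain ⟨L₂, hL₂, hc₂⟩ := dec_comp hE hg hdegF (by omega) hw1
  have hFK : restr F K = {s(w₁, w₂)} + restr H K := by
    rw [hF0, restr_add, restr_add, restr_singleton_of_notMem, zero_add, restr_singleton_of_mem]
    · exact mem_comp.2 (Reach.refl _ _)
    · exact mem_comp.2 hw₂
    · exact fun hh => ht₁ (mem_comp.1 hh)
  rw [← hK, hFK] at hL₂
  rw [← hK] at hc₂
  obtain ⟨A, B, L₂', hL₂', hc₂'⟩ := hL₂.exists_edge (a := w₁) (b := w₂) (by simp)
  obtain ⟨hp₂, hpS₂, F₂, hF₂, hEq₂⟩ := hL₂'.uncons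
  have hHK : restr H K = pathEdges (A ++ [w₁]) + pathEdges (w₂ :: B) + F₂ := by
    rw [pathEdges_append_cons_cons] at hEq₂
    apply add_left_cancel (a := {s(w₁, w₂)})
    rw [hEq₂]
    abel
  -- The path through the auxiliary edge `w₁w₂` is cut there: one half continues through `v` into
  -- the path ending at `u`, the other through `v` to `w₃`. The number of paths is unchanged, and
  -- since |K| is odd the two bounds add up to the bound for |R| + |K| + 1 vertices.
  refine hE.not_dec ⟨(A ++ w₁ :: v :: u :: B₁) ::ₘ (w₃ :: v :: w₂ :: B) ::ₘ (L₁' + L₂'), ?_, ?_⟩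
  · have hsum : E = pathEdges (A ++ w₁ :: v :: u :: B₁) +
        (pathEdges (w₃ :: v :: w₂ :: B) + (F₁ + F₂)) := by
      refine hEsplit.trans ?_
      rw [hHK, hEq₁]
      simp only [pathEdges_append_cons_cons, pathEdges_cons_cons, star_cons, star_nil,
        Sym2.eq_swap (a := w₁) (b := v), Sym2.eq_swap (a := v) (b := u),
        Sym2.eq_swap (a := w₃) (b := v)]
      abel
    rw [hsum]
    refine (((hF₁.mono (Set.subset_univ _)).add (hF₂.mono (Set.subset_univ _))).cons ?_
      (by simp)).cons ?_ (by simp)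
    · have h1 : w₃ ∉ A ++ w₁ :: w₂ :: B := fun hh => hw₃ (mem_comp.1 (hpS₂ _ hh))
      have h2 : v ∉ A ++ w₁ :: w₂ :: B := fun hh => hvK (hpS₂ _ hh)
      have h3 : w₃ ≠ v := (mem_others.1 hw3).1
      clear * - hp₂ h1 h2 h3
      simp only [List.nodup_append, List.nodup_cons, List.mem_cons, List.mem_append] at *
      grind
    · have h1 : ∀ x ∈ A ++ w₁ :: w₂ :: B, x ∉ u :: B₁ := by
        intro x hx hx'
        have h1 : x ∈ K := hpS₂ x hx
        have h2 : x ∈ R := hpS₁ x hx'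
        rcases Finset.mem_insert.1 h2 with rfl | h2
        · exact huK h1
        · exact (Finset.mem_sdiff.1 h2).2 h1
      have h2 : v ∉ A ++ w₁ :: w₂ :: B := fun hh => hvK (hpS₂ _ hh)
      have h3 : v ∉ u :: B₁ := fun hh => hvR (hpS₁ _ hh)
      clear * - hp₁ hp₂ h1 h2 h3
      simp only [List.nodup_append, List.nodup_cons, List.mem_cons, List.mem_append] at *
      grind
  · simp only [Multiset.card_cons, Multiset.card_add]
    obtain ⟨j, hj⟩ := hodd
    omega

/-- If `w₃` lies in the odd component of `t₁`, and `t₃` does not, then `u` can be kept, with `w₃`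
as its third neighbour. -/
lemma PairConfig.false_of_crossing (hE : IsMin k E) (h : PairConfig E u v t₁ t₂ t₃ w₁ w₂ w₃)
    (hodd : Odd (comp (pairGraph E u v t₁ t₂ w₁ w₂) t₁).card)
    (hw₁ : ¬ Reach (pairGraph E u v t₁ t₂ w₁ w₂) t₁ w₁)
    (hw₃ : Reach (pairGraph E u v t₁ t₂ w₁ w₂) t₁ w₃)
    (ht₃ : ¬ Reach (pairGraph E u v t₁ t₂ w₁ w₂) t₁ t₃) (h1 : w₃ ≠ t₁) (h2 : w₃ ≠ t₂)
    (hdec : Dec (others u v \ comp (pairGraph E u v t₁ t₂ w₁ w₂) t₁ : Finset V)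
      (restr (pairGraph E u v t₁ t₂ w₁ w₂) (others u v \ comp (pairGraph E u v t₁ t₂ w₁ w₂) t₁))
      (((others u v).card + 3) / 2 - ((comp (pairGraph E u v t₁ t₂ w₁ w₂) t₁).card + 1) / 2)) :
    False := by
  have hg := h.graphOn hE
  have hEeq := h.eq hE
  have hdegF := h.deg_le hE
  have hk := h.four_le hE
  obtain ⟨huv, ⟨ht12, ht13, ht23⟩, -, ⟨ht1, ht2, ht3⟩, hw1, hw2, hw3⟩ := h.distinct hE
  have hcard := card_others huv
  have hF0 : pairGraph E u v t₁ t₂ w₁ w₂ =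
    {s(t₁, t₂)} + ({s(w₁, w₂)} + del (del E u) v) := rfl
  have hH := graphOn_others hE u v
  set F := pairGraph E u v t₁ t₂ w₁ w₂ with hFdef
  set H := del (del E u) v with hHdef
  have hHF : ∀ e ∈ H, e ∈ F := fun e he => by rw [hF0]; simp [he]
  set K := comp F t₁ with hK
  have hKS : K ⊆ others u v := comp_subset hg ht1
  have hKcl : Closed H K := fun a b hab => closed_comp F t₁ a b (hHF _ hab)
  have ht₁K : t₁ ∈ K := mem_comp.2 (Reach.refl _ _)
  have ht₂K : t₂ ∈ K := mem_comp.2 (Reach.of_mem (by rw [hF0]; simp))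
  have hw₃K : w₃ ∈ K := mem_comp.2 hw₃
  have hw₁K : w₁ ∉ K := fun hh => hw₁ (mem_comp.1 hh)
  have hw₂K : w₂ ∉ K := fun hh => hw₁ ((mem_comp.1 hh).trans (Reach.of_mem (by
    rw [hF0]; simp [Sym2.eq_swap])))
  have ht₃K : t₃ ∉ K := fun hh => ht₃ (mem_comp.1 hh)
  have huK : u ∉ K := fun hh => by simpa using hKS hh
  have hvK : v ∉ K := fun hh => by simpa using hKS hh
  have hsplit := restr_sdiff_add_restr hH hKcl hKS
  have huH : ∀ e ∈ restr H K, u ∉ e := fun e he hue => huK ((mem_restr.1 he).2 u hue)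
  have hg₁ : GraphOn (insert u K) ({s(u, t₁)} + restr H K) :=
    (hH.restr (T := K)).cons (fun hh => huK (hh ▸ ht₁K)) (fun hh => huH _ hh (by simp))
      (Finset.subset_insert _ _) (by simp) (by simp [ht₁K])
  have hg₂ : GraphOn (insert u K) ({s(u, t₂)} + ({s(u, t₁)} + restr H K)) := by
    refine hg₁.cons (fun hh => huK (hh ▸ ht₂K)) (fun hh => ?_) subset_rfl (by simp) (by simp [ht₂K])
    rcases Multiset.mem_add.1 hh with hh | hh
    · rw [Multiset.mem_singleton, Sym2.congr_right] at hh
      exact ht12 hh.symm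
    · exact huH _ hh (by simp)
  -- Here `w₃ ≠ t₁, t₂` is needed for a simple graph. Adding `u` to the odd set `K` does not raise
  -- the bound.
  have hg₃ : GraphOn (insert u K) ({s(u, w₃)} + ({s(u, t₂)} + ({s(u, t₁)} + restr H K))) := by
    refine hg₂.cons (fun hh => huK (hh ▸ hw₃K)) (fun hh => ?_) subset_rfl (by simp) (by simp [hw₃K])
    rcases Multiset.mem_add.1 hh with hh | hh
    · rw [Multiset.mem_singleton, Sym2.congr_right] at hh
      exact h2 hh
    rcases Multiset.mem_add.1 hh with hh | hh
    · rw [Multiset.mem_singleton, Sym2.congr_right] at hh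
      exact h1 hh
    · exact huH _ hh (by simp)
  have hKcard := Finset.card_le_card hKS
  have hconn : ∀ x ∈ insert u K,
      Reach ({s(u, w₃)} + ({s(u, t₂)} + ({s(u, t₁)} + restr H K))) x u := by
    intro x hx
    have hut₁ : Reach ({s(u, w₃)} + ({s(u, t₂)} + ({s(u, t₁)} + restr H K))) u t₁ :=
      Reach.of_mem (by simp)
    have hut₂ : Reach ({s(u, w₃)} + ({s(u, t₂)} + ({s(u, t₁)} + restr H K))) u t₂ :=
      Reach.of_mem (by simp)
    rcases Finset.mem_insert.1 hx with rfl | hx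
    · exact Reach.refl _ _
    have hxr : Reach (restr F K) x t₁ := reach_restr_comp (mem_comp.1 hx) (mem_comp.1 hx).symm
    refine (hxr.lift fun a b hab => ?_).trans hut₁.symm
    rw [mk_mem_restr, hF0, Multiset.mem_add, Multiset.mem_add, Multiset.mem_singleton,
      Multiset.mem_singleton] at hab
    obtain ⟨hab | hab | hab, ha, hb⟩ := hab
    · rcases Sym2.eq_iff.1 hab with ⟨rfl, rfl⟩ | ⟨rfl, rfl⟩
      · exact hut₁.symm.trans hut₂
      · exact hut₂.symm.trans hut₁
    · exfalso
      rcases Sym2.eq_iff.1 hab with ⟨rfl, rfl⟩ | ⟨rfl, rfl⟩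
      · exact hw₁K ha
      · exact hw₁K hb
    · refine Reach.of_mem ?_
      simp only [Multiset.mem_add, mk_mem_restr]
      exact .inr (.inr (.inr ⟨hab, ha, hb⟩))
  have hdec₁ := hE.dec _ _ hg₃ ⟨u, by simp, hconn⟩ (fun x => ?_)
    (by rw [Finset.card_insert_of_notMem huK]; omega)
  · have hdu : deg ({s(u, w₃)} + ({s(u, t₂)} + ({s(u, t₁)} + restr H K))) u = 3 := by
      simp [deg_eq_zero huH]
    have hnot : ∀ {x}, x ∉ K → x ≠ u → x ∉ ((insert u K : Finset V) : Set V) := by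
      intro x hx hxu
      simp [hx, hxu]
    have ht₃u : t₃ ≠ u := (mem_others.1 ht3).2
    have ht₃v : t₃ ≠ v := (mem_others.1 ht3).1
    -- `u` has odd degree three, so a path ending there can be prolonged to `t₃`. Next `uw₃` becomes
    -- `u v w₃`, and in the rest of the graph `w₁w₂` becomes `w₁ v w₂`.
    have hdec₂ := hdec₁.prolong (a := u) (c := t₃) (by rw [hdu]; decide) (hnot ht₃K ht₃u)
    rw [add_left_comm] at hdec₂
    have hdec₃ := hdec₂.subdivide (M := [v]) (by simp) (by
      simp [hvK, huv.symm, ht₃v.symm])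
    have hFres : restr F (others u v \ K) =
        {s(w₁, w₂)} + restr H (others u v \ K) := by
      rw [hF0, restr_add, restr_add, restr_singleton_of_notMem, zero_add, restr_singleton_of_mem]
      · simp only [Finset.mem_sdiff]
        exact ⟨hw1, hw₁K⟩
      · simp only [Finset.mem_sdiff]
        exact ⟨hw2, hw₂K⟩
      · simp [ht₁K]
    rw [hFres] at hdec
    have hdec₄ := hdec.subdivide (M := [v]) (by simp) (by simp)
    refine hE.false_of_dec (hdec₃.add hdec₄) ?_ ?_
    · refine hEeq.trans ?_
      conv_lhs => rw [← hsplit]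
      simp only [List.cons_append, List.nil_append, pathEdges_cons_cons, pathEdges_singleton,
        Sym2.eq_swap (a := w₁) (b := v), Sym2.eq_swap (a := t₃) (b := u)]
      abel
    · rw [Finset.card_insert_of_notMem huK]
      obtain ⟨j, hj⟩ := hodd
      omega
  · have e1 := hdegF x
    have e2 : deg F x = deg H x + (if x = t₁ ∨ x = t₂ then 1 else 0) +
        if x = w₁ ∨ x = w₂ then 1 else 0 := by
      rw [hF0]
      simp only [deg_add, deg_singleton, Sym2.mem_iff]
      omega
    have e3 := deg_le_of_le (restr_le H K) x
    simp only [deg_add, deg_singleton, Sym2.mem_iff]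
    by_cases hxu : x = u
    · subst hxu
      rw [deg_eq_zero huH]
      simp
      omega
    · simp only [hxu, false_or]
      have e4 : (if x = t₁ ∨ x = t₂ then 1 else 0) =
          (if x = t₁ then 1 else 0) + if x = t₂ then 1 else 0 := by
        clear_value K F H
        grind
      omega

/-- Two adjacent vertices of degree four cannot both have a non-adjacent pair of neighbours, if
the pairs differ and the remaining neighbours differ. -/
lemma PairConfig.false (hE : IsMin k E) (h : PairConfig E u v t₁ t₂ t₃ w₁ w₂ w₃) : False := by
  obtain ⟨hno, ho₁, ho₂, hsplit⟩ := h.odd_comps hE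
  have hg := h.graphOn hE
  obtain ⟨huv, ⟨ht12, ht13, ht23⟩, ⟨hw12, hw13, hw23⟩, ⟨ht1, ht2, ht3⟩, hw1, hw2, hw3⟩ :=
    h.distinct hE
  have hsymm := pairGraph_symm E u v t₁ t₂ w₁ w₂
  by_cases hW : ¬ Reach (pairGraph E u v t₁ t₂ w₁ w₂) w₁ t₃ ∧
      ¬ Reach (pairGraph E u v t₁ t₂ w₁ w₂) w₁ w₃
  · exact h.false_of_separated hE ho₂ (fun hh => hno hh.symm) hW.1 hW.2
  by_cases hT : ¬ Reach (pairGraph E u v t₁ t₂ w₁ w₂) t₁ t₃ ∧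
      ¬ Reach (pairGraph E u v t₁ t₂ w₁ w₂) t₁ w₃
  · refine h.symm.false_of_separated hE ?_ ?_ ?_ ?_ <;> rw [hsymm]
    exacts [ho₁, hno, hT.2, hT.1]
  set F := pairGraph E u v t₁ t₂ w₁ w₂ with hF
  have htF : Reach F t₁ t₂ := Reach.of_mem (by simp [hF, pairGraph])
  have hwF : Reach F w₁ w₂ := Reach.of_mem (by simp [hF, pairGraph])
  have hexcl : ∀ x, Reach F t₁ x → ¬ Reach F w₁ x := fun x h1 h2 => hno (h1.trans h2.symm)
  -- The components of `t₁` and `w₁` each contain `t₃` or `w₃`. If `t₃` lies with `t₁` and `w₃` with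
  -- `w₁`, then `uv` is a cut-edge.
  by_cases ht₃ : Reach F t₁ t₃
  · have hw₃ : Reach F w₁ w₃ := by
      by_contra hh
      exact hW ⟨hexcl _ ht₃, hh⟩
    refine hE.not_cut_edge (u := u) (v := v) (M := insert u (comp F t₁))
      ((h.nb_left.2 v).2 (by simp)) (by rw [h.nb_left.deg_eq hE.graph]; exact ⟨2, rfl⟩)
      (by rw [h.nb_right.deg_eq hE.graph]; exact ⟨2, rfl⟩) (by simp) ?_ ?_
    · rw [Finset.mem_insert, not_or]
      exact ⟨huv.symm, fun hh => by simpa using comp_subset hg ht1 hh⟩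
    · intro a b hab ha hb
      simp only [Finset.mem_insert, not_or, mem_comp] at ha hb
      rcases ha with rfl | ha
      · refine ⟨rfl, ?_⟩
        have := (h.nb_left.2 b).1 hab
        simp only [List.mem_cons, List.not_mem_nil, or_false] at this
        rcases this with rfl | rfl | rfl | rfl
        · rfl
        · exact absurd (Reach.refl _ _) hb.2
        · exact absurd htF hb.2
        · exact absurd ht₃ hb.2
      · exfalso
        have haS := hg.reach_mem ha ht1
        by_cases hbv : b = v
        · subst hbv
          have := (h.nb_right.2 a).1 (by rwa [Sym2.eq_swap])
          simp only [List.mem_cons, List.not_mem_nil, or_false] at this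
          rcases this with rfl | rfl | rfl | rfl
          · exact (mem_others.1 haS).2 rfl
          · exact hno ha
          · exact hexcl _ ha hwF
          · exact hexcl _ ha hw₃
        · refine hb.2 (ha.trans (Reach.of_mem ?_))
          simp only [hF, pairGraph, Multiset.mem_add]
          exact .inr (.inr (mk_mem_del_del.2 ⟨hab, haS, by simp [hb.1, hbv]⟩))
  have hw₃ : Reach F t₁ w₃ := by
    by_contra hh
    exact hT ⟨ht₃, hh⟩
  have ht₃' : Reach F w₁ t₃ := by
    by_contra hh
    exact hW ⟨hh, hexcl _ hw₃⟩
  by_cases hc₁ : w₃ ≠ t₁ ∧ w₃ ≠ t₂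
  · exact h.false_of_crossing hE ho₁ hno hw₃ ht₃ hc₁.1 hc₁.2 (hsplit t₁ ht1 ho₁)
  by_cases hc₂ : t₃ ≠ w₁ ∧ t₃ ≠ w₂
  · have hd := hsplit w₁ hw1 ho₂
    rw [others_comm] at hd
    refine h.symm.false_of_crossing hE ?_ ?_ ?_ ?_ hc₂.1 hc₂.2 ?_ <;> rw [hsymm]
    exacts [ho₂, fun hh => hno hh.symm, ht₃', hexcl _ hw₃, hd]
  -- What remains is `w₃` among `t₁`, `t₂` and `t₃` among `w₁`, `w₂`: both are common neighbours of
  -- `u` and `v`, and they are non-adjacent since they lie in different components.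
  have hnadj : s(w₃, t₃) ∉ E := by
    intro hh
    refine ht₃ (hw₃.trans (Reach.of_mem ?_))
    simp only [hF, pairGraph, Multiset.mem_add]
    exact .inr (.inr (mk_mem_del_del.2 ⟨hh, hw3, ht3⟩))
  have hT' : ∃ t, Nb E u [v, w₃, t₃, t] ∧ t ≠ w₃ ∧ Reach F t₁ t := by
    by_cases h1 : w₃ = t₁
    · exact ⟨t₂, h1 ▸ h.nb_left.perm (by
        refine List.Perm.cons _ (List.Perm.cons _ (List.Perm.swap _ _ _))), h1 ▸ ht12.symm, htF⟩
    · have h2 : w₃ = t₂ := by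
        by_contra h2
        exact hc₁ ⟨h1, h2⟩
      refine ⟨t₁, h2 ▸ h.nb_left.perm (List.Perm.cons _ ?_), h2 ▸ ht12, Reach.refl _ _⟩
      exact (List.perm_append_comm (l₁ := [t₁]) (l₂ := [t₂, t₃]))
  have hW' : ∃ w, Nb E v [u, t₃, w, w₃] ∧ s(t₃, w) ∉ E ∧ Reach F w₁ w := by
    by_cases h1 : t₃ = w₁
    · exact ⟨w₂, h1 ▸ h.nb_right, h1 ▸ h.right, hwF⟩
    · have h2 : t₃ = w₂ := by
        by_contra h2
        exact hc₂ ⟨h1, h2⟩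
      refine ⟨w₁, h2 ▸ h.nb_right.perm (List.Perm.cons _ (List.Perm.swap _ _ _)), ?_, Reach.refl _ _⟩
      rw [h2, Sym2.eq_swap]
      exact h.right
  obtain ⟨t, hNt, htw, -⟩ := hT'
  obtain ⟨w, hNw, hnw, hww⟩ := hW'
  have hcfg : PairConfig E u v w₃ t₃ t t₃ w w₃ := by
    refine ⟨hNt, hNw, hnadj, hnw, htw, fun hh => ?_⟩
    rw [Sym2.eq_swap, Sym2.congr_right] at hh
    exact hexcl _ hw₃ (hh ▸ hww)
  -- The relabelled pairs `w₃t₃` and `t₃w` share `t₃`, so their first vertices are connected in the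
  -- new reduced graph.
  exact (hcfg.odd_comps hE).1 (Reach.of_mem (by simp [pairGraph]))

end Pairs

/-! ### Configuration C3, and C4 in general -/

section TwoCommon

variable {V : Type u} [Fintype V] {k : ℕ} {E : Multiset (Sym2 V)} {u v x y a b : V}

/-- Two adjacent vertices of degree four with two adjacent common neighbours `x`, `y` have a third
common neighbour. -/
lemma IsMin.false_of_two_common_adj (hE : IsMin k E) (hu : Nb E u [v, x, y, a])
    (hv : Nb E v [u, x, y, b]) (hab : a ≠ b) (hxy : s(x, y) ∈ E) : False := by
  have hg := hE.graph
  have hun := hu.notMem hg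
  have hvn := hv.notMem hg
  have hu1 := hu.1
  have hv1 := hv.1
  simp only [List.nodup_cons, List.mem_cons, List.not_mem_nil, or_false, not_or] at hun hvn hu1 hv1
  obtain ⟨⟨hvx, hvy, hva⟩, ⟨hxny, hxa⟩, hya, -⟩ := hu1
  obtain ⟨⟨huxn, huyn, hub⟩, ⟨-, hxb⟩, hyb, -⟩ := hv1
  obtain ⟨huv, -, -, hua⟩ := hun
  obtain ⟨-, -, -, hvb⟩ := hvn
  have hEeq := eq_stars_add_del hg hu hv
  simp only [star_cons, star_nil, add_zero] at hEeq
  have hH := graphOn_others hE u v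
  have hcard := card_others huv
  have hxS : x ∈ others u v := by simp [Ne.symm hvx, Ne.symm huxn]
  have hyS : y ∈ others u v := by simp [Ne.symm hvy, Ne.symm huyn]
  have hxyH : s(x, y) ∈ del (del E u) v := mk_mem_del_del.2 ⟨hxy, hxS, hyS⟩
  have hdeg : ∀ z, deg (del (del E u) v) z + ((if z = a then 1 else 0) + if z = b then 1 else 0)
      ≤ k := by
    intro z
    have h1 := hE.deg_le z
    rw [hEeq] at h1
    simp only [deg_add, deg_singleton, Sym2.mem_iff] at h1
    have e3 : (if z = a then 1 else 0) ≤ if z = u ∨ z = a then 1 else 0 := by grind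
    have e4 : (if z = b then 1 else 0) ≤ if z = v ∨ z = b then 1 else 0 := by grind
    omega
  have hk : 4 ≤ k := by
    have := hE.deg_le u
    rwa [hu.deg_eq hg] at this
  have hreach : ∀ z ∈ others u v, Reach (del (del E u) v) z x ∨ Reach (del (del E u) v) z a ∨
      Reach (del (del E u) v) z b := by
    intro z hz
    obtain ⟨r, hr, hzr⟩ := exists_reach_neighbour hE hu hv hH (fun e he => he) hz
    have e1 : Reach (del (del E u) v) y x := Reach.symm (Reach.of_mem hxyH)
    simp only [List.mem_cons, List.not_mem_nil, or_false] at hr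
    rcases hr with (rfl | rfl | rfl) | (rfl | rfl | rfl)
    · exact .inl hzr
    · exact .inl (hzr.trans e1)
    · exact .inr (.inl hzr)
    · exact .inl hzr
    · exact .inl (hzr.trans e1)
    · exact .inr (.inr hzr)
  have hnod : [a, u, y, x, v, b].Nodup := by
    simp only [List.nodup_cons, List.mem_cons, List.not_mem_nil, or_false, not_or]
    clear * - huv hvx hvy hva hxny hxa hya huxn huyn hub hxb hyb hua hvb hab
    grind
  set H := del (del E u) v with hHdef
  have finish : ∀ {S : Set V} {E₁ E₂ : Multiset (Sym2 V)} {m₁ m₂ : ℕ}, E₁ + E₂ = H →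
      s(x, y) ∈ E₁ → u ∉ S → v ∉ S → Dec S E₁ m₁ →
      Dec Set.univ (pathEdges [a, u, y, x, v, b] + E₂) m₂ →
      m₁ + m₂ ≤ (Fintype.card V + 1) / 2 → False := by
    intro S E₁ E₂ m₁ m₂ hsum hmem huS hvS h₁ h₂ hm
    obtain ⟨G₁, rfl⟩ := Multiset.exists_cons_of_mem hmem
    rw [← Multiset.singleton_add] at hsum h₁
    -- The edge `xy` becomes `x u v y`; the new path `a u y x v b` takes `xy` over together with the
    -- other deleted edges.
    have h₃ := h₁.subdivide (M := [u, v]) (by simp [huv]) (by simp [huS, hvS])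
    refine hE.false_of_dec (h₃.add h₂) ?_ hm
    refine hEeq.trans ?_
    conv_lhs => rw [← hsum]
    simp only [List.cons_append, List.nil_append, pathEdges_cons_cons, pathEdges_singleton,
      Sym2.eq_swap (a := x) (b := u), Sym2.eq_swap (a := a) (b := u),
      Sym2.eq_swap (a := y) (b := x), Sym2.eq_swap (a := x) (b := v)]
    abel
  rcases dec_or_odd_comps hE hH (fun z => (Nat.le_add_right _ _).trans (hdeg z)) (by omega)
    hreach with hdec | ⟨hsplit, p, hp, q, hq, hpo, hqo, hpq⟩
  · refine finish (add_zero _) hxyH (by simp) (by simp) hdec (m₂ := 1) ?_ (by omega)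
    rw [add_zero]
    exact dec_path hnod
  -- Of two odd components one avoids `x`, hence also `y`. It contains `a` or `b` but no inner
  -- vertex of the new path, so it can absorb that path.
  have hz : ∃ z ∈ others u v, Odd (comp H z).card ∧ ¬ Reach H z x := by
    by_cases hpx : Reach H p x
    · exact ⟨q, hq, hqo, fun hh => hpq (hpx.trans hh.symm)⟩
    · exact ⟨p, hp, hpo, hpx⟩
  obtain ⟨z, hz, hzo, hzx⟩ := hz
  have hzy : ¬ Reach H z y := fun hh => hzx (hh.trans (Reach.of_mem hxyH).symm)
  have hsub := comp_subset hH hz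
  have hcard2 := Finset.card_le_card hsub
  have hle := fun x => deg_le_of_le (restr_le H (comp H z)) x
  have h3 : a ∈ comp H z ∨ b ∈ comp H z := by
    simpa only [mem_comp, hzx, false_or] using hreach z hz
  have hatt : Dec Set.univ (pathEdges [a, u, y, x, v, b] + restr H (comp H z))
      (((comp H z).card + 1) / 2) := by
    refine attach hE (M := [u, y, x, v]) (r := z) (hH.restr (T := comp H z)) (by simp [Reach.refl])
      (fun x hx => reach_restr_comp (mem_comp.1 hx) (mem_comp.1 hx).symm)
      (fun x => (hle x).trans ((Nat.le_add_right _ _).trans (hdeg x))) hzo (by omega) hab h3 ?_ ?_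
      (by omega) (by simp) hnod ?_
    · have h1 := hdeg a
      have h2 := hle a
      simp only [if_true] at h1
      omega
    · have h1 := hdeg b
      have h2 := hle b
      simp only [if_true] at h1
      omega
    · simp only [List.mem_cons, List.not_mem_nil, or_false, forall_eq_or_imp, forall_eq]
      exact ⟨fun h => by simpa using hsub h, fun h => hzy (mem_comp.1 h),
        fun h => hzx (mem_comp.1 h), fun h => by simpa using hsub h⟩
  refine finish (restr_sdiff_add_restr hH (closed_comp H z) hsub) ?_ (by simp) (by simp)
    (hsplit z hz hzo) hatt (by omega)
  rw [mk_mem_restr, Finset.mem_sdiff, Finset.mem_sdiff, mem_comp, mem_comp]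
  exact ⟨hxyH, ⟨hxS, hzx⟩, hyS, hzy⟩

/-- Two adjacent vertices of degree four with two common neighbours have a third one. -/
lemma IsMin.false_of_two_common (hE : IsMin k E) (hu : Nb E u [v, x, y, a])
    (hv : Nb E v [u, x, y, b]) (hab : a ≠ b) : False := by
  by_cases hxy : s(x, y) ∈ E
  · exact hE.false_of_two_common_adj hu hv hab hxy
  have hg := hE.graph
  have hun := hu.notMem hg
  have hvn := hv.notMem hg
  have hu1 := hu.1
  have hv1 := hv.1
  simp only [List.nodup_cons, List.mem_cons, List.not_mem_nil, or_false, not_or] at hun hvn hu1 hv1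
  obtain ⟨⟨hvx, hvy, hva⟩, ⟨hxny, hxa⟩, hya, -⟩ := hu1
  obtain ⟨⟨huxn, huyn, hub⟩, ⟨-, hxb⟩, hyb, -⟩ := hv1
  obtain ⟨huv, -, -, hua⟩ := hun
  obtain ⟨-, -, -, hvb⟩ := hvn
  have hyu : Nb E u [v, a, y, x] := hu.perm (by
    refine List.Perm.cons _ ?_
    exact (List.reverse_perm [a, y, x]))
  have hxu : Nb E u [v, a, x, y] := hu.perm (by
    refine List.Perm.cons _ ?_
    exact (List.perm_append_comm (l₁ := [x, y]) (l₂ := [a])))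
  have hxv : Nb E v [u, b, x, y] := hv.perm (by
    refine List.Perm.cons _ ?_
    exact (List.perm_append_comm (l₁ := [x, y]) (l₂ := [b])))
  -- Each missing edge among `ay`, `ax`, `bx` would give, with the non-adjacent pair `xy` at the
  -- other vertex, a configuration with distinct pairs.
  have hay : s(a, y) ∈ E := by
    by_contra hh
    refine PairConfig.false hE (⟨hyu, hv, hh, hxy, hxb, ?_⟩ : PairConfig E u v a y x x y b)
    rw [Ne, Sym2.congr_left]
    exact Ne.symm hxa
  have hax : s(a, x) ∈ E := by
    by_contra hh
    refine PairConfig.false hE (⟨hxu, hv, hh, hxy, hyb, ?_⟩ : PairConfig E u v a x y x y b)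
    rw [Ne, Sym2.eq_swap, Sym2.congr_right]
    exact Ne.symm hya
  have hbx : s(b, x) ∈ E := by
    by_contra hh
    refine PairConfig.false hE (⟨hu, hxv, hxy, hh, Ne.symm hya, ?_⟩ : PairConfig E u v x y a b x y)
    rw [Ne, Sym2.eq_swap (a := b), Sym2.congr_right]
    exact hyb
  have hEeq := eq_stars_add_del hg hu hv
  simp only [star_cons, star_nil, add_zero] at hEeq
  have hH := graphOn_others hE u v
  have hcard := card_others huv
  have hxS : x ∈ others u v := by simp [Ne.symm hvx, Ne.symm huxn]
  have hyS : y ∈ others u v := by simp [Ne.symm hvy, Ne.symm huyn]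
  have haS : a ∈ others u v := by simp [Ne.symm hva, Ne.symm hua]
  have hbS : b ∈ others u v := by simp [Ne.symm hvb, Ne.symm hub]
  have haxH : s(a, x) ∈ del (del E u) v := mk_mem_del_del.2 ⟨hax, haS, hxS⟩
  have hayH : s(a, y) ∈ del (del E u) v := mk_mem_del_del.2 ⟨hay, haS, hyS⟩
  have hbxH : s(b, x) ∈ del (del E u) v := mk_mem_del_del.2 ⟨hbx, hbS, hxS⟩
  have hxyH : s(x, y) ∉ del (del E u) v := fun hh => hxy (mk_mem_del_del.1 hh).1
  set H := del (del E u) v with hHdef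
  -- In the reduced graph `xy` takes the place of `ax`. Then `xy` becomes `x u v y`, and the new
  -- path `y u a x v b` restores `ax`; the edges `ay` and `bx` keep the reduced graph connected.
  obtain ⟨H', hH'⟩ := Multiset.exists_cons_of_mem haxH
  rw [← Multiset.singleton_add] at hH'
  have hle : H' ≤ H := by
    rw [hH']
    exact Multiset.le_add_left _ _
  have hg' : GraphOn (others u v) ({s(x, y)} + H') :=
    (hH.of_le hle fun e he => hH.mem e (Multiset.mem_of_le hle he)).cons hxny
      (fun hh => hxyH (Multiset.mem_of_le hle hh)) subset_rfl hxS hyS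
  have hmem : ∀ e ∈ H, e ≠ s(a, x) → e ∈ {s(x, y)} + H' := by
    intro e he hne
    rw [hH', Multiset.mem_add, Multiset.mem_singleton] at he
    exact Multiset.mem_add.2 (.inr (he.resolve_left hne))
  have hayF : s(a, y) ∈ {s(x, y)} + H' := hmem _ hayH (by
    rw [Ne, Sym2.congr_right]; exact Ne.symm hxny)
  have hbxF : s(b, x) ∈ {s(x, y)} + H' := hmem _ hbxH (by
    rw [Ne, Sym2.congr_left]; exact Ne.symm hab)
  have ryx : Reach ({s(x, y)} + H') y x := Reach.symm (Reach.of_mem (by simp))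
  have rax : Reach ({s(x, y)} + H') a x := (Reach.of_mem hayF).trans ryx
  have rbx : Reach ({s(x, y)} + H') b x := Reach.of_mem hbxF
  have hconn : ∀ z ∈ others u v, Reach ({s(x, y)} + H') z x := by
    intro z hz
    -- The neighbours of `u` and `v` meet all components of a graph containing all of `H`, so `ax`
    -- is put back first; each use of it is then replaced by the detour `a y x`.
    have hg'' : GraphOn (others u v) ({s(a, x)} + ({s(x, y)} + H')) := by
      refine hg'.cons (Ne.symm hxa) (fun hh => ?_) subset_rfl haS hxS
      rcases Multiset.mem_add.1 hh with hh | hh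
      · rw [Multiset.mem_singleton, Sym2.eq_swap, Sym2.congr_right] at hh
        exact hya hh.symm
      · have := hH.nodup
        rw [hH', Multiset.singleton_add, Multiset.nodup_cons] at this
        exact this.1 hh
    have hsub : ∀ e ∈ H, e ∈ {s(a, x)} + ({s(x, y)} + H') := by
      intro e he
      rw [hH', Multiset.mem_add] at he
      rcases he with he | he
      · exact Multiset.mem_add.2 (.inl he)
      · simp [he]
    obtain ⟨r, hr, hzr⟩ := exists_reach_neighbour hE hu hv hg'' hsub hz
    have hzr' : Reach ({s(x, y)} + H') z r := hzr.lift fun c d hcd => by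
      rcases Multiset.mem_add.1 hcd with hcd | hcd
      · rw [Multiset.mem_singleton, Sym2.eq_iff] at hcd
        rcases hcd with ⟨rfl, rfl⟩ | ⟨rfl, rfl⟩
        · exact rax
        · exact rax.symm
      · exact Reach.of_mem hcd
    simp only [List.mem_cons, List.not_mem_nil, or_false] at hr
    rcases hr with (rfl | rfl | rfl) | (rfl | rfl | rfl)
    · exact hzr'
    · exact hzr'.trans ryx
    · exact hzr'.trans rax
    · exact hzr'
    · exact hzr'.trans ryx
    · exact hzr'.trans rbx
  have hdec := hE.dec _ _ hg' ⟨x, hxS, hconn⟩ (fun z => by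
    have h1 := hE.deg_le z
    rw [hEeq, hH'] at h1
    simp only [deg_add, deg_singleton, Sym2.mem_iff] at h1 ⊢
    have e1 : (if z = x ∨ z = y then 1 else 0) ≤
      (if z = u ∨ z = x then 1 else 0) + if z = u ∨ z = y then 1 else 0 := by
      clear * -
      grind
    omega) (by omega)
  have hdec' := hdec.subdivide (M := [u, v]) (by simp [huv]) (by simp)
  have hnod : [y, u, a, x, v, b].Nodup := by
    simp only [List.nodup_cons, List.mem_cons, List.not_mem_nil, or_false, not_or]
    clear * - huv hvx hvy hva hxny hxa hya huxn huyn hub hxb hyb hua hvb hab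
    grind
  refine hE.false_of_dec (hdec'.add (dec_path hnod)) ?_ (by omega)
  refine hEeq.trans ?_
  conv_lhs => rw [hH']
  simp only [List.cons_append, List.nil_append, pathEdges_cons_cons, pathEdges_singleton,
    Sym2.eq_swap (a := x) (b := u), Sym2.eq_swap (a := y) (b := u),
    Sym2.eq_swap (a := x) (b := v)]
  abel

/-- Two adjacent vertices of degree four cannot both have a non-adjacent pair of neighbours, if
the remaining neighbours differ. -/
lemma IsMin.false_of_pairs (hE : IsMin k E) {t₁ t₂ t₃ w₁ w₂ w₃ : V}
    (hu : Nb E u [v, t₁, t₂, t₃]) (hv : Nb E v [u, w₁, w₂, w₃]) (ht : s(t₁, t₂) ∉ E)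
    (hw : s(w₁, w₂) ∉ E) (hne : t₃ ≠ w₃) : False := by
  by_cases h : s(t₁, t₂) = s(w₁, w₂)
  · rcases Sym2.eq_iff.1 h with ⟨rfl, rfl⟩ | ⟨rfl, rfl⟩
    · exact hE.false_of_two_common hu hv hne
    · exact hE.false_of_two_common hu (hv.perm (List.Perm.cons _ (List.Perm.swap _ _ _))) hne
  · exact PairConfig.false hE ⟨hu, hv, ht, hw, hne, h⟩

end TwoCommon

/-! ### Configuration C5 with a vertex of degree two -/

section Triangles

variable {V : Type u}

/-- The edges of a path through `u` and five edges at two new vertices `v`, `w` form two paths, if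
both `r` and `s` precede `u` on the path. -/
lemma exists_two_paths_of_before {A₁ A₂ A₃ B : List V} {u v w r s : V}
    (hp : (A₁ ++ r :: (A₂ ++ s :: (A₃ ++ u :: B))).Nodup)
    (hv : v ∉ A₁ ++ r :: (A₂ ++ s :: (A₃ ++ u :: B)))
    (hw : w ∉ A₁ ++ r :: (A₂ ++ s :: (A₃ ++ u :: B))) (hvw : v ≠ w) :
    ∃ p₁ p₂ : List V, p₁.Nodup ∧ p₂.Nodup ∧ pathEdges p₁ + pathEdges p₂ =
      pathEdges (A₁ ++ r :: (A₂ ++ s :: (A₃ ++ u :: B))) +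
        ({s(v, w)} + {s(v, u)} + {s(w, u)} + {s(w, r)} + {s(w, s)}) := by
  -- The segment between `s` and `u` is traversed backwards by the first path, which frees the
  -- second to pass from `s` through `w`, `v` to `u`.
  refine ⟨A₁ ++ r :: w :: (u :: (s :: A₃).reverse), r :: A₂ ++ s :: w :: v :: u :: B, ?_, ?_, ?_⟩
  · simp only [List.nodup_append, List.nodup_cons, List.mem_cons, List.mem_append,
      List.mem_reverse, List.nodup_reverse] at *
    grind
  · simp only [List.nodup_append, List.nodup_cons, List.mem_cons, List.mem_append] at *
    grind
  · have e : pathEdges (A₁ ++ r :: (A₂ ++ s :: (A₃ ++ u :: B))) = pathEdges (A₁ ++ [r]) +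
        (pathEdges (r :: A₂ ++ [s]) + (pathEdges (s :: A₃ ++ [u]) + pathEdges (u :: B))) :=
      (pathEdges_append_cons A₁ r _).trans (congrArg _ ((pathEdges_append_cons (r :: A₂) s _).trans
        (congrArg _ (pathEdges_append_cons (s :: A₃) u _))))
    rw [e, pathEdges_append_cons_cons A₁ r w, pathEdges_append_cons_cons (r :: A₂) s w,
      pathEdges_cons_cons w u (s :: A₃).reverse, pathEdges_cons_cons w, pathEdges_cons_cons v,
      pathEdges_reverse_concat, Sym2.eq_swap (a := r), Sym2.eq_swap (a := s),
      Sym2.eq_swap (a := w) (b := v)]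
    abel

/-- The edges of a path through `u` and five edges at two new vertices `v`, `w` form two paths. -/
lemma exists_two_paths {A B : List V} {u v w r s : V} (hp : (A ++ u :: B).Nodup)
    (hv : v ∉ A ++ u :: B) (hw : w ∉ A ++ u :: B) (hvw : v ≠ w) (hr : [u, v, w, r, s].Nodup) :
    ∃ p₁ p₂ : List V, p₁.Nodup ∧ p₂.Nodup ∧ pathEdges p₁ + pathEdges p₂ =
      pathEdges (A ++ u :: B) +
        ({s(v, w)} + {s(v, u)} + {s(w, u)} + {s(w, r)} + {s(w, s)}) := by
  have key : ∀ {A B : List V} {r s : V}, (A ++ u :: B).Nodup → v ∉ A ++ u :: B →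
      w ∉ A ++ u :: B → [u, v, w, r, s].Nodup → r ∉ A → s ∉ B →
      ∃ p₁ p₂ : List V, p₁.Nodup ∧ p₂.Nodup ∧ pathEdges p₁ + pathEdges p₂ =
        pathEdges (A ++ u :: B) +
          ({s(v, w)} + {s(v, u)} + {s(w, u)} + {s(w, r)} + {s(w, s)}) := by
    intro A B r s hp hv hw hr hrA hsB
    -- The path is cut at `u` and both halves pass through `w`; this fails for both orders of `r`,
    -- `s` only if they lie on the same side of `u`.
    refine ⟨A ++ [u, v, w, r], s :: w :: u :: B, ?_, ?_, ?_⟩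
    · simp only [List.nodup_append, List.nodup_cons, List.mem_cons, List.mem_append] at *
      grind
    · simp only [List.nodup_append, List.nodup_cons, List.mem_cons, List.mem_append] at *
      grind
    · rw [pathEdges_append_cons_cons, pathEdges_append_cons A u B]
      simp only [pathEdges_cons_cons, pathEdges_singleton, Sym2.eq_swap (a := u) (b := v),
        Sym2.eq_swap (a := s) (b := w)]
      abel
  have before : ∀ {A B : List V}, (A ++ u :: B).Nodup → v ∉ A ++ u :: B →
      w ∉ A ++ u :: B → r ∈ A → s ∈ A →
      ∃ p₁ p₂ : List V, p₁.Nodup ∧ p₂.Nodup ∧ pathEdges p₁ + pathEdges p₂ =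
        pathEdges (A ++ u :: B) +
          ({s(v, w)} + {s(v, u)} + {s(w, u)} + {s(w, r)} + {s(w, s)}) := by
    intro A B hp hv hw hrA hsA
    obtain ⟨A₁, A₂, rfl⟩ := List.append_of_mem hrA
    rcases List.mem_append.1 hsA with hs | hs
    · obtain ⟨A₁, A₃, rfl⟩ := List.append_of_mem hs
      simp only [List.append_assoc, List.cons_append] at hp hv hw ⊢
      obtain ⟨p₁, p₂, h1, h2, h3⟩ := exists_two_paths_of_before hp hv hw hvw
      refine ⟨p₁, p₂, h1, h2, h3.trans ?_⟩
      abel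
    · have hsr : s ≠ r := by
        simp only [List.nodup_cons, List.mem_cons, List.not_mem_nil, or_false, not_or] at hr
        exact Ne.symm hr.2.2.2.1
      obtain ⟨A₂, A₃, rfl⟩ := List.append_of_mem ((List.mem_cons.1 hs).resolve_left hsr)
      simp only [List.append_assoc, List.cons_append] at hp hv hw ⊢
      exact exists_two_paths_of_before hp hv hw hvw
  have hr' : [u, v, w, s, r].Nodup := by
    simp only [List.nodup_cons, List.mem_cons] at hr ⊢
    grind
  by_cases h1 : r ∉ A ∧ s ∉ B
  · exact key hp hv hw hr h1.1 h1.2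
  by_cases h2 : s ∉ A ∧ r ∉ B
  · obtain ⟨p₁, p₂, e1, e2, e3⟩ := key hp hv hw hr' h2.1 h2.2
    refine ⟨p₁, p₂, e1, e2, e3.trans ?_⟩
    abel
  by_cases hrA : r ∈ A
  · have hrB : r ∉ B := by
      simp only [List.nodup_append, List.nodup_cons, List.mem_cons] at hp
      grind
    have hsA : s ∈ A := by
      by_contra hh
      exact h2 ⟨hh, hrB⟩
    exact before hp hv hw hrA hsA
  · have hsB : s ∈ B := by
      by_contra hh
      exact h1 ⟨hrA, hh⟩
    have hsA : s ∉ A := by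
      simp only [List.nodup_append, List.nodup_cons, List.mem_cons] at hp
      grind
    have hrB : r ∈ B := by
      by_contra hh
      exact h2 ⟨hsA, hh⟩
    have hrev : (A ++ u :: B).reverse = B.reverse ++ u :: A.reverse := by simp
    rw [← List.mem_reverse] at hv hw
    rw [← List.nodup_reverse] at hp
    rw [← pathEdges_reverse (A ++ u :: B)]
    rw [hrev] at hp hv hw ⊢
    exact before hp hv hw (List.mem_reverse.2 hrB) (List.mem_reverse.2 hsB)

variable [Fintype V] {k : ℕ} {E : Multiset (Sym2 V)} {u v w r s p q : V}

/-- Two adjacent vertices of degree two with a common neighbour span a component. -/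
lemma IsMin.false_of_triangle_two_two (hE : IsMin k E) (hv : Nb E v [w, u]) (hw : Nb E w [v, u])
    (hu : deg E u = 4) : False := by
  have hg := hE.graph
  have hvn := hv.notMem hg
  have hwn := hw.notMem hg
  simp only [List.mem_cons, List.not_mem_nil, or_false, not_or] at hvn hwn
  have hEeq := eq_stars_add_del hg hv hw
  simp only [star_cons, star_nil, add_zero] at hEeq
  have hH := graphOn_others hE v w
  have hcard := card_others hvn.1
  have huS : u ∈ others v w := by simp [Ne.symm hwn.2, Ne.symm hvn.2]
  obtain ⟨L, hL, hc⟩ := hE.dec _ _ hH ⟨u, huS, fun z hz => by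
    obtain ⟨t, ht, hzt⟩ := exists_reach_neighbour hE hv hw hH (fun e he => he) hz
    simp only [List.mem_cons, List.not_mem_nil, or_false, or_self] at ht
    exact ht ▸ hzt⟩ (fun z => (deg_le_of_le ((del_le _ _).trans (del_le _ _)) z).trans
      (hE.deg_le z)) (by omega)
  have hdu : deg (del (del E v) w) u ≠ 0 := by
    rw [hEeq] at hu
    simp only [deg_add, deg_singleton, Sym2.mem_iff, Ne.symm hvn.2, Ne.symm hwn.2, or_true,
      or_self, if_true, if_false] at hu
    omega
  obtain ⟨A, B, L', hL', hc'⟩ := hL.exists_vertex hdu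
  obtain ⟨hp, hpS, F, hF, hFeq⟩ := hL'.uncons
  have hvp : v ∉ A ++ u :: B := fun hh => by simpa using hpS _ hh
  have hwp : w ∉ A ++ u :: B := fun hh => by simpa using hpS _ hh
  -- A path through `u` is cut at `u`, and its halves share the edges of the triangle.
  refine hE.not_dec ⟨(A ++ [u, v, w]) ::ₘ (w :: u :: B) ::ₘ L', ?_, ?_⟩
  · have hsum : E = pathEdges (A ++ [u, v, w]) + (pathEdges (w :: u :: B) + F) := by
      refine hEeq.trans ?_
      rw [hFeq, pathEdges_append_cons_cons, pathEdges_append_cons A u B]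
      simp only [pathEdges_cons_cons, pathEdges_singleton, Sym2.eq_swap (a := u) (b := v)]
      abel
    rw [hsum]
    refine ((hF.mono (Set.subset_univ _)).cons ?_ (by simp)).cons ?_ (by simp)
    · clear * - hp hwp
      simp only [List.nodup_append, List.nodup_cons, List.mem_cons, List.mem_append] at *
      grind
    · clear * - hp hwp hvp hvn
      simp only [List.nodup_append, List.nodup_cons, List.mem_cons, List.mem_append] at *
      grind
  · simp only [Multiset.card_cons]
    omega

/-- The reduction at a triangle with a vertex of degree two, when an odd component of the rest
avoids `u`. -/
lemma IsMin.false_of_triangle_odd_comp (hE : IsMin k E) (hv : Nb E v [w, u])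
    (hw : Nb E w [v, u, r, s]) (hu : deg E u = 4)
    (hodd : Odd (comp (del (del E v) w) r).card) (hru : ¬ Reach (del (del E v) w) r u)
    (hdec : Dec (others v w \ comp (del (del E v) w) r : Finset V)
      (restr (del (del E v) w) (others v w \ comp (del (del E v) w) r))
      (((others v w).card + 3) / 2 - ((comp (del (del E v) w) r).card + 1) / 2)) : False := by
  have hg := hE.graph
  have hvn := hv.notMem hg
  have hwn := hw.notMem hg
  have hv1 := hv.1
  have hw1 := hw.1
  simp only [List.nodup_cons, List.mem_cons, List.not_mem_nil, or_false, not_or] at hvn hwn hv1 hw1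
  have hEeq := eq_stars_add_del hg hv hw
  simp only [star_cons, star_nil, add_zero] at hEeq
  have hH := graphOn_others hE v w
  have hcard := card_others hvn.1
  have huS : u ∈ others v w := by simp [Ne.symm hwn.2.1, Ne.symm hvn.2]
  have hrS : r ∈ others v w := by simp [Ne.symm hwn.2.2.1, Ne.symm hw1.1.2.1]
  have hdeg : ∀ z, deg (del (del E v) w) z + (if z = r then 1 else 0) ≤ k := by
    intro z
    have h1 := hE.deg_le z
    rw [hEeq] at h1
    simp only [deg_add, deg_singleton, Sym2.mem_iff] at h1
    have e3 : (if z = r then 1 else 0) ≤ if z = w ∨ z = r then 1 else 0 := by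
      clear * -
      grind
    omega
  have hdu : deg (del (del E v) w) u ≠ 0 := by
    rw [hEeq] at hu
    simp only [deg_add, deg_singleton, Sym2.mem_iff, Ne.symm hvn.2, Ne.symm hwn.2.1, hw1.2.1.1,
      hw1.2.1.2, or_true, or_self, if_true, if_false] at hu
    omega
  obtain ⟨e, he, hue⟩ := exists_mem_of_deg_ne_zero hdu
  obtain ⟨b, rfl⟩ := Sym2.mem_iff_exists.1 hue
  set H := del (del E v) w with hHdef
  set K := comp H r with hK
  have hsub : K ⊆ others v w := comp_subset hH hrS
  have hcard2 := Finset.card_le_card hsub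
  have hle := fun x => deg_le_of_le (restr_le H K) x
  have hvK : v ∉ K := fun h => by simpa using hsub h
  have hwK : w ∉ K := fun h => by simpa using hsub h
  have hrK : r ∈ K := mem_comp.2 (Reach.refl _ _)
  have hsplit := restr_sdiff_add_restr hH (closed_comp H r) hsub
  rw [← hK] at hsplit
  obtain ⟨Q, L₁, hL₁, hc₁⟩ := exists_isDec_end hE (hH.restr (T := K)) hrK
    (fun x hx => reach_restr_comp (mem_comp.1 hx) (mem_comp.1 hx).symm)
    (fun x => (hle x).trans ((Nat.le_add_right _ _).trans (hdeg x))) (by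
      have h1 := hdeg r
      have h2 := hle r
      simp only [if_true] at h1
      omega) hodd (by omega) hvK
  obtain ⟨L₂, hL₂, hc₂⟩ := hdec
  have heR : s(u, b) ∈ restr H (others v w \ K) := by
    rw [mk_mem_restr, Finset.mem_sdiff, Finset.mem_sdiff, hK, mem_comp, mem_comp]
    exact ⟨he, ⟨huS, hru⟩, hH.mem _ he b (by simp), fun hh => hru (hh.trans (Reach.of_mem he).symm)⟩
  obtain ⟨A, B, L₃, hL₃, hc₃⟩ := hL₂.exists_edge heR
  -- `s` lies on at most one side of `u`; the path is oriented so that the half continued from `s w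
  -- u` avoids it.
  have hends : ∃ A B, IsDec ((others v w \ K : Finset V) : Set V) (restr H (others v w \ K))
      ((A ++ u :: B) ::ₘ L₃) ∧ s ∉ B := by
    by_cases hs : s ∈ b :: B
    · refine ⟨(b :: B).reverse, A.reverse, by simpa using hL₃.reverse_head, ?_⟩
      have := hL₃.uncons.1
      clear * - this hs
      rw [List.mem_reverse]
      simp only [List.nodup_append, List.nodup_cons, List.mem_cons] at *
      grind
    · exact ⟨A, b :: B, hL₃, hs⟩
  obtain ⟨A, B, hL₃, hsB⟩ := hends
  obtain ⟨hp₁, hpS₁, F₁, hF₁, hEq₁⟩ := hL₁.uncons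
  obtain ⟨hp₃, hpS₃, F₃, hF₃, hEq₃⟩ := hL₃.uncons
  -- The path ending at `r` in the odd component is continued through `w` and `v` into one half of
  -- the path at `u`, so no additional path arises.
  refine hE.not_dec ⟨(Q ++ r :: w :: v :: u :: A.reverse) ::ₘ (s :: w :: u :: B) ::ₘ (L₁ + L₃),
    ?_, ?_⟩
  · have hsum : E = pathEdges (Q ++ r :: w :: v :: u :: A.reverse) +
        (pathEdges (s :: w :: u :: B) + (F₁ + F₃)) := by
      refine hEeq.trans ?_
      rw [← hsplit, hEq₁, hEq₃, pathEdges_append_cons_cons, pathEdges_append_cons A u B]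
      simp only [pathEdges_cons_cons, pathEdges_reverse_concat, Sym2.eq_swap (a := r) (b := w),
        Sym2.eq_swap (a := s) (b := w), Sym2.eq_swap (a := w) (b := v)]
      abel
    rw [hsum]
    have h2 : v ∉ A ++ u :: B := fun hh => by simpa using hpS₃ _ hh
    have h3 : w ∉ A ++ u :: B := fun hh => by simpa using hpS₃ _ hh
    refine (((hF₁.mono (Set.subset_univ _)).add (hF₃.mono (Set.subset_univ _))).cons ?_
      (by simp)).cons ?_ (by simp)
    · have h1 : s ≠ u := Ne.symm hw1.2.1.2
      have h4 : s ≠ w := Ne.symm hwn.2.2.2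
      clear * - hp₃ h1 h3 h4 hsB
      simp only [List.nodup_append, List.nodup_cons, List.mem_cons, List.mem_append] at *
      grind
    · have h1 : ∀ x ∈ Q ++ [r], x ∉ A ++ u :: B := by
        intro x hx hx'
        have h1 : x ∈ K := hpS₁ x hx
        have h2 : x ∈ others v w \ K := hpS₃ x hx'
        exact (Finset.mem_sdiff.1 h2).2 h1
      have h4 : v ∉ Q ++ [r] := fun hh => hvK (hpS₁ _ hh)
      have h5 : w ∉ Q ++ [r] := fun hh => hwK (hpS₁ _ hh)
      have h6 := hvn.1
      clear * - hp₁ hp₃ h1 h2 h3 h4 h5 h6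
      simp only [List.nodup_append, List.nodup_cons, List.mem_cons, List.mem_append,
        List.mem_reverse, List.nodup_reverse] at *
      grind
  · simp only [Multiset.card_cons, Multiset.card_add]
    omega

/-- A triangle with a vertex of degree two and two vertices of degree four is reducible. -/
lemma IsMin.false_of_triangle_two_four (hE : IsMin k E) (hv : Nb E v [w, u])
    (hw : Nb E w [v, u, r, s]) (hu : deg E u = 4) : False := by
  have hg := hE.graph
  have hvn := hv.notMem hg
  have hwn := hw.notMem hg
  have hw1 := hw.1
  simp only [List.nodup_cons, List.mem_cons, List.not_mem_nil, or_false, not_or] at hvn hwn hw1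
  have hEeq := eq_stars_add_del hg hv hw
  simp only [star_cons, star_nil, add_zero] at hEeq
  have hH := graphOn_others hE v w
  have hcard := card_others hvn.1
  have hdu : deg (del (del E v) w) u ≠ 0 := by
    rw [hEeq] at hu
    simp only [deg_add, deg_singleton, Sym2.mem_iff, Ne.symm hvn.2, Ne.symm hwn.2.1, hw1.2.1.1,
      hw1.2.1.2, or_true, or_self, if_true, if_false] at hu
    omega
  have hreach : ∀ z ∈ others v w, Reach (del (del E v) w) z u ∨ Reach (del (del E v) w) z r ∨
      Reach (del (del E v) w) z s := by
    intro z hz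
    obtain ⟨t, ht, hzt⟩ := exists_reach_neighbour hE hv hw hH (fun e he => he) hz
    simp only [List.mem_cons, List.not_mem_nil, or_false] at ht
    rcases ht with rfl | rfl | rfl | rfl
    · exact .inl hzt
    · exact .inl hzt
    · exact .inr (.inl hzt)
    · exact .inr (.inr hzt)
  rcases dec_or_odd_comps hE hH (fun z => (deg_le_of_le ((del_le _ _).trans (del_le _ _)) z).trans
    (hE.deg_le z)) (by omega) hreach with ⟨L, hL, hc⟩ | ⟨hsplit, x, hx, y, hy, hxo, hyo, hxy⟩
  · obtain ⟨A, B, L', hL', hc'⟩ := hL.exists_vertex hdu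
    obtain ⟨hp, hpS, F, hF, hFeq⟩ := hL'.uncons
    have hvp : v ∉ A ++ u :: B := fun hh => by simpa using hpS _ hh
    have hwp : w ∉ A ++ u :: B := fun hh => by simpa using hpS _ hh
    have hnod : [u, v, w, r, s].Nodup := by
      simp only [List.nodup_cons, List.mem_cons, List.not_mem_nil, or_false, not_or]
      clear * - hvn hwn hw1
      grind
    obtain ⟨p₁, p₂, h1, h2, h3⟩ := exists_two_paths hp hvp hwp hvn.1 hnod
    refine hE.not_dec ⟨p₁ ::ₘ p₂ ::ₘ L', ?_, ?_⟩
    · have hsum : E = pathEdges p₁ + (pathEdges p₂ + F) := by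
        refine hEeq.trans ?_
        rw [← add_assoc (pathEdges p₁), h3, hFeq]
        abel
      rw [hsum]
      exact ((hF.mono (Set.subset_univ _)).cons h2 (by simp)).cons h1 (by simp)
    · simp only [Multiset.card_cons]
      omega
  -- Of two odd components one avoids `u`; it then contains `r` or `s`, which play symmetric roles.
  have hz : ∃ z ∈ others v w, Odd (comp (del (del E v) w) z).card ∧
      ¬ Reach (del (del E v) w) z u := by
    by_cases hpx : Reach (del (del E v) w) x u
    · exact ⟨y, hy, hyo, fun hh => hxy (hpx.trans hh.symm)⟩
    · exact ⟨x, hx, hxo, hpx⟩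
  obtain ⟨z, hz, hzo, hzu⟩ := hz
  have hdec := hsplit z hz hzo
  rcases (hreach z hz).resolve_left hzu with hr | hr
  · rw [comp_eq_of_reach hr] at hzo hdec
    exact hE.false_of_triangle_odd_comp hv hw hu hzo (fun hh => hzu (hr.trans hh)) hdec
  · rw [comp_eq_of_reach hr] at hzo hdec
    exact hE.false_of_triangle_odd_comp hv
      (hw.perm (List.Perm.cons _ (List.Perm.cons _ (List.Perm.swap _ _ _)))) hu hzo
      (fun hh => hzu (hr.trans hh)) hdec

end Triangles

/-! ### Configuration C5 with all degrees four -/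

section FullTriangles

variable {V : Type u} {E : Multiset (Sym2 V)} {u v w p q : V}

/-- Two distinct neighbours other than `u` and `v` must be `a` and `b` in some order. -/
lemma Nb.replace_pair {a b : V} (hw : Nb E w [u, v, a, b]) (hp : s(w, p) ∈ E) (hq : s(w, q) ∈ E)
    (hnod : [u, v, p, q].Nodup) : Nb E w [u, v, p, q] := by
  have h1 := (hw.2 p).1 hp
  have h2 := (hw.2 q).1 hq
  refine ⟨hnod, fun y => (hw.2 y).trans ?_⟩
  simp only [List.nodup_cons, List.mem_cons, List.not_mem_nil, or_false, not_or] at *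
  clear hw hp hq
  grind

/-- A path through the edge `pq` and a vertex `w` all of whose neighbours are `p` and `q` starts
with `w`, `p`, `q` or ends with `p`, `q`, `w`. -/
lemma path_eq_of_mem_left {X Y : List V} (hn : (X ++ p :: q :: Y).Nodup)
    (hw : ∀ z, s(w, z) ∈ pathEdges (X ++ p :: q :: Y) → z = p ∨ z = q) (hX : w ∈ X) : X = [w] := by
  obtain ⟨X₁, X₂, rfl⟩ := List.append_of_mem hX
  have h2 : X₂ = [] := by
    rcases X₂ with _ | ⟨c, X₂⟩
    · rfl
    exfalso
    have := hw c (by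
      simp only [List.append_assoc, List.cons_append]
      rw [pathEdges_append_cons_cons]
      simp)
    clear hw
    simp only [List.nodup_append, List.nodup_cons, List.mem_cons, List.mem_append] at hn
    grind
  subst h2
  rcases List.eq_nil_or_concat X₁ with rfl | ⟨X₁, c, rfl⟩
  · rfl
  exfalso
  have := hw c (by
    simp only [List.concat_eq_append, List.append_assoc, List.cons_append, List.nil_append]
    rw [pathEdges_append_cons_cons]
    simp [Sym2.eq_swap])
  clear hw
  simp only [List.concat_eq_append, List.nodup_append, List.nodup_cons, List.mem_cons,
    List.mem_append] at hn
  grind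

variable [Fintype V] {k : ℕ}

/-- The reduction at a triangle `uvw` with `u`, `v`, `w` all joined to the ends of an edge `pq`,
when a path of the decomposition starts with `w`, `p`, `q`. -/
lemma IsMin.false_of_path_triangle (hE : IsMin k E) (hu : Nb E u [v, w, p, q])
    (hv : Nb E v [u, w, p, q]) (hw : Nb E w [u, v, p, q]) {Y : List V} {L : Multiset (List V)}
    (hL : IsDec (others u v : Set V) (del (del E u) v) ((w :: p :: q :: Y) ::ₘ L))
    (hc : L.card + 1 ≤ ((others u v).card + 1) / 2) : False := by
  have hg := hE.graph
  have hun := hu.notMem hg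
  have hvn := hv.notMem hg
  have hwn := hw.notMem hg
  have hu1 := hu.1
  simp only [List.nodup_cons, List.mem_cons, List.not_mem_nil, or_false, not_or] at hun hvn hu1 hwn
  have hEeq := eq_stars_add_del hg hu hv
  simp only [star_cons, star_nil, add_zero] at hEeq
  have hH := graphOn_others hE u v
  have hcard := card_others hun.1
  obtain ⟨hp, hpS, F, hF, hFeq⟩ := hL.uncons
  have hwq : s(q, w) ∈ F := by
    have h1 : s(q, w) ∈ del (del E u) v := by
      refine mk_mem_del_del.2 ⟨?_, ?_, ?_⟩
      · rw [Sym2.eq_swap]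
        exact (hw.2 q).2 (by simp)
      · simp [Ne.symm hun.2.2.2, Ne.symm hvn.2.2.2]
      · simp [Ne.symm hun.2.1, Ne.symm hvn.2.1]
    rw [hFeq, Multiset.mem_add] at h1
    refine h1.resolve_left fun h2 => ?_
    rw [pathEdges_cons_cons, Multiset.mem_add, Multiset.mem_singleton] at h2
    rcases h2 with h2 | h2
    · rw [Sym2.eq_swap, Sym2.congr_right] at h2
      exact hu1.2.2.1 h2.symm
    · exact (List.nodup_cons.1 hp).1 (mem_of_mem_pathEdges h2 (by simp))
  obtain ⟨Z, Z', L', hL', hc'⟩ := hF.exists_edge hwq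
  obtain ⟨hp', hpS', F', hF', hFeq'⟩ := hL'.uncons
  -- After deletion `w` has only the neighbours `p` and `q`, and `wp` is used by the first path; so
  -- the path through `qw` ends at `w`.
  have hZ' : Z' = [] := by
    rcases Z' with _ | ⟨c, Z'⟩
    · rfl
    exfalso
    have hcF : s(w, c) ∈ F := by
      rw [hFeq', pathEdges_append_cons_cons, pathEdges_cons_cons]
      simp
    have hcH : s(w, c) ∈ del (del E u) v := by
      rw [hFeq]
      exact Multiset.mem_add.2 (.inr hcF)
    obtain ⟨hcE, -, hcS⟩ := mk_mem_del_del.1 hcH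
    have hcl := (hw.2 c).1 hcE
    rw [mem_others] at hcS
    simp only [List.mem_cons, List.not_mem_nil, or_false, hcS.1, hcS.2, false_or] at hcl
    rcases hcl with rfl | rfl
    · have := hH.nodup
      rw [hFeq, pathEdges_cons_cons, add_assoc, Multiset.singleton_add, Multiset.nodup_cons] at this
      exact this.1 (Multiset.mem_add.2 (.inr hcF))
    · clear * - hp'
      simp only [List.nodup_append, List.nodup_cons, List.mem_cons] at hp'
      grind
  subst hZ'
  have hup : u ∉ w :: p :: q :: Y := fun hh => by simpa using hpS _ hh
  have hvp : v ∉ w :: p :: q :: Y := fun hh => by simpa using hpS _ hh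
  have hup' : u ∉ Z ++ [q, w] := fun hh => by simpa using hpS' _ hh
  have hvp' : v ∉ Z ++ [q, w] := fun hh => by simpa using hpS' _ hh
  have huv := hun.1
  -- Two paths and the seven deleted edges are rearranged into three paths, using the one additional
  -- path allowed.
  refine hE.not_dec ⟨(w :: p :: v :: u :: q :: Y) ::ₘ (Z ++ [q, v, w, u]) ::ₘ [u, p, q, w] ::ₘ L',
    ?_, ?_⟩
  · have hsum : E = pathEdges (w :: p :: v :: u :: q :: Y) + (pathEdges (Z ++ [q, v, w, u]) +
        (pathEdges [u, p, q, w] + F')) := by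
      refine hEeq.trans ?_
      rw [hFeq, hFeq', pathEdges_append_cons_cons Z q w, pathEdges_append_cons_cons Z q v]
      simp only [pathEdges_cons_cons, pathEdges_singleton, Sym2.eq_swap (a := p) (b := v),
        Sym2.eq_swap (a := q) (b := v), Sym2.eq_swap (a := v) (b := u),
        Sym2.eq_swap (a := w) (b := u)]
      abel
    rw [hsum]
    refine (((hF'.mono (Set.subset_univ _)).cons ?_ (by simp)).cons ?_ (by simp)).cons ?_ (by simp)
    · clear * - hp hup
      simp only [List.nodup_cons, List.mem_cons, List.not_mem_nil] at *
      grind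
    · clear * - hp' hup' hvp' huv
      simp only [List.nodup_append, List.nodup_cons, List.mem_cons, List.mem_append] at *
      grind
    · clear * - hp hup hvp huv
      simp only [List.nodup_cons, List.mem_cons] at *
      grind
  · simp only [Multiset.card_cons]
    omega

/-- A triangle `uvw` of vertices of degree four with the same two further neighbours is
reducible. -/
lemma IsMin.false_of_full_triangle (hE : IsMin k E) (hu : Nb E u [v, w, p, q])
    (hv : Nb E v [u, w, p, q]) (hw : Nb E w [u, v, p, q]) : False := by
  have hg := hE.graph
  have hun := hu.notMem hg
  have hvn := hv.notMem hg
  have hwn := hw.notMem hg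
  have hu1 := hu.1
  simp only [List.nodup_cons, List.mem_cons, List.not_mem_nil, or_false, not_or] at hun hvn hu1 hwn
  have hEeq := eq_stars_add_del hg hu hv
  simp only [star_cons, star_nil, add_zero] at hEeq
  have hH := graphOn_others hE u v
  have hcard := card_others hun.1
  have hwS : w ∈ others u v := by simp [Ne.symm hun.2.1, Ne.symm hvn.2.1]
  have hpS : p ∈ others u v := by simp [Ne.symm hun.2.2.1, Ne.symm hvn.2.2.1]
  have hqS : q ∈ others u v := by simp [Ne.symm hun.2.2.2, Ne.symm hvn.2.2.2]
  have hwp : s(w, p) ∈ del (del E u) v := mk_mem_del_del.2 ⟨(hw.2 p).2 (by simp), hwS, hpS⟩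
  have hwq : s(w, q) ∈ del (del E u) v := mk_mem_del_del.2 ⟨(hw.2 q).2 (by simp), hwS, hqS⟩
  have hconn : ∀ z ∈ others u v, Reach (del (del E u) v) z w := by
    intro z hz
    obtain ⟨t, ht, hzt⟩ := exists_reach_neighbour hE hu hv hH (fun e he => he) hz
    simp only [List.mem_cons, List.not_mem_nil, or_false, or_self] at ht
    rcases ht with rfl | rfl | rfl
    · exact hzt
    · exact hzt.trans (Reach.of_mem hwp).symm
    · exact hzt.trans (Reach.of_mem hwq).symm
  by_cases hpq : s(p, q) ∈ E
  · have hpqH : s(p, q) ∈ del (del E u) v := mk_mem_del_del.2 ⟨hpq, hpS, hqS⟩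
    obtain ⟨L, hL, hc⟩ := hE.dec _ _ hH ⟨w, hwS, hconn⟩ (fun z =>
      (deg_le_of_le ((del_le _ _).trans (del_le _ _)) z).trans (hE.deg_le z)) (by omega)
    obtain ⟨X, Y, L', hL', hc'⟩ := hL.exists_edge hpqH
    obtain ⟨hn, hS, F, hF, hFeq⟩ := hL'.uncons
    have hnbr : ∀ z, s(w, z) ∈ pathEdges (X ++ p :: q :: Y) → z = p ∨ z = q := by
      intro z hz
      have h1 : s(w, z) ∈ del (del E u) v := by
        rw [hFeq]
        exact Multiset.mem_add.2 (.inl hz)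
      obtain ⟨hcE, -, hcS⟩ := mk_mem_del_del.1 h1
      have hcl := (hw.2 z).1 hcE
      rw [mem_others] at hcS
      simpa only [List.mem_cons, List.not_mem_nil, or_false, hcS.1, hcS.2, false_or] using hcl
    by_cases hX : w ∈ X
    · rw [path_eq_of_mem_left hn hnbr hX] at hL'
      exact hE.false_of_path_triangle hu hv hw hL' (by omega)
    by_cases hY : w ∈ Y
    · have hrev : (X ++ p :: q :: Y).reverse = Y.reverse ++ q :: p :: X.reverse := by simp
      have hL'' := hL'.reverse_head
      rw [hrev] at hL''
      rw [← pathEdges_reverse, hrev] at hnbr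
      rw [← List.nodup_reverse, hrev] at hn
      rw [path_eq_of_mem_left hn (fun z hz => (hnbr z hz).symm) (List.mem_reverse.2 hY)] at hL''
      have hsw : ∀ x y, [x, y, p, q].Perm [x, y, q, p] := fun x y =>
        List.Perm.cons _ (List.Perm.cons _ (List.Perm.swap _ _ _))
      exact hE.false_of_path_triangle (hu.perm (hsw _ _)) (hv.perm (hsw _ _)) (hw.perm (hsw _ _))
        hL'' (by omega)
    have hup : u ∉ X ++ p :: q :: Y := fun hh => by simpa using hS _ hh
    have hvp : v ∉ X ++ p :: q :: Y := fun hh => by simpa using hS _ hh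
    -- If `w` is not on the path through `pq`, that path is cut at `p` and both pieces can be led to
    -- `w`.
    refine hE.not_dec ⟨(X ++ [p, v, q, u, w]) ::ₘ (w :: v :: u :: p :: q :: Y) ::ₘ L', ?_, ?_⟩
    · have hsum : E = pathEdges (X ++ [p, v, q, u, w]) +
          (pathEdges (w :: v :: u :: p :: q :: Y) + F) := by
        refine hEeq.trans ?_
        rw [hFeq, pathEdges_append_cons_cons X p q, pathEdges_append_cons_cons X p v]
        simp only [pathEdges_cons_cons, pathEdges_singleton, Sym2.eq_swap (a := p) (b := v),
          Sym2.eq_swap (a := q) (b := u), Sym2.eq_swap (a := v) (b := u),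
          Sym2.eq_swap (a := w) (b := v)]
        abel
      rw [hsum]
      refine ((hF.mono (Set.subset_univ _)).cons ?_ (by simp)).cons ?_ (by simp)
      · clear * - hn hup hvp hY hun hvn hwn
        simp only [List.nodup_append, List.nodup_cons, List.mem_cons, List.mem_append] at *
        grind
      · clear * - hn hup hvp hX hun hvn hwn
        simp only [List.nodup_append, List.nodup_cons, List.mem_cons, List.mem_append] at *
        grind
    · simp only [Multiset.card_cons]
      omega
  · have hg' : GraphOn (others u v) ({s(p, q)} + del (del E u) v) :=
      hH.cons hu1.2.2.1 (fun hh => hpq (mk_mem_del_del.1 hh).1) subset_rfl hpS hqS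
    have hdec := hE.dec _ _ hg' ⟨w, hwS, fun z hz => (hconn z hz).mono fun e he =>
        Multiset.mem_add.2 (.inr he)⟩
      (fun z => by
        have h1 := hE.deg_le z
        rw [hEeq] at h1
        simp only [deg_add, deg_singleton, Sym2.mem_iff] at h1 ⊢
        have e1 : (if z = p ∨ z = q then 1 else 0) ≤
          (if z = u ∨ z = p then 1 else 0) + if z = u ∨ z = q then 1 else 0 := by
          clear * -
          grind
        omega) (by omega)
    -- The added edge `pq` becomes `p u v q`, and `q u w v p` is the one new path.
    have hdec' := hdec.subdivide (M := [u, v]) (by simp [hun.1]) (by simp)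
    have hnod : [q, u, w, v, p].Nodup := by
      simp only [List.nodup_cons, List.mem_cons, List.not_mem_nil, or_false, not_or]
      clear * - hun hvn hwn hu1
      grind
    refine hE.false_of_dec (hdec'.add (dec_path hnod)) ?_ (by omega)
    refine hEeq.trans ?_
    simp only [List.cons_append, List.nil_append, pathEdges_cons_cons, pathEdges_singleton,
      Sym2.eq_swap (a := p) (b := u), Sym2.eq_swap (a := q) (b := u),
      Sym2.eq_swap (a := w) (b := v)]
    abel

/-- In a triangle `uvw` of vertices of degree four, `v` is adjacent to both or none of the further
neighbours of `u`. -/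
lemma IsMin.adj_of_adj_triangle (hE : IsMin k E) {a b : V} (hu : Nb E u [v, w, p, q])
    (hv : Nb E v [u, w, a, b]) (h : s(v, p) ∈ E) : s(v, q) ∈ E := by
  by_contra hq
  have h1 := (hv.2 p).1 h
  have hun := hu.notMem hE.graph
  have hu1 := hu.1
  simp only [List.nodup_cons, List.mem_cons, List.not_mem_nil, or_false, not_or] at h1 hun hu1
  rcases h1 with rfl | rfl | rfl | rfl
  · exact hun.2.2.1 rfl
  · exact hu1.2.1.1 rfl
  -- With `w` and `p` common to `u` and `v`, the result for two common neighbours forces `q` to be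
  -- common too.
  · exact hE.false_of_two_common hu hv fun hh => hq ((hv.2 q).2 (by simp [hh]))
  · exact hE.false_of_two_common hu
      (hv.perm (List.Perm.cons _ (List.Perm.cons _ (List.Perm.swap _ _ _))))
      fun hh => hq ((hv.2 q).2 (by simp [hh]))

/-- In a triangle `uvw` of vertices of degree four, `w` cannot be non-adjacent to all further
neighbours of `u` and `v`. -/
lemma IsMin.false_of_separate_triangle (hE : IsMin k E) {a b : V} (hu : Nb E u [v, w, p, q])
    (hv : Nb E v [u, w, a, b]) (hp : s(w, p) ∉ E) (ha : s(w, a) ∉ E) (hb : s(w, b) ∉ E) :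
    False := by
  -- The pair `wp` at `u` is combined with `wa` or `wb` at `v`, whichever leaves different remaining
  -- neighbours.
  by_cases hqb : q = b
  · refine hE.false_of_pairs hu
      (hv.perm (List.Perm.cons _ (List.Perm.cons _ (List.Perm.swap _ _ _)))) hp hb ?_
    rintro rfl
    have := hv.1
    simp [hqb] at this
  · exact hE.false_of_pairs hu hv hp ha hqb

/-- A triangle of vertices of degree four is reducible. -/
lemma IsMin.false_of_triangle_four (hE : IsMin k E) {a b c d : V} (hu : Nb E u [v, w, p, q])
    (hv : Nb E v [u, w, a, b]) (hw : Nb E w [u, v, c, d]) : False := by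
  have hg := hE.graph
  have hun := hu.notMem hg
  have hvn := hv.notMem hg
  have hu1 := hu.1
  have hv1 := hv.1
  have swap : ∀ x y z t : V, [x, y, z, t].Perm [y, x, z, t] := fun x y z t => List.Perm.swap _ _ _
  have swap' : ∀ x y z t : V, [x, y, z, t].Perm [x, y, t, z] := fun x y z t =>
    List.Perm.cons _ (List.Perm.cons _ (List.Perm.swap _ _ _))
  have huq : Nb E u [v, w, q, p] := hu.perm (swap' _ _ _ _)
  have huw : Nb E u [w, v, p, q] := hu.perm (swap _ _ _ _)
  have huwq : Nb E u [w, v, q, p] := huq.perm (swap _ _ _ _)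
  have hvw : Nb E v [w, u, a, b] := hv.perm (swap _ _ _ _)
  have hwv : Nb E w [v, u, c, d] := hw.perm (swap _ _ _ _)
  simp only [List.nodup_cons, List.mem_cons, List.not_mem_nil, or_false, not_or] at hun hvn hu1 hv1
  -- Either all three vertices share their outer neighbours, or one of them shares none with the
  -- other two; the cases locate that vertex.
  by_cases hvp : s(v, p) ∈ E
  · have hv' : Nb E v [u, w, p, q] := hv.replace_pair hvp (hE.adj_of_adj_triangle hu hv hvp) (by
      simp only [List.nodup_cons, List.mem_cons, List.not_mem_nil, or_false, not_or]
      clear * - hun hu1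
      grind)
    by_cases hwp : s(w, p) ∈ E
    · refine hE.false_of_full_triangle hu hv'
        (hw.replace_pair hwp (hE.adj_of_adj_triangle huw hw hwp) ?_)
      simp only [List.nodup_cons, List.mem_cons, List.not_mem_nil, or_false, not_or]
      clear * - hun hu1
      grind
    · exact hE.false_of_separate_triangle hu hv' hwp hwp
        fun hwq => hwp (hE.adj_of_adj_triangle huwq hw hwq)
  have hvq : s(v, q) ∉ E := fun hh => hvp (hE.adj_of_adj_triangle huq hv hh)
  by_cases hwp : s(w, p) ∈ E
  · refine hE.false_of_separate_triangle huw (hw.replace_pair hwp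
      (hE.adj_of_adj_triangle huw hw hwp) ?_) hvp hvp hvq
    simp only [List.nodup_cons, List.mem_cons, List.not_mem_nil, or_false, not_or]
    clear * - hun hu1
    grind
  by_cases hwa : s(w, a) ∈ E
  · have hua : ∀ z, s(v, z) ∈ E → z ≠ u → z ≠ w → s(u, z) ∉ E := by
      intro z hz hzu hzw hh
      have := (hu.2 z).1 hh
      simp only [List.mem_cons, List.not_mem_nil, or_false] at this
      rcases this with rfl | rfl | rfl | rfl
      · exact hE.graph.ne hz rfl
      · exact hzw rfl
      · exact hvp hz
      · exact hvq hz
    have ha := hua a ((hv.2 a).2 (by simp)) (Ne.symm hv1.1.2.1) (Ne.symm hv1.2.1.1)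
    have hb := hua b ((hv.2 b).2 (by simp)) (Ne.symm hv1.1.2.2) (Ne.symm hv1.2.1.2)
    have hw' : Nb E w [v, u, a, b] := hwv.replace_pair hwa
      (hE.adj_of_adj_triangle hvw hwv hwa) (by
        simp only [List.nodup_cons, List.mem_cons, List.not_mem_nil, or_false, not_or]
        clear * - hvn hv1
        grind)
    exact hE.false_of_separate_triangle hvw hw' ha ha hb
  · exact hE.false_of_separate_triangle hu hv hwp hwa fun hwb =>
      hwa (hE.adj_of_adj_triangle (hvw.perm (swap' _ _ _ _)) hwv hwb)

end FullTriangles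

/-! ### Neighbour lists from degrees, and the final assembly -/

section Neighbours

variable {V : Type u} [Fintype V] {E : Multiset (Sym2 V)}

/-- A list of distinct neighbours extends to a list of all neighbours. -/
lemma exists_nb_append {x : V} {l : List V} (hl : l.Nodup) (h : ∀ y ∈ l, s(x, y) ∈ E) :
    ∃ l', Nb E x (l ++ l') := by
  refine ⟨(Finset.univ.filter fun y => s(x, y) ∈ E ∧ y ∉ l).toList, ?_, fun y => ?_⟩
  · refine hl.append (Finset.nodup_toList _) fun y hy hy' => ?_
    simp only [Finset.mem_toList, Finset.mem_filter] at hy'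
    exact hy'.2.2 hy
  · simp only [List.mem_append, Finset.mem_toList, Finset.mem_filter, Finset.mem_univ, true_and]
    have := h y
    tauto

/-- The degree forces the listed labels to be distinct: a duplicate-free list of all neighbours is
contained in `l` and has the same length. -/
lemma nb_of_length_eq {S : Finset V} (hE : GraphOn S E) {x : V} {l : List V}
    (h : ∀ y, s(x, y) ∈ E ↔ y ∈ l) (hd : deg E x = l.length) : Nb E x l := by
  obtain ⟨l', hl'⟩ := exists_nb_append (E := E) (x := x) (l := []) List.nodup_nil (by simp)
  rw [List.nil_append] at hl'
  refine hl'.perm ((List.subperm_of_subset hl'.1 fun y hy => (h y).1 ((hl'.2 y).2 hy)).perm_of_length_le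
    ?_)
  rw [← hd, hl'.deg_eq hE]

lemma exists_nb_four_of_two {S : Finset V} (hE : GraphOn S E) {x a b : V} (hd : deg E x = 4)
    (hab : a ≠ b) (ha : s(x, a) ∈ E) (hb : s(x, b) ∈ E) : ∃ c d, Nb E x [a, b, c, d] := by
  obtain ⟨l, hl⟩ := exists_nb_append (E := E) (x := x) (l := [a, b]) (by simpa using hab)
    (by simp [ha, hb])
  rw [hl.deg_eq hE, List.length_append] at hd
  obtain ⟨c, d, rfl⟩ := List.length_eq_two.1 (show l.length = 2 by simp at hd; omega)
  exact ⟨c, d, hl⟩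

lemma exists_nb_four_of_three {S : Finset V} (hE : GraphOn S E) {x a b c : V} (hd : deg E x = 4)
    (hn : [a, b, c].Nodup) (ha : s(x, a) ∈ E) (hb : s(x, b) ∈ E) (hc : s(x, c) ∈ E) :
    ∃ d, Nb E x [a, b, c, d] := by
  obtain ⟨l, hl⟩ := exists_nb_append (E := E) (x := x) hn (by simp [ha, hb, hc])
  rw [hl.deg_eq hE, List.length_append] at hd
  obtain ⟨d, rfl⟩ := List.length_eq_one_iff.1 (show l.length = 1 by simp at hd; omega)
  exact ⟨d, hl⟩

lemma nb_two {S : Finset V} (hE : GraphOn S E) {x a b : V} (hd : deg E x = 2) (hab : a ≠ b)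
    (ha : s(x, a) ∈ E) (hb : s(x, b) ∈ E) : Nb E x [a, b] := by
  obtain ⟨l, hl⟩ := exists_nb_append (E := E) (x := x) (l := [a, b]) (by simpa using hab)
    (by simp [ha, hb])
  rw [hl.deg_eq hE, List.length_append] at hd
  obtain rfl := List.length_eq_zero_iff.1 (show l.length = 0 by simpa using hd)
  simpa using hl

end Neighbours

/-- A minimal counterexample contains none of the five configurations. -/
lemma IsMinimalCounterexample.not_contains {k : ℕ} {V : Type u} [Fintype V] {G : SimpleGraph V}
    [DecidableRel G.Adj] (hG : IsMinimalCounterexample k G) :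
    ¬ ContainsC1 G ∧ ¬ ContainsC2 G ∧ ¬ ContainsC3 G ∧ ¬ ContainsC4 G ∧ ¬ ContainsC5 G := by
  have hE := isMin_edgeFinset hG
  have hmem : ∀ a b, s(a, b) ∈ G.edgeFinset.val ↔ G.Adj a b := fun a b => by simp
  have hdeg : ∀ x, deg G.edgeFinset.val x = G.degree x := fun x => by
    convert deg_edgeFinset G x
  generalize hEdef : G.edgeFinset.val = E at hE hmem hdeg
  have hg := hE.graph
  refine ⟨?_, ?_, ?_, ?_, ?_⟩
  · rintro ⟨v, a, b, hd, hN, hab⟩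
    refine hab ((hmem a b).1 (hE.adj_of_degree_two (v := v)
      (nb_of_length_eq hg (fun y => ?_) ((hdeg v).trans hd))))
    have : y ∈ G.neighborSet v ↔ y ∈ ({a, b} : Set V) := by rw [hN]
    simpa [hmem] using this
  · rintro ⟨u, v, huv, hbr, hu, hv⟩
    rw [SimpleGraph.isBridge_iff] at hbr
    -- The side of `u` is what it reaches once the bridge is deleted, so only the bridge leaves it.
    refine hE.not_cut_edge ((hmem u v).2 huv) (hdeg u ▸ hu) (hdeg v ▸ hv)
      (M := Finset.univ.filter fun x => (G.deleteEdges {s(u, v)}).Reachable u x)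
      (by simp) (by simpa using hbr) ?_
    intro a b hab ha hb
    simp only [Finset.mem_filter, Finset.mem_univ, true_and] at ha hb
    have hab' : s(a, b) = s(u, v) := by
      by_contra hne
      refine hb (ha.trans (SimpleGraph.Adj.reachable ?_))
      rw [SimpleGraph.deleteEdges_adj]
      exact ⟨(hmem a b).1 hab, hne⟩
    rcases Sym2.eq_iff.1 hab' with h | ⟨rfl, rfl⟩
    · exact h
    · exact absurd (SimpleGraph.Reachable.refl _) hb
  · rintro ⟨u, v, huv, hc, hu, hv⟩
    obtain ⟨x, y, hxy, hN⟩ := Set.ncard_eq_two.1 hc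
    have hx : x ∈ G.commonNeighbors u v := hN ▸ (by simp)
    have hy : y ∈ G.commonNeighbors u v := hN ▸ (by simp)
    rw [SimpleGraph.mem_commonNeighbors] at hx hy
    obtain ⟨a, ha⟩ := exists_nb_four_of_three hg ((hdeg u).trans hu) (a := v) (b := x) (c := y)
      (by simp [hx.2.ne, hy.2.ne, hxy]) ((hmem _ _).2 huv) ((hmem _ _).2 hx.1) ((hmem _ _).2 hy.1)
    obtain ⟨b, hb⟩ := exists_nb_four_of_three hg ((hdeg v).trans hv) (a := u) (b := x) (c := y)
      (by simp [hx.1.ne, hy.1.ne, hxy]) ((hmem _ _).2 huv.symm) ((hmem _ _).2 hx.2)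
      ((hmem _ _).2 hy.2)
    -- Equal fourth neighbours would be a third common neighbour.
    refine hE.false_of_two_common ha hb ?_
    rintro rfl
    have : a ∈ G.commonNeighbors u v := by
      rw [SimpleGraph.mem_commonNeighbors, ← hmem, ← hmem, ha.2, hb.2]
      simp
    rw [hN] at this
    have hn := ha.1
    rcases this with rfl | rfl <;> simp at hn
  · rintro ⟨u, v, t₁, t₂, t₃, w₁, w₂, w₃, huv, hu, hv, hT, hW, ht, hw, hne⟩
    have key : ∀ {x y a b c : V}, G.Adj x y → G.degree x = 4 →
        G.neighborSet x \ {y} = {a, b, c} → Nb E x [y, a, b, c] := by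
      intro x y a b c hxy hd hN
      refine nb_of_length_eq hg (fun z => ?_) ((hdeg x).trans hd)
      have : z ∈ G.neighborSet x \ {y} ↔ z ∈ ({a, b, c} : Set V) := by rw [hN]
      simp only [Set.mem_sdiff, SimpleGraph.mem_neighborSet, Set.mem_singleton_iff,
        Set.mem_insert_iff] at this
      simp only [hmem, List.mem_cons, List.not_mem_nil, or_false]
      by_cases hz : z = y
      · simp [hz, hxy]
      · simpa [hz] using this
    exact hE.false_of_pairs (key huv hu hT) (key huv.symm hv hW) (fun h => ht ((hmem _ _).1 h))
      (fun h => hw ((hmem _ _).1 h)) hne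
  · rintro ⟨u, v, w, huv, hvw, huw, hu, hv, hw⟩
    have four : ∀ {x a b : V}, G.degree x = 4 → a ≠ b → G.Adj x a → G.Adj x b →
        ∃ c d, Nb E x [a, b, c, d] := fun hd hab ha hb =>
      exists_nb_four_of_two hg ((hdeg _).trans hd) hab ((hmem _ _).2 ha) ((hmem _ _).2 hb)
    have two : ∀ {x a b : V}, G.degree x = 2 → a ≠ b → G.Adj x a → G.Adj x b →
        Nb E x [a, b] := fun hd hab ha hb =>
      nb_two hg ((hdeg _).trans hd) hab ((hmem _ _).2 ha) ((hmem _ _).2 hb)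
    rcases hv with hv | hv <;> rcases hw with hw | hw
    · exact hE.false_of_triangle_two_two (two hv huw.ne.symm hvw huv.symm)
        (two hw huv.ne.symm hvw.symm huw.symm) ((hdeg u).trans hu)
    · obtain ⟨r, s, hr⟩ := four hw huv.ne.symm hvw.symm huw.symm
      exact hE.false_of_triangle_two_four (two hv huw.ne.symm hvw huv.symm) hr ((hdeg u).trans hu)
    · obtain ⟨r, s, hr⟩ := four hv huw.ne.symm hvw huv.symm
      exact hE.false_of_triangle_two_four (two hw huv.ne.symm hvw.symm huw.symm) hr
        ((hdeg u).trans hu)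
    · obtain ⟨p, q, h1⟩ := four hu hvw.ne huv huw
      obtain ⟨a, b, h2⟩ := four hv huw.ne huv.symm hvw
      obtain ⟨c, d, h3⟩ := four hw huv.ne huw.symm hvw.symm
      exact hE.false_of_triangle_four h1 h2 h3

end GallaiPaths

theorem lemma4 (k : ℕ) {V : Type u} [Fintype V] (G : SimpleGraph V) [DecidableRel G.Adj]
    (hG : GallaiPaths.IsMinimalCounterexample k G) :
    ¬ GallaiPaths.ContainsC1 G ∧ ¬ GallaiPaths.ContainsC2 G ∧ ¬ GallaiPaths.ContainsC3 G ∧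
      ¬ GallaiPaths.ContainsC4 G ∧ ¬ GallaiPaths.ContainsC5 G := by
  exact hG.not_contains
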